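/- Let $\mathbb S^2\subset\mathbb R^3$ be the unit sphere with outer unit normal $\nu(x)=x$ and surface measure $\sigma$, let $H^1(\mathbb S^2,\mathbb S^2)=\{m\in H^1(\mathbb S^2,\mathbb R^3): |m|=1 \text{ a.e.}\}$, and for $\kappa>0$ let $$\mathcal E_\kappa(m)=\frac12\int_{\mathbb S^2}|\nabla m|^2+\kappa\bigl(1-\langle m,\nu\rangle^2\bigr)\,d\sigma ,\qquad m\in H^1(\mathbb S^2,\mathbb S^2).$$ A map $m\in H^1(\mathbb S^2,\mathbb S^2)$ is a critical point of $\mathcal E_\kappa$ if $\frac{d}{d\varepsilon}\mathcal E_\kappa\bigl(\frac{m+\varepsilon\varphi}{|m+\varepsilon\varphi|}\bigr)\big|_{\varepsilon=0}=0$ for all $\varphi\in H^1\cap L^\infty(\mathbb S^2,\mathbb R^3)$, and a saddle point if it is a critical point that is neither a local minimizer nor a local maximizer of $\mathcal E_\kappa$ in $H^1(\mathbb S^2,\mathbb S^2)$ (with respect to the $H^1$-norm). With spherical coordinates $\Psi(\theta,\varphi)=(\cos\varphi\sin\theta,\sin\varphi\sin\theta,\cos\theta)$, the axisymmetric map with profile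 $h$ is $\Psi(\theta,\varphi)\mapsto\Psi(h(\theta),\varphi)$. Let $E_{0,2}$ be the set of continuous, piecewise continuously differentiable $h:[0,\pi]\to\mathbb R$ with $h(0)=0$, $h(\pi)=2\pi$, and consider the profile equation $$0=h''+\frac{\cos\theta}{\sin\theta}h'-\frac{\sin 2h}{2\sin^2\theta}-\frac{\kappa}{2}\sin(2h-2\theta)\quad\text{on }(0,\pi).\qquad(1)$$ Let $L^2_{\sin}=L^2((0,\pi),\sin\theta\,d\theta)$, $\hat{\mathcal L}f=\frac1{\sin\theta}(\sin\theta\, f')'-\frac{f}{\sin^2\theta}$, $$D(\hat{\mathcal L})=\{f\in L^2_{\sin}: f,\ f'\sin\in AC_{\rm loc}((0,\pi)),\ \hat{\mathcal L}f\in L^2_{\sin}\},\qquad \|f\|_D=\|f\|_{L^2_{\sin}}+\|\hat{\mathcal L}f\|_{L^2_{\sin}} .$$ Then there are an open neighborhood $I\subset(0,\infty)$ of $4$ and functions $h_\kappa\in E_{0,2}$, $\kappa\in I$, with $h_4(\theta)=2\theta$ on $[0,\pi]$, such that $h_\kappa$ solves (1) for the parameter $\kappa$, $\eta_\kappa:=h_\kappa-2\theta\in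 D(\hat{\mathcal L})$ for all $\kappa\in I$, and $\kappa\mapsto\eta_\kappa$ is continuously differentiable as a map $I\to(D(\hat{\mathcal L}),\|\cdot\|_D)$. Moreover, there are $0<\kappa_1<4<\kappa_2$ with $(\kappa_1,\kappa_2)\subset I$ such that for every $\kappa\in(\kappa_1,\kappa_2)$ the axisymmetric map $m_\kappa:\mathbb S^2\to\mathbb S^2$ with profile $h_\kappa$ is a saddle point of $\mathcal E_\kappa$. -/

import Mathlib

open MeasureTheory Filter Topology Set
open scoped ContDiff

noncomputable section

namespace SphereSaddle

/-! ## The sphere and the Sobolev space `H¹` -/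

/-- Euclidean three-space. -/
abbrev E3 : Type := EuclideanSpace ℝ (Fin 3)

/-- The unit sphere in three-space. The outer unit normal at `x : S2` is `x` itself. -/
abbrev S2 : Type := Metric.sphere (0 : E3) 1

/-- The surface measure on the unit sphere (total mass `4π`). -/
def surf : Measure S2 := (volume : Measure E3).toSphere

/-- The tangential derivative of `U` at a point `x` of the sphere in the direction
`eᵢ - xᵢ x`, the orthogonal projection of the `i`-th unit vector onto the tangent plane at `x`.
It depends only on the restriction of `U` to the sphere, and
`|∇U|² = ∑ i, ‖tangDeriv U i x‖²` is the squared norm of the surface gradient. -/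
def tangDeriv (U : E3 → E3) (i : Fin 3) (x : S2) : E3 :=
  fderiv ℝ U (x : E3) (EuclideanSpace.single i (1 : ℝ) - ((x : E3) i) • (x : E3))

/-- `m ∈ H¹(S², ℝ³)` with surface gradient `G`: `m` and `G` are square integrable, and `(m, G)` is
the `L²`-limit of `(u_j, ∇u_j)` for smooth maps `u_j` on the sphere. (Smooth maps on the sphere are
the restrictions of smooth maps on `ℝ³`; `H¹` is the completion of the smooth maps in the
`H¹`-norm, which on the compact sphere is the same as having a square integrable weak gradient.) -/
def HasH1Gradient (m : S2 → E3) (G : Fin 3 → S2 → E3) : Prop :=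
  MemLp m 2 surf ∧ (∀ i, MemLp (G i) 2 surf) ∧
    ∃ U : ℕ → E3 → E3, (∀ j, ContDiff ℝ ∞ (U j)) ∧
      Tendsto (fun j => eLpNorm (fun x : S2 => U j (x : E3) - m x) 2 surf) atTop (𝓝 0) ∧
      ∀ i, Tendsto (fun j => eLpNorm (fun x : S2 => tangDeriv (U j) i x - G i x) 2 surf)
        atTop (𝓝 0)

/-- `m ∈ H¹(S², ℝ³)`. -/
def MemH1 (m : S2 → E3) : Prop := ∃ G, HasH1Gradient m G

/-- `m ∈ H¹(S², S²)`. -/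
def MemH1Sphere (m : S2 → E3) : Prop := MemH1 m ∧ ∀ᵐ x ∂surf, ‖m x‖ = 1

open Classical in
/-- The surface gradient of `m ∈ H¹(S², ℝ³)`, unique almost everywhere (`0` if `m` is not in
`H¹`). -/
def h1Gradient (m : S2 → E3) : Fin 3 → S2 → E3 :=
  if hm : MemH1 m then hm.choose else 0

/-- The `H¹`-norm. -/
def h1Norm (m : S2 → E3) : ℝ :=
  Real.sqrt (∫ x, (‖m x‖ ^ 2 + ∑ i, ‖h1Gradient m i x‖ ^ 2) ∂surf)

/-! ## The energy, its critical points and its saddle points -/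

/-- `ℰ(m) = ½ ∫ |∇m|² + κ (1 - ⟨m, ν⟩²) dσ`, with `ν(x) = x`. -/
def energy (κ : ℝ) (m : S2 → E3) : ℝ :=
  (1 / 2) * ∫ x, ((∑ i, ‖h1Gradient m i x‖ ^ 2) + κ * (1 - (inner ℝ (m x) (x : E3)) ^ 2)) ∂surf

/-- The variation `m_ε = (m + ε φ) / |m + ε φ|`. -/
def variation (m φ : S2 → E3) (ε : ℝ) (x : S2) : E3 :=
  ‖m x + ε • φ x‖⁻¹ • (m x + ε • φ x)

/-- `m ∈ H¹(S², S²)` is a critical point: `d/dε ℰ(m_ε) = 0` at `ε = 0` for all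
`φ ∈ H¹ ∩ L^∞(S², ℝ³)`. -/
def IsCriticalPoint (κ : ℝ) (m : S2 → E3) : Prop :=
  MemH1Sphere m ∧ ∀ φ : S2 → E3, MemH1 φ → MemLp φ ⊤ surf →
    HasDerivAt (fun ε : ℝ => energy κ (variation m φ ε)) 0 0

/-- `m` is a local minimizer of the energy in `H¹(S², S²)`. -/
def IsLocalMinimizer (κ : ℝ) (m : S2 → E3) : Prop :=
  ∃ δ > 0, ∀ u : S2 → E3, MemH1Sphere u → h1Norm (fun x => u x - m x) < δ →
    energy κ m ≤ energy κ u

/-- `m` is a local maximizer of the energy in `H¹(S², S²)`. -/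
def IsLocalMaximizer (κ : ℝ) (m : S2 → E3) : Prop :=
  ∃ δ > 0, ∀ u : S2 → E3, MemH1Sphere u → h1Norm (fun x => u x - m x) < δ →
    energy κ u ≤ energy κ m

/-- A saddle point: a critical point in `H¹(S², S²)` that is neither a local minimizer nor a local
maximizer. -/
def IsSaddlePoint (κ : ℝ) (m : S2 → E3) : Prop :=
  IsCriticalPoint κ m ∧ ¬ IsLocalMinimizer κ m ∧ ¬ IsLocalMaximizer κ m

/-! ## Axisymmetric maps and their profiles -/

/-- Spherical coordinates: `(cos φ sin θ, sin φ sin θ, cos θ)`. -/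
def sphericalCoord (θ φ : ℝ) : E3 :=
  !₂[Real.cos φ * Real.sin θ, Real.sin φ * Real.sin θ, Real.cos θ]

/-- The polar angle in `[0, π]` of a point on the sphere. -/
def polarAngle (x : S2) : ℝ := Real.arccos ((x : E3) 2)

/-- The azimuthal angle of a point on the sphere (`0` at the poles). -/
def azimuth (x : S2) : ℝ := Complex.arg ⟨(x : E3) 0, (x : E3) 1⟩

/-- The axisymmetric map with profile `h`: the point with spherical coordinates `(θ, φ)` is sent to
the point with spherical coordinates `(h θ, φ)`. -/
def axisymmetricMap (h : ℝ → ℝ) (x : S2) : E3 :=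
  sphericalCoord (h (polarAngle x)) (azimuth x)

/-- Continuous and piecewise continuously differentiable functions on `[0, π]`. -/
def IsPiecewiseC1 (h : ℝ → ℝ) : Prop :=
  ContinuousOn h (Icc 0 Real.pi) ∧
    ∃ (n : ℕ) (t : ℕ → ℝ), t 0 = 0 ∧ t n = Real.pi ∧ (∀ i < n, t i < t (i + 1)) ∧
      ∀ i < n, ContDiffOn ℝ 1 h (Icc (t i) (t (i + 1)))

/-- The class `E_{m,n}` of profiles with `h(0) = mπ` and `h(π) = nπ`. -/
def profileClass (m n : ℤ) : Set (ℝ → ℝ) :=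
  {h | IsPiecewiseC1 h ∧ h 0 = m * Real.pi ∧ h Real.pi = n * Real.pi}

/-- `h` is a solution on `(0, π)` of the profile equation
`0 = h'' + (cos θ / sin θ) h' - sin (2h) / (2 sin² θ) - (κ/2) sin (2h - 2θ)`. -/
def SolvesProfileEq (κ : ℝ) (h : ℝ → ℝ) : Prop :=
  ContDiffOn ℝ 2 h (Ioo 0 Real.pi) ∧
    ∀ θ ∈ Ioo 0 Real.pi,
      0 = deriv (deriv h) θ + Real.cos θ / Real.sin θ * deriv h θ
        - Real.sin (2 * h θ) / (2 * Real.sin θ ^ 2) - κ / 2 * Real.sin (2 * h θ - 2 * θ)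

/-! ## The Legendre operator and its graph norm -/

/-- The measure `sin θ dθ` on `(0, π)`. -/
def sinMeasure : Measure ℝ :=
  (volume.restrict (Ioo 0 Real.pi)).withDensity (fun θ => ENNReal.ofReal (Real.sin θ))

/-- Local absolute continuity on `(0, π)`. -/
def IsACLoc (f : ℝ → ℝ) : Prop :=
  ∀ a b : ℝ, 0 < a → a ≤ b → b < Real.pi → AbsolutelyContinuousOnInterval f a b

/-- The Legendre operator `f ↦ (1 / sin θ) (sin θ f')' - f / sin² θ`. -/
def legendreOp (f : ℝ → ℝ) (θ : ℝ) : ℝ :=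
  1 / Real.sin θ * deriv (fun t => Real.sin t * deriv f t) θ - f θ / Real.sin θ ^ 2

/-- The maximal domain of the Legendre operator in `L²((0, π), sin θ dθ)`. -/
def legendreDomain : Set (ℝ → ℝ) :=
  {f | MemLp f 2 sinMeasure ∧ IsACLoc f ∧ IsACLoc (fun t => deriv f t * Real.sin t) ∧
    MemLp (legendreOp f) 2 sinMeasure}

/-- The graph norm `‖f‖ + ‖L f‖` on the domain of the Legendre operator. -/
def graphNorm (f : ℝ → ℝ) : ℝ :=
  (eLpNorm f 2 sinMeasure).toReal + (eLpNorm (legendreOp f) 2 sinMeasure).toReal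

/-- For an open set `I ⊆ ℝ`, the curve `κ ↦ η κ` is a continuously differentiable map from `I`
to the domain of the Legendre operator with the graph norm; `η' κ` is its derivative at `κ`. -/
def IsC1InGraphNorm (I : Set ℝ) (η : ℝ → ℝ → ℝ) : Prop :=
  (∀ κ ∈ I, η κ ∈ legendreDomain) ∧
    ∃ η' : ℝ → ℝ → ℝ, (∀ κ ∈ I, η' κ ∈ legendreDomain) ∧
      (∀ κ ∈ I, Tendsto
        (fun s => graphNorm (fun θ => (s - κ)⁻¹ * (η s θ - η κ θ) - η' κ θ))
        (𝓝[≠] κ) (𝓝 0)) ∧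
      ∀ κ ∈ I, Tendsto (fun s => graphNorm (fun θ => η' s θ - η' κ θ)) (𝓝 κ) (𝓝 0)

end SphereSaddle

end

open SphereSaddle

/-!
Write `z = cos θ`. A profile is sought in the form `h = 2θ + sin θ w(cos θ)` with `w` odd. In terms
of `w` the profile equation is a regular singular equation
`(1 - z²) w'' - 4 z w' - 2 w = -γ` whose right-hand side `γ` depends on `w` through a superposition
operator. The linear equation has an explicit Green operator that is bounded at both poles
(`greenW`). Since everything is odd in `z`, one may write `w = z u`, `γ = z v` and work with bounded
continuous functions `u`, `v` on the upper half `0 < z < 1`; there the Green operator `v ↦ u`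
(`greenOp`) has norm at most `1 / 6`, because `γ = z` has the solution `w = z / 6`. The
superposition operators are `C¹` in the supremum norm (`exists_superposition`), and their linearization
at `κ = 4`, `h = 2θ` is the multiplication by `4`. So the linearized fixed point operator
`1 - 4 greenOp` is invertible by the Neumann series, and the implicit function theorem gives the
branch (`exists_branch`). The perturbation `η` depends linearly and boundedly on `v`, from the
supremum norm to the graph norm of the Legendre operator, so it is `C¹` in `κ` in the graph norm.

The associated axisymmetric map is zonal: it has the form `x ↦ (x₀ a(x₂), x₁ a(x₂), b(x₂))` with
`a = sin h / sin θ` and `b = cos h`. This makes it possible to compute on the sphere without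
spherical coordinates. The rotation invariance of the surface measure yields integration by
parts along the Killing fields, hence the closability of the gradient
(`HasH1Gradient.ae_eq_zero`) and the weak form of the Laplacian of a zonal map
(`ZonalData.integral_dirichlet`). The chain rule for the normalization `y ↦ y / |y|` in `H¹`
(`HasH1Gradient.variation`) gives the first variation of the energy for bounded fields, and the
profile equation makes it vanish (`ZonalSolution.isCriticalPoint`).

For the saddle property the profile is varied by `ρ(cos θ) sin θ`. At `κ = 4`, `h = 2θ` the second
variation is the integral of `5 z² - 3` for `ρ = 1`, which is negative, and the integral of
`8 z⁴ - 7 z² + 1` for `ρ = z`, which is positive. The signs persist for small `|κ - 4|` and small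
`η` (`ZonalSolution.isSaddlePoint`). The energy expansion along a bounded field has a cubic
remainder, and the variations converge in `H¹`, so the map is neither a local minimizer nor a local
maximizer.
-/

open SphereSaddle

namespace SphereSaddle

/-! ### Rotations and integration by parts on the sphere -/

instance : IsFiniteMeasure surf := inferInstanceAs (IsFiniteMeasure (volume : Measure E3).toSphere)

lemma S2.norm_coe (x : S2) : ‖(x : E3)‖ = 1 := by simp

lemma S2.sq_sum (x : S2) : (x : E3) 0 ^ 2 + (x : E3) 1 ^ 2 + (x : E3) 2 ^ 2 = 1 := by
  have h := x.norm_coe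
  rw [EuclideanSpace.norm_eq, Real.sqrt_eq_one, Fin.sum_univ_three] at h
  simpa using h

lemma S2.abs_apply_le (x : S2) (i : Fin 3) : |(x : E3) i| ≤ 1 := by
  have h := PiLp.norm_apply_le (x : E3) i
  rwa [x.norm_coe, Real.norm_eq_abs] at h

/-- The action of a linear isometry of `ℝ³` on the sphere. -/
noncomputable def sphereMap (e : E3 ≃ₗᵢ[ℝ] E3) (x : S2) : S2 :=
  ⟨e x, by simp⟩

lemma continuous_sphereMap (e : E3 ≃ₗᵢ[ℝ] E3) : Continuous (sphereMap e) :=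
  (e.continuous.comp continuous_subtype_val).subtype_mk _

open scoped Pointwise in
lemma measurePreserving_sphereMap (e : E3 ≃ₗᵢ[ℝ] E3) :
    MeasurePreserving (sphereMap e) surf surf := by
  refine ⟨(continuous_sphereMap e).measurable, ?_⟩
  ext s hs
  rw [Measure.map_apply (continuous_sphereMap e).measurable hs, surf,
    Measure.toSphere_apply' _ ((continuous_sphereMap e).measurable hs),
    Measure.toSphere_apply' _ hs, 
    ← e.measurePreserving.measure_preimage_equiv (f := e.toMeasurableEquiv)
      (Ioo (0 : ℝ) 1 • (Subtype.val '' s))]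
  congr 2
  ext y
  change _ ↔ e y ∈ Ioo (0 : ℝ) 1 • ((↑) '' s : Set E3)
  simp only [Set.mem_smul, Set.mem_preimage, Set.mem_image]
  constructor
  · rintro ⟨r, hr, _, ⟨x, hx, rfl⟩, hy⟩
    refine ⟨r, hr, _, ⟨sphereMap e x, hx, rfl⟩, ?_⟩
    simp only [sphereMap, ← hy, map_smul]
  · rintro ⟨r, hr, _, ⟨x, hx, rfl⟩, hy⟩
    refine ⟨r, hr, _, ⟨sphereMap e.symm x, ?_, rfl⟩, ?_⟩
    · have : sphereMap e (sphereMap e.symm x) = x := by ext1; simp [sphereMap]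
      simpa [this] using hx
    · apply e.injective
      simpa only [sphereMap, map_smul, LinearIsometryEquiv.apply_symm_apply] using hy

/-- The Killing field of the rotations in the plane spanned by the `i`-th and `j`-th unit
vectors. -/
noncomputable def rotField (i j : Fin 3) (x : E3) : E3 :=
  x i • EuclideanSpace.single j 1 - x j • EuclideanSpace.single i 1

/-- The rotation by the angle `t` in the plane spanned by the `i`-th and `j`-th unit vectors. -/
noncomputable def rotLin (i j : Fin 3) (t : ℝ) : E3 →ₗ[ℝ] E3 where
  toFun x := x + (Real.cos t - 1) • (x i • EuclideanSpace.single i 1 +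
    x j • EuclideanSpace.single j 1) + Real.sin t • rotField i j x
  map_add' x y := by
    ext k; simp [rotField]; split_ifs <;> ring
  map_smul' c x := by
    ext k; simp [rotField]; split_ifs <;> ring

lemma norm_rotLin {i j : Fin 3} (hij : i ≠ j) (t : ℝ) (x : E3) : ‖rotLin i j t x‖ = ‖x‖ := by
  rw [EuclideanSpace.norm_eq, EuclideanSpace.norm_eq]
  congr 1
  simp only [Real.norm_eq_abs, sq_abs, Fin.sum_univ_three]
  have h := Real.sin_sq_add_cos_sq t
  fin_cases i <;> fin_cases j <;> simp [rotLin, rotField] at hij ⊢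
  all_goals first
    | linear_combination (x 0 ^ 2 + x 1 ^ 2) * h
    | linear_combination (x 0 ^ 2 + x 2 ^ 2) * h
    | linear_combination (x 1 ^ 2 + x 2 ^ 2) * h

/-- The rotation by the angle `t` as a linear isometry. -/
noncomputable def rotIso {i j : Fin 3} (hij : i ≠ j) (t : ℝ) : E3 ≃ₗᵢ[ℝ] E3 :=
  LinearIsometry.toLinearIsometryEquiv ⟨rotLin i j t, norm_rotLin hij t⟩ rfl

lemma rotIso_apply {i j : Fin 3} (hij : i ≠ j) (t : ℝ) (x : E3) :
    rotIso hij t x = rotLin i j t x := rfl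

lemma hasDerivAt_rotLin {i j : Fin 3} (hij : i ≠ j) (t : ℝ) (x : E3) :
    HasDerivAt (fun t => rotLin i j t x) (rotField i j (rotLin i j t x)) t := by
  have h1 : HasDerivAt (fun t => x + (Real.cos t - 1) • (x i • EuclideanSpace.single i (1 : ℝ) +
      x j • EuclideanSpace.single j (1 : ℝ)) + Real.sin t • rotField i j x)
      ((0 + (-Real.sin t - 0) • (x i • EuclideanSpace.single i (1 : ℝ) +
      x j • EuclideanSpace.single j (1 : ℝ))) + Real.cos t • rotField i j x) t :=
    (((hasDerivAt_const t x).add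
      (((Real.hasDerivAt_cos t).sub (hasDerivAt_const t 1)).smul_const _)).add
      ((Real.hasDerivAt_sin t).smul_const _))
  refine h1.congr_deriv ?_
  ext k
  simp [rotLin, rotField, hij, hij.symm]
  split_ifs <;> ring

lemma norm_rotField_le (i j : Fin 3) (x : S2) : ‖rotField i j x‖ ≤ 2 := by
  refine (norm_sub_le _ _).trans ?_
  simp only [norm_smul, PiLp.norm_single, norm_one, mul_one, Real.norm_eq_abs]
  linarith [x.abs_apply_le i, x.abs_apply_le j]

lemma continuous_rotField (i j : Fin 3) : Continuous (rotField i j) := by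
  unfold rotField; fun_prop

lemma continuous_fderiv_sphere {F : Type*} [NormedAddCommGroup F] [NormedSpace ℝ F] {f : E3 → F}
    (hf : ∀ x : S2, ContDiffAt ℝ 1 f x) : Continuous fun x : S2 => fderiv ℝ f x := by
  rw [continuous_iff_continuousAt]
  intro x
  exact ContinuousAt.comp (f := fun x : S2 => (x : E3))
    ((hf x).continuousAt_fderiv one_ne_zero) continuous_subtype_val.continuousAt

lemma continuous_sphere_of_contDiffAt {F : Type*} [NormedAddCommGroup F] [NormedSpace ℝ F]
    {f : E3 → F} (hf : ∀ x : S2, ContDiffAt ℝ 1 f x) : Continuous fun x : S2 => f x := by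
  rw [continuous_iff_continuousAt]
  intro x
  exact ContinuousAt.comp (f := fun x : S2 => (x : E3)) (hf x).continuousAt
    continuous_subtype_val.continuousAt

lemma Continuous.integrable_surf {F : Type*} [NormedAddCommGroup F] {f : S2 → F}
    (hf : Continuous f) : Integrable f surf := by
  rw [← integrableOn_univ]
  exact hf.continuousOn.integrableOn_compact isCompact_univ

/-- The integral of `f` over the sphere does not change under a rotation, so its derivative along
a Killing field has integral zero. -/
lemma integral_fderiv_rotField {f : E3 → ℝ} (hf : ∀ x : S2, ContDiffAt ℝ 1 f x) {i j : Fin 3}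
    (hij : i ≠ j) : ∫ x : S2, fderiv ℝ f x (rotField i j x) ∂surf = 0 := by
  have hc := continuous_fderiv_sphere hf
  have hfc := continuous_sphere_of_contDiffAt hf
  obtain ⟨C, hC⟩ := (isCompact_univ (X := S2)).exists_bound_of_continuousOn hc.continuousOn
  have key := hasDerivAt_integral_of_dominated_loc_of_deriv_le (μ := surf) (x₀ := (0 : ℝ))
    (s := univ) (F := fun t (x : S2) => f (sphereMap (rotIso hij t) x))
    (F' := fun t (x : S2) => fderiv ℝ f (sphereMap (rotIso hij t) x)
      (rotField i j (sphereMap (rotIso hij t) x))) (bound := fun _ => C * 2) univ_mem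
    (Eventually.of_forall fun t =>
      (hfc.comp (continuous_sphereMap _)).aestronglyMeasurable)
    (Continuous.integrable_surf (hfc.comp (continuous_sphereMap _)))
    ?_ ?_ (integrable_const _) ?_
  · have hconst : (fun t => ∫ x : S2, f (sphereMap (rotIso hij t) x) ∂surf) =
        fun _ => ∫ x : S2, f x ∂surf := by
      ext t
      have := (measurePreserving_sphereMap (rotIso hij t)).integral_comp'
        (f := (Homeomorph.mk ⟨sphereMap (rotIso hij t), sphereMap (rotIso hij t).symm,
          fun x => by ext1; simp [sphereMap], fun x => by ext1; simp [sphereMap]⟩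
          (continuous_sphereMap _) (continuous_sphereMap _)).toMeasurableEquiv)
        (fun x : S2 => f x)
      exact this
    have h2 := key.2
    rw [hconst] at h2
    have h0 := (hasDerivAt_const (0 : ℝ) (∫ x : S2, f x ∂surf)).unique h2
    rw [h0]
    congr 1
    ext x
    have : sphereMap (rotIso hij 0) x = x := by
      ext1
      simp [sphereMap, rotIso_apply, rotLin]
    rw [this]
  · exact ((hc.comp (continuous_sphereMap _)).clm_apply ((continuous_rotField i j).comp
      (continuous_subtype_val.comp (continuous_sphereMap _)))).aestronglyMeasurable
  · refine Eventually.of_forall fun x t _ => (ContinuousLinearMap.le_opNorm _ _).trans ?_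
    exact mul_le_mul (hC _ (mem_univ _)) (norm_rotField_le _ _ _) (norm_nonneg _)
      ((norm_nonneg _).trans (hC x (mem_univ _)))
  · refine Eventually.of_forall fun x t _ => ?_
    exact ((hf (sphereMap (rotIso hij t) x)).differentiableAt one_ne_zero).hasFDerivAt.comp_hasDerivAt t
      (hasDerivAt_rotLin hij t x)

/-- Integration by parts along a Killing field. -/
lemma integral_mul_fderiv_rotField {f g : E3 → ℝ} (hf : ∀ x : S2, ContDiffAt ℝ 1 f x)
    (hg : ∀ x : S2, ContDiffAt ℝ 1 g x) {i j : Fin 3} (hij : i ≠ j) :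
    ∫ x : S2, f x * fderiv ℝ g x (rotField i j x) ∂surf =
      -∫ x : S2, fderiv ℝ f x (rotField i j x) * g x ∂surf := by
  have h := integral_fderiv_rotField (fun x => (hf x).mul (hg x)) hij
  have hi : ∀ {f g : E3 → ℝ}, (∀ x : S2, ContDiffAt ℝ 1 f x) → (∀ x : S2, ContDiffAt ℝ 1 g x) →
      Integrable (fun x : S2 => f x * fderiv ℝ g x (rotField i j x)) surf := fun hf hg =>
    Continuous.integrable_surf ((continuous_sphere_of_contDiffAt hf).mul
      ((continuous_fderiv_sphere hg).clm_apply
        ((continuous_rotField i j).comp continuous_subtype_val)))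
  rw [eq_neg_iff_add_eq_zero, ← h, ← integral_add (hi hf hg)]
  · congr 1
    ext x
    have := ((hf x).differentiableAt one_ne_zero).hasFDerivAt.mul
      ((hg x).differentiableAt one_ne_zero).hasFDerivAt
    rw [show (fun x => f x * g x) = f * g from rfl, this.fderiv]
    simp
    ring
  · simpa only [mul_comm] using hi hg hf

/-- The tangential projection `eᵢ - xᵢ x` of the `i`-th unit vector. -/
noncomputable def tangField (i : Fin 3) (x : E3) : E3 :=
  EuclideanSpace.single i (1 : ℝ) - x i • x

lemma tangField_eq_sum (i : Fin 3) (x : S2) :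
    tangField i x = ∑ j, (x : E3) j • rotField j i x := by
  have h := x.sq_sum
  ext k
  rw [Fin.sum_univ_three]
  simp only [tangField, rotField, PiLp.sub_apply, PiLp.add_apply, PiLp.smul_apply, smul_eq_mul,
    PiLp.single_apply]
  fin_cases i <;> fin_cases k <;> simp <;> first | ring1 | linear_combination -h

lemma continuous_tangField (i : Fin 3) : Continuous (tangField i) := by
  unfold tangField; fun_prop

/-- The divergence theorem on the sphere. -/
lemma integral_fderiv_tangField {f : E3 → ℝ} (hf : ∀ x : S2, ContDiffAt ℝ 1 f x) (i : Fin 3) :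
    ∫ x : S2, fderiv ℝ f x (tangField i x) ∂surf = 2 * ∫ x : S2, (x : E3) i * f x ∂surf := by
  have hco : ∀ j (x : S2), ContDiffAt ℝ 1 (fun y : E3 => y j) x := fun j x => by fun_prop
  have hfc := continuous_sphere_of_contDiffAt hf
  have hcc : ∀ j, Continuous fun x : S2 => (x : E3) j := fun j => by fun_prop
  have hterm : ∀ j, ∫ x : S2, (x : E3) j * fderiv ℝ f x (rotField j i x) ∂surf =
      if j = i then 0 else ∫ x : S2, (x : E3) i * f x ∂surf := by
    intro j
    split_ifs with h
    · subst h; simp [rotField]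
    · rw [integral_mul_fderiv_rotField (hco j) hf h, ← integral_neg]
      congr 1
      ext x
      have : HasFDerivAt (fun y : E3 => y j) (EuclideanSpace.proj j : E3 →L[ℝ] ℝ) (x : E3) :=
        (EuclideanSpace.proj j : E3 →L[ℝ] ℝ).hasFDerivAt
      rw [this.fderiv]
      simp [rotField, h]
  simp_rw [tangField_eq_sum, map_sum, map_smul, smul_eq_mul]
  have hint : ∀ j, Integrable (fun x : S2 => (x : E3) j * fderiv ℝ f x (rotField j i x)) surf :=
    fun j => Continuous.integrable_surf ((hcc j).mul
      ((continuous_fderiv_sphere hf).clm_apply ((continuous_rotField j i).comp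
        continuous_subtype_val)))
  rw [integral_finsetSum _ fun j _ => hint j]
  simp_rw [hterm]
  fin_cases i <;> simp [Fin.sum_univ_three] <;> ring

/-! ### Convergence in `L²` on the sphere -/

lemma Continuous.memLp_surf {F : Type*} [NormedAddCommGroup F] {f : S2 → F}
    (hf : Continuous f) (p : ENNReal) : MemLp f p surf := by
  obtain ⟨C, hC⟩ := (isCompact_univ (X := S2)).exists_bound_of_continuousOn hf.continuousOn
  exact MemLp.of_bound hf.aestronglyMeasurable C (Eventually.of_forall fun x => hC x (mem_univ _))

/-- Dominated convergence in `L²`. -/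
lemma tendsto_eLpNorm_two_of_dominated {ι α F : Type*} [MeasurableSpace α] {μ : Measure α}
    [NormedAddCommGroup F] {l : Filter ι} [l.IsCountablyGenerated] {f : ι → α → F} {g : α → ℝ}
    (hf : ∀ᶠ n in l, AEStronglyMeasurable (f n) μ) (hg : MemLp g 2 μ)
    (hfg : ∀ᶠ n in l, ∀ᵐ x ∂μ, ‖f n x‖ ≤ g x)
    (hlim : ∀ᵐ x ∂μ, Tendsto (fun n => f n x) l (𝓝 0)) :
    Tendsto (fun n => eLpNorm (f n) 2 μ) l (𝓝 0) := by
  have h1 : Tendsto (fun n => ∫⁻ x, ‖f n x‖ₑ ^ (2 : ℝ) ∂μ) l (𝓝 (∫⁻ _, 0 ∂μ)) := by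
    refine tendsto_lintegral_filter_of_dominated_convergence' (fun x => ‖g x‖ₑ ^ (2 : ℝ))
      ?_ ?_ ?_ ?_
    · filter_upwards [hf] with n hn using (hn.enorm.pow_const _)
    · filter_upwards [hfg] with n hn
      filter_upwards [hn] with x hx
      gcongr
      rw [enorm_le_iff_norm_le]
      exact hx.trans (le_abs_self _)
    · have := (lintegral_rpow_enorm_lt_top_of_eLpNorm_lt_top two_ne_zero ENNReal.ofNat_ne_top hg.2)
      simpa using this.ne
    · filter_upwards [hlim] with x hx
      have := (ENNReal.continuous_rpow_const (y := 2)).continuousAt.tendsto.comp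
        ((continuous_enorm.tendsto (0 : F)).comp hx)
      simpa [Function.comp_def] using this
  have h2 : ∀ n, eLpNorm (f n) 2 μ = (∫⁻ x, ‖f n x‖ₑ ^ (2 : ℝ) ∂μ) ^ (1 / 2 : ℝ) := fun n => by
    rw [eLpNorm_eq_lintegral_rpow_enorm_toReal two_ne_zero ENNReal.ofNat_ne_top]
    simp
  simp_rw [h2]
  have := (ENNReal.continuous_rpow_const (y := 1 / 2)).continuousAt.tendsto.comp h1
  simpa [Function.comp_def] using this

/-- Integration against a bounded function is continuous under `L²`-convergence. -/
lemma tendsto_integral_inner {ι F : Type*} [NormedAddCommGroup F] [InnerProductSpace ℝ F]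
    {l : Filter ι} {f : ι → S2 → F} {f₀ G : S2 → F} {C : ℝ}
    (hG : AEStronglyMeasurable G surf) (hGC : ∀ x, ‖G x‖ ≤ C) (hf : ∀ n, MemLp (f n) 2 surf)
    (hf₀ : MemLp f₀ 2 surf) (h : Tendsto (fun n => eLpNorm (fun x => f n x - f₀ x) 2 surf) l (𝓝 0)) :
    Tendsto (fun n => ∫ x, inner ℝ (G x) (f n x) ∂surf) l (𝓝 (∫ x, inner ℝ (G x) (f₀ x) ∂surf)) := by
  have hi : ∀ {f : S2 → F}, MemLp f 2 surf → Integrable (fun x => inner ℝ (G x) (f x)) surf := by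
    intro f hf
    refine ((hf.integrable one_le_two).norm.const_mul C).mono' (hG.inner hf.1) ?_
    refine Eventually.of_forall fun x => (norm_inner_le_norm _ _).trans ?_
    gcongr
    exact hGC x
  refine tendsto_integral_of_L1' _ (hi hf₀).1 (Eventually.of_forall fun n => hi (hf n)) ?_
  set K : ENNReal := ENNReal.ofReal C * surf univ ^ (1 / (1 : ENNReal).toReal - 1 / (2 : ENNReal).toReal)
  have hK : K ≠ ⊤ := by
    refine ENNReal.mul_ne_top ENNReal.ofReal_ne_top ?_
    exact ENNReal.rpow_ne_top_of_nonneg (by norm_num) (measure_ne_top _ _)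
  have h0 : Tendsto (fun n => K * eLpNorm (fun x => f n x - f₀ x) 2 surf) l (𝓝 0) := by
    simpa using ENNReal.Tendsto.const_mul h (Or.inr hK)
  refine tendsto_of_tendsto_of_tendsto_of_le_of_le tendsto_const_nhds h0 (fun _ => zero_le)
    fun n => ?_
  have h1 : eLpNorm ((fun x => inner ℝ (G x) (f n x)) - fun x => inner ℝ (G x) (f₀ x)) 1 surf ≤
      ENNReal.ofReal C * eLpNorm (fun x => f n x - f₀ x) 1 surf := by
    refine eLpNorm_le_mul_eLpNorm_of_ae_le_mul (Eventually.of_forall fun x => ?_) 1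
    simp only [Pi.sub_apply, ← inner_sub_right]
    refine (norm_inner_le_norm _ _).trans ?_
    gcongr
    exact hGC x
  refine h1.trans ?_
  have h2 := eLpNorm_le_eLpNorm_mul_rpow_measure_univ (p := 1) (q := 2) one_le_two
    ((hf n).sub hf₀).1
  calc _ ≤ _ := mul_le_mul_right h2 _
    _ = _ := by simp only [K]; rw [mul_comm (eLpNorm _ _ _), ← mul_assoc]; rfl

/-! ### The Sobolev space: linearity and uniqueness of the gradient -/

lemma tangDeriv_eq (U : E3 → E3) (i : Fin 3) (x : S2) :
    tangDeriv U i x = fderiv ℝ U x (tangField i x) := rfl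

lemma continuous_tangDeriv {U : E3 → E3} (hU : ContDiff ℝ 1 U) (i : Fin 3) :
    Continuous (tangDeriv U i) :=
  (continuous_fderiv_sphere fun _ => hU.contDiffAt).clm_apply
    ((continuous_tangField i).comp continuous_subtype_val)

lemma HasH1Gradient.add {u v : S2 → E3} {G H : Fin 3 → S2 → E3} (hu : HasH1Gradient u G)
    (hv : HasH1Gradient v H) :
    HasH1Gradient (fun x => u x + v x) (fun i x => G i x + H i x) := by
  obtain ⟨hu1, hG, U, hU, hUu, hUG⟩ := hu
  obtain ⟨hv1, hH, V, hV, hVv, hVH⟩ := hv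
  refine ⟨hu1.add hv1, fun i => (hG i).add (hH i), fun j x => U j x + V j x,
    fun j => (hU j).add (hV j), ?_, fun i => ?_⟩
  · refine tendsto_of_tendsto_of_tendsto_of_le_of_le tendsto_const_nhds
      (by simpa using hUu.add hVv) (fun _ => zero_le) fun n => ?_
    refine le_trans (le_of_eq ?_) (eLpNorm_add_le
      ((((hU n).continuous.comp continuous_subtype_val).memLp_surf 2).sub hu1).1
      ((((hV n).continuous.comp continuous_subtype_val).memLp_surf 2).sub hv1).1 one_le_two)
    congr 1; ext1 x; simp only [Pi.add_apply]; abel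
  · refine tendsto_of_tendsto_of_tendsto_of_le_of_le tendsto_const_nhds
      (by simpa using (hUG i).add (hVH i)) (fun _ => zero_le) fun n => ?_
    refine le_trans (le_of_eq ?_) (eLpNorm_add_le
      (((continuous_tangDeriv ((hU n).of_le (by simp)) i).memLp_surf 2).sub (hG i)).1
      (((continuous_tangDeriv ((hV n).of_le (by simp)) i).memLp_surf 2).sub (hH i)).1 one_le_two)
    congr 1; ext1 x
    have : tangDeriv (fun x => U n x + V n x) i x = tangDeriv (U n) i x + tangDeriv (V n) i x := by
      simp only [tangDeriv_eq]
      rw [fderiv_fun_add ((hU n).differentiable (by simp) _) ((hV n).differentiable (by simp) _)]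
      rfl
    simp only [this, Pi.add_apply]; abel

lemma HasH1Gradient.const_smul {u : S2 → E3} {G : Fin 3 → S2 → E3} (hu : HasH1Gradient u G)
    (c : ℝ) : HasH1Gradient (fun x => c • u x) (fun i x => c • G i x) := by
  obtain ⟨hu1, hG, U, hU, hUu, hUG⟩ := hu
  refine ⟨hu1.const_smul c, fun i => (hG i).const_smul c, fun j x => c • U j x,
    fun j => (hU j).const_smul c, ?_, fun i => ?_⟩
  · have := ENNReal.Tendsto.const_mul (a := ‖c‖ₑ) hUu (Or.inr enorm_ne_top)
    rw [mul_zero] at this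
    refine this.congr fun n => ?_
    rw [← eLpNorm_const_smul]
    congr 1; ext1 x; simp [smul_sub]
  · have := ENNReal.Tendsto.const_mul (a := ‖c‖ₑ) (hUG i) (Or.inr enorm_ne_top)
    rw [mul_zero] at this
    refine this.congr fun n => ?_
    rw [← eLpNorm_const_smul]
    congr 1; ext1 x
    have : tangDeriv (fun x => c • U n x) i x = c • tangDeriv (U n) i x := by
      simp only [tangDeriv_eq]
      rw [fderiv_fun_const_smul ((hU n).differentiable (by simp) _)]
      rfl
    simp [this, smul_sub]

lemma HasH1Gradient.sub {u v : S2 → E3} {G H : Fin 3 → S2 → E3} (hu : HasH1Gradient u G)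
    (hv : HasH1Gradient v H) :
    HasH1Gradient (fun x => u x - v x) (fun i x => G i x - H i x) := by
  simpa [sub_eq_add_neg] using hu.add (hv.const_smul (-1))

/-- The tangential gradient is closable: integration by parts identifies every `L²`-limit of
`∇U_j` when `U_j → 0`. -/
lemma HasH1Gradient.ae_eq_zero {G : Fin 3 → S2 → E3} (h : HasH1Gradient (fun _ => 0) G)
    (i : Fin 3) : ∀ᵐ x ∂surf, G i x = 0 := by
  obtain ⟨-, hG, U, hU, hU0, hUG⟩ := h
  have hUc : ∀ j, MemLp (fun x : S2 => U j x) 2 surf := fun j =>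
    ((hU j).continuous.comp continuous_subtype_val).memLp_surf 2
  have hemb : MeasurableEmbedding (Subtype.val : S2 → E3) :=
    MeasurableEmbedding.subtype_coe Metric.isClosed_sphere.measurableSet
  have hext : ∀ x : S2, Function.extend Subtype.val (G i) 0 (x : E3) = G i x := fun x =>
    Subtype.val_injective.extend_apply _ _ _
  have key : ∀ᵐ y ∂(surf.map (Subtype.val : S2 → E3)),
      Function.extend Subtype.val (G i) 0 y = 0 := by
    refine ae_eq_zero_of_integral_contDiff_smul_eq_zero ?_ ?_
    · refine Integrable.locallyIntegrable ?_
      rw [hemb.integrable_map_iff]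
      refine ((hG i).integrable one_le_two).congr (Eventually.of_forall fun x => ?_)
      exact (hext x).symm
    · intro g hg hgs
      rw [hemb.integral_map]
      simp_rw [hext]
      have hgi : Integrable (fun x : S2 => g x • G i x) surf := by
        obtain ⟨C, hC⟩ := (hgs.exists_bound_of_continuous hg.continuous)
        exact ((hG i).integrable one_le_two).bdd_smul C
          (hg.continuous.comp continuous_subtype_val).aestronglyMeasurable
          (Eventually.of_forall fun x => hC x)
      refine ext_inner_left ℝ fun e => ?_
      rw [inner_zero_right, ← integral_inner hgi]
      have hg1 : ∀ x : S2, ContDiffAt ℝ 1 g x := fun x => (hg.of_le (by simp)).contDiffAt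
      have hcg : Continuous fun x : S2 => g x := hg.continuous.comp continuous_subtype_val
      have hcdg : Continuous fun x : S2 => fderiv ℝ g x (tangField i x) :=
        (continuous_fderiv_sphere hg1).clm_apply
          ((continuous_tangField i).comp continuous_subtype_val)
      have hcx : Continuous fun x : S2 => (x : E3) i := by fun_prop
      have bdd : ∀ {f : S2 → E3}, Continuous f → ∃ C, ∀ x, ‖f x‖ ≤ C := fun hf => by
        obtain ⟨C, hC⟩ := (isCompact_univ (X := S2)).exists_bound_of_continuousOn hf.continuousOn
        exact ⟨C, fun x => hC x (mem_univ _)⟩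
      have c1 : Continuous fun x : S2 => g x • e := hcg.smul continuous_const
      have c2 : Continuous fun x : S2 =>
          (2 * ((x : E3) i * g x) - fderiv ℝ g x (tangField i x)) • e :=
        ((continuous_const.mul (hcx.mul hcg)).sub hcdg).smul continuous_const
      obtain ⟨C1, hC1⟩ := bdd c1
      obtain ⟨C2, hC2⟩ := bdd c2
      have t1 := tendsto_integral_inner c1.aestronglyMeasurable hC1
        (fun j => (continuous_tangDeriv ((hU j).of_le (by simp)) i).memLp_surf 2) (hG i) (hUG i)
      have t2 := tendsto_integral_inner c2.aestronglyMeasurable hC2 hUc (MemLp.zero') hU0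
      have heq : ∀ j, ∫ x : S2, inner ℝ (g x • e) (tangDeriv (U j) i x) ∂surf =
          ∫ x : S2, inner ℝ ((2 * ((x : E3) i * g x) - fderiv ℝ g x (tangField i x)) • e)
            (U j x) ∂surf := by
        intro j
        have hUj : Differentiable ℝ (U j) := (hU j).differentiable (by simp)
        have hu : ContDiff ℝ 1 fun y => inner ℝ e (U j y) :=
          contDiff_const.inner ℝ ((hU j).of_le (by simp))
        have hcu : Continuous fun x : S2 => inner ℝ e (U j x) :=
          hu.continuous.comp continuous_subtype_val
        have hcdu : Continuous fun x : S2 => inner ℝ e (tangDeriv (U j) i x) :=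
          continuous_const.inner (continuous_tangDeriv ((hU j).of_le (by simp)) i)
        have hdiv := integral_fderiv_tangField (f := fun y => g y * inner ℝ e (U j y))
          (fun x => (hg1 x).mul hu.contDiffAt) i
        have hpt : ∀ x : S2, fderiv ℝ (fun y => g y * inner ℝ e (U j y)) x (tangField i x) =
            g x * inner ℝ e (tangDeriv (U j) i x) +
              fderiv ℝ g x (tangField i x) * inner ℝ e (U j x) := by
          intro x
          have h1 := ((hg1 x).differentiableAt one_ne_zero).hasFDerivAt.mul
            ((hasFDerivAt_const e (x : E3)).inner ℝ (hUj x).hasFDerivAt)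
          have h2 : HasFDerivAt (fun y => g y * inner ℝ e (U j y)) _ (x : E3) := h1
          rw [h2.fderiv]
          simp [tangDeriv_eq]
          ring
        simp_rw [hpt] at hdiv
        have i1 : Integrable (fun x : S2 => g x * inner ℝ e (tangDeriv (U j) i x)) surf :=
          (hcg.mul hcdu).integrable_surf
        have i2 : Integrable (fun x : S2 => fderiv ℝ g x (tangField i x) * inner ℝ e (U j x))
          surf := (hcdg.mul hcu).integrable_surf
        have i3 : Integrable (fun x : S2 => 2 * ((x : E3) i * (g x * inner ℝ e (U j x)))) surf :=
          (continuous_const.mul (hcx.mul (hcg.mul hcu))).integrable_surf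
        rw [integral_add i1 i2] at hdiv
        simp_rw [real_inner_smul_left, sub_mul, mul_assoc]
        rw [integral_sub i3 i2, integral_const_mul]
        linarith
      simp_rw [heq] at t1
      have := tendsto_nhds_unique t1 t2
      simp only [inner_zero_right, integral_zero] at this
      rw [← this]
      congr 1; ext x
      rw [real_inner_smul_left, real_inner_smul_right]
  rw [hemb.ae_map_iff] at key
  filter_upwards [key] with x hx
  rwa [hext] at hx

lemma HasH1Gradient.unique {u : S2 → E3} {G H : Fin 3 → S2 → E3} (hG : HasH1Gradient u G)
    (hH : HasH1Gradient u H) (i : Fin 3) : ∀ᵐ x ∂surf, G i x = H i x := by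
  have h := hG.sub hH
  simp only [sub_self] at h
  filter_upwards [h.ae_eq_zero i] with x hx using sub_eq_zero.1 hx

lemma HasH1Gradient.congr_ae {u v : S2 → E3} {G H : Fin 3 → S2 → E3} (hu : HasH1Gradient u G)
    (huv : u =ᵐ[surf] v) (hGH : ∀ i, G i =ᵐ[surf] H i) : HasH1Gradient v H := by
  obtain ⟨hu1, hG, U, hU, hUu, hUG⟩ := hu
  refine ⟨hu1.ae_eq huv, fun i => (hG i).ae_eq (hGH i), U, hU, ?_, fun i => ?_⟩
  · refine hUu.congr fun n => eLpNorm_congr_ae ?_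
    filter_upwards [huv] with x hx; rw [hx]
  · refine (hUG i).congr fun n => eLpNorm_congr_ae ?_
    filter_upwards [hGH i] with x hx; rw [hx]

lemma HasH1Gradient.h1Gradient_ae {u : S2 → E3} {G : Fin 3 → S2 → E3} (hu : HasH1Gradient u G) :
    ∀ᵐ x ∂surf, ∀ i, h1Gradient u i x = G i x := by
  have hm : MemH1 u := ⟨G, hu⟩
  rw [ae_all_iff]
  intro i
  have : HasH1Gradient u (h1Gradient u) := by
    rw [h1Gradient, dif_pos hm]; exact hm.choose_spec
  exact this.unique hu i

/-- The energy density of `m`. -/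
noncomputable def energyDensity (κ : ℝ) (m : S2 → E3) (G : Fin 3 → S2 → E3) (x : S2) : ℝ :=
  (∑ i, ‖G i x‖ ^ 2) + κ * (1 - (inner ℝ (m x) (x : E3)) ^ 2)

/-- The energy does not depend on the choice of the surface gradient. -/
lemma HasH1Gradient.energy_eq {u : S2 → E3} {G : Fin 3 → S2 → E3} (hu : HasH1Gradient u G)
    (κ : ℝ) : energy κ u = (1 / 2) * ∫ x, energyDensity κ u G x ∂surf := by
  rw [energy]
  congr 1
  refine integral_congr_ae ?_
  filter_upwards [hu.h1Gradient_ae] with x hx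
  simp only [hx, energyDensity]

lemma HasH1Gradient.h1Norm_eq {u : S2 → E3} {G : Fin 3 → S2 → E3} (hu : HasH1Gradient u G) :
    h1Norm u = Real.sqrt (∫ x, (‖u x‖ ^ 2 + ∑ i, ‖G i x‖ ^ 2) ∂surf) := by
  rw [h1Norm]
  congr 1
  refine integral_congr_ae ?_
  filter_upwards [hu.h1Gradient_ae] with x hx
  simp only [hx]

/-! ### The chain rule in the Sobolev space and projected variations -/

lemma aestronglyMeasurable_clm_apply {A : S2 → E3 →L[ℝ] E3} {v : S2 → E3}
    (hA : AEStronglyMeasurable A surf) (hv : AEStronglyMeasurable v surf) :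
    AEStronglyMeasurable (fun x => A x (v x)) surf :=
  isBoundedBilinearMap_apply.continuous.comp_aestronglyMeasurable (hA.prodMk hv)

/-- The chain rule for `H¹`-maps and smooth maps with bounded derivative. A subsequence of the
approximating maps converges almost everywhere, and then dominated convergence applies. -/
lemma HasH1Gradient.comp_contDiff {u : S2 → E3} {G : Fin 3 → S2 → E3} (hu : HasH1Gradient u G)
    {Q : E3 → E3} (hQ : ContDiff ℝ ∞ Q) {C : ℝ} (hC : ∀ y, ‖fderiv ℝ Q y‖ ≤ C) :
    HasH1Gradient (fun x => Q (u x)) (fun i x => fderiv ℝ Q (u x) (G i x)) := by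
  obtain ⟨hu1, hG, U, hU, hUu, hUG⟩ := hu
  have hC0 : 0 ≤ C := (norm_nonneg _).trans (hC 0)
  have hlip : ∀ y z, ‖Q y - Q z‖ ≤ C * ‖y - z‖ := fun y z =>
    convex_univ.norm_image_sub_le_of_norm_fderiv_le
      (fun x _ => hQ.differentiable (by simp) x) (fun x _ => hC x) (mem_univ _) (mem_univ _)
  have hdQ : Continuous (fderiv ℝ Q) := hQ.continuous_fderiv (by simp)
  have hUc : ∀ j, Continuous fun x : S2 => U j x := fun j =>
    (hU j).continuous.comp continuous_subtype_val
  have hdU : ∀ j i, Continuous (tangDeriv (U j) i) := fun j i =>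
    continuous_tangDeriv ((hU j).of_le (by simp)) i
  obtain ⟨ns, hns, hae⟩ := (tendstoInMeasure_of_tendsto_eLpNorm (p := 2) two_ne_zero
    (fun j => (hUc j).aestronglyMeasurable) hu1.1 hUu).exists_seq_tendsto_ae
  have hGm : ∀ i, AEStronglyMeasurable (fun x => fderiv ℝ Q (u x) (G i x)) surf := fun i =>
    aestronglyMeasurable_clm_apply (hdQ.comp_aestronglyMeasurable hu1.1) (hG i).1
  refine ⟨?_, fun i => ?_, fun j x => Q (U (ns j) x), fun j => hQ.comp (hU _), ?_, fun i => ?_⟩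
  · refine ((hu1.norm.const_mul C).add (memLp_const ‖Q 0‖)).mono
      (hQ.continuous.comp_aestronglyMeasurable hu1.1) (Eventually.of_forall fun x => ?_)
    have h1 := hlip (u x) 0
    rw [sub_zero] at h1
    have h2 := norm_sub_norm_le (Q (u x)) (Q 0)
    refine le_trans ?_ (le_abs_self _)
    simp only [Pi.add_apply]
    linarith
  · refine ((hG i).norm.const_mul C).mono (hGm i) (Eventually.of_forall fun x => ?_)
    refine le_trans ?_ (le_abs_self _)
    exact (ContinuousLinearMap.le_opNorm _ _).trans (by gcongr; exact hC _)
  · have h0 := ENNReal.Tendsto.const_mul (a := ENNReal.ofReal C)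
      (hUu.comp hns.tendsto_atTop) (Or.inr ENNReal.ofReal_ne_top)
    rw [mul_zero] at h0
    refine tendsto_of_tendsto_of_tendsto_of_le_of_le tendsto_const_nhds h0
      (fun _ => zero_le) fun j => ?_
    exact eLpNorm_le_mul_eLpNorm_of_ae_le_mul (Eventually.of_forall fun x => hlip _ _) 2
  · have h0 := ENNReal.Tendsto.const_mul (a := ENNReal.ofReal C)
      ((hUG i).comp hns.tendsto_atTop) (Or.inr ENNReal.ofReal_ne_top)
    rw [mul_zero] at h0
    have h1 : Tendsto (fun j => eLpNorm (fun x : S2 => (fderiv ℝ Q (U (ns j) x) -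
        fderiv ℝ Q (u x)) (G i x)) 2 surf) atTop (𝓝 0) := by
      refine tendsto_eLpNorm_two_of_dominated (g := fun x => (C + C) * ‖G i x‖)
        (Eventually.of_forall fun j => ?_) ((hG i).norm.const_mul _)
        (Eventually.of_forall fun j => Eventually.of_forall fun x => ?_) ?_
      · exact aestronglyMeasurable_clm_apply ((hdQ.comp (hUc _)).aestronglyMeasurable.sub
          (hdQ.comp_aestronglyMeasurable hu1.1)) (hG i).1
      · refine (ContinuousLinearMap.le_opNorm _ _).trans ?_
        gcongr
        exact (norm_sub_le _ _).trans (add_le_add (hC _) (hC _))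
      · filter_upwards [hae] with x hx
        have h2 := ((hdQ.tendsto _).comp hx).sub_const (fderiv ℝ Q (u x))
        rw [sub_self] at h2
        have h3 := ((ContinuousLinearMap.apply ℝ E3 (G i x)).continuous.tendsto 0).comp h2
        simpa [Function.comp_def] using h3
    refine tendsto_of_tendsto_of_tendsto_of_le_of_le tendsto_const_nhds
      (by simpa using h0.add h1) (fun _ => zero_le) fun j => ?_
    have hsplit : (fun x : S2 => tangDeriv (fun x => Q (U (ns j) x)) i x -
        fderiv ℝ Q (u x) (G i x)) =
        (fun x : S2 => fderiv ℝ Q (U (ns j) x) (tangDeriv (U (ns j)) i x - G i x)) +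
        fun x : S2 => (fderiv ℝ Q (U (ns j) x) - fderiv ℝ Q (u x)) (G i x) := by
      ext1 x
      have : tangDeriv (fun x => Q (U (ns j) x)) i x =
          fderiv ℝ Q (U (ns j) x) (tangDeriv (U (ns j)) i x) := by
        simp only [tangDeriv_eq]
        rw [fderiv_fun_comp _ (hQ.differentiable (by simp) _) ((hU _).differentiable (by simp) _)]
        rfl
      rw [this, Pi.add_apply]
      simp
    rw [hsplit]
    refine (eLpNorm_add_le ?_ ?_ one_le_two).trans (add_le_add ?_ le_rfl)
    · exact aestronglyMeasurable_clm_apply (hdQ.comp (hUc _)).aestronglyMeasurable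
        ((hdU _ _).aestronglyMeasurable.sub (hG i).1)
    · exact aestronglyMeasurable_clm_apply ((hdQ.comp (hUc _)).aestronglyMeasurable.sub
        (hdQ.comp_aestronglyMeasurable hu1.1)) (hG i).1
    · refine eLpNorm_le_mul_eLpNorm_of_ae_le_mul (Eventually.of_forall fun x => ?_) 2
      exact (ContinuousLinearMap.le_opNorm _ _).trans (by gcongr; exact hC _)

/-- A smooth map with bounded derivative that agrees with `y ↦ y / ‖y‖` near the unit sphere. -/
lemma exists_contDiff_eq_normalize : ∃ (Q : E3 → E3) (C : ℝ), ContDiff ℝ ∞ Q ∧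
    (∀ y, ‖fderiv ℝ Q y‖ ≤ C) ∧ ∀ y, 1 / 2 < ‖y‖ → ‖y‖ < 3 / 2 → Q y = ‖y‖⁻¹ • y := by
  let β : ContDiffBump (5 / 4 : ℝ) := ⟨1, 9 / 8, one_pos, by norm_num⟩
  have hβ0 : ∀ s, s ∉ Ioo (1 / 8 : ℝ) (19 / 8) → β s = 0 := fun s hs => by
    refine β.zero_of_le_dist ?_
    rw [Real.dist_eq]
    by_contra! h
    rw [abs_lt] at h
    exact hs ⟨by linarith [h.1], by linarith [h.2]⟩
  have hψ : ContDiff ℝ ∞ fun s : ℝ => β s * (Real.sqrt s)⁻¹ := by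
    rw [contDiff_iff_contDiffAt]
    intro s
    rcases lt_or_ge 0 s with h | h
    · exact β.contDiffAt.mul ((Real.contDiffAt_sqrt h.ne').inv (Real.sqrt_pos.2 h).ne')
    · refine (contDiffAt_const (c := (0 : ℝ))).congr_of_eventuallyEq ?_
      filter_upwards [Iio_mem_nhds (show s < 1 / 8 by linarith)] with t ht
      rw [hβ0 t (fun h' => absurd h'.1 (not_lt.2 (le_of_lt ht))), zero_mul]
  have hQ : ContDiff ℝ ∞ fun y : E3 => (β (‖y‖ ^ 2) * (Real.sqrt (‖y‖ ^ 2))⁻¹) • y :=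
    (hψ.comp (contDiff_norm_sq ℝ)).smul contDiff_id
  have hsupp : HasCompactSupport fun y : E3 => (β (‖y‖ ^ 2) * (Real.sqrt (‖y‖ ^ 2))⁻¹) • y := by
    refine HasCompactSupport.of_support_subset_isCompact (isCompact_closedBall (0 : E3) 2) ?_
    intro y hy
    rw [Function.mem_support] at hy
    by_contra h
    rw [mem_closedBall_zero_iff, not_le] at h
    exact hy (by rw [hβ0 _ (fun h' => by nlinarith [h'.2]), zero_mul, zero_smul])
  obtain ⟨C, hC⟩ := (hsupp.fderiv (𝕜 := ℝ)).exists_bound_of_continuous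
    (hQ.continuous_fderiv (by simp))
  refine ⟨_, C, hQ, hC, fun y h1 h2 => ?_⟩
  have : β (‖y‖ ^ 2) = 1 := by
    refine β.one_of_mem_closedBall ?_
    rw [Metric.mem_closedBall, Real.dist_eq, abs_le]
    constructor <;> nlinarith
  simp only [this, one_mul, Real.sqrt_sq (norm_nonneg y)]

lemma hasFDerivAt_normalize {y : E3} (hy : y ≠ 0) (v : E3) :
    fderiv ℝ (fun y : E3 => ‖y‖⁻¹ • y) y v = ‖y‖⁻¹ • v - (‖y‖⁻¹ ^ 3 * inner ℝ y v) • y := by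
  have hn : ‖y‖ ≠ 0 := norm_ne_zero_iff.2 hy
  have h1 : HasFDerivAt (fun y : E3 => ‖y‖) (‖y‖⁻¹ • innerSL ℝ y) y := by
    have h := ((hasStrictFDerivAt_norm_sq y).hasFDerivAt).sqrt (by positivity)
    simp only [Real.sqrt_sq (norm_nonneg _)] at h
    refine h.congr_fderiv ?_
    ext w
    simp
    field_simp
  have h2 : HasFDerivAt (fun y : E3 => ‖y‖⁻¹ • y) _ y :=
    ((hasDerivAt_inv hn).comp_hasFDerivAt y h1).smul (hasFDerivAt_id y)
  rw [h2.fderiv]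
  simp [smul_smul, sub_eq_add_neg]
  congr 1
  field_simp

/-- The gradient of a projected variation `(m + εφ) / |m + εφ|`. -/
lemma HasH1Gradient.variation {m φ : S2 → E3} {G H : Fin 3 → S2 → E3} (hm : HasH1Gradient m G)
    (hφ : HasH1Gradient φ H) (hm1 : ∀ᵐ x ∂surf, ‖m x‖ = 1) {B ε : ℝ}
    (hB : ∀ᵐ x ∂surf, ‖φ x‖ ≤ B) (hε : |ε| * B < 1 / 2) :
    HasH1Gradient (variation m φ ε) (fun i x => ‖m x + ε • φ x‖⁻¹ • (G i x + ε • H i x) -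
      (‖m x + ε • φ x‖⁻¹ ^ 3 * inner ℝ (m x + ε • φ x) (G i x + ε • H i x)) •
        (m x + ε • φ x)) := by
  obtain ⟨Q, C, hQ, hC, hQe⟩ := exists_contDiff_eq_normalize
  have hann : ∀ᵐ x ∂surf, 1 / 2 < ‖m x + ε • φ x‖ ∧ ‖m x + ε • φ x‖ < 3 / 2 := by
    filter_upwards [hm1, hB] with x h1 h2
    have h3 : ‖ε • φ x‖ < 1 / 2 := by
      rw [norm_smul, Real.norm_eq_abs]
      exact (mul_le_mul_of_nonneg_left h2 (abs_nonneg _)).trans_lt hε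
    have h4 := norm_add_le (m x) (ε • φ x)
    have h5 := norm_sub_le (m x + ε • φ x) (ε • φ x)
    rw [add_sub_cancel_right] at h5
    constructor <;> linarith
  refine ((hm.add (hφ.const_smul ε)).comp_contDiff hQ hC).congr_ae ?_ fun i => ?_
  · filter_upwards [hann] with x hx
    exact hQe _ hx.1 hx.2
  · filter_upwards [hann] with x hx
    have hev : Q =ᶠ[𝓝 (m x + ε • φ x)] fun y => ‖y‖⁻¹ • y := by
      filter_upwards [continuous_norm.continuousAt.eventually_mem
        (Ioo_mem_nhds hx.1 hx.2)] with y hy using hQe y hy.1 hy.2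
    rw [hev.fderiv_eq, hasFDerivAt_normalize]
    rintro h
    have := hx.1
    rw [h, norm_zero] at this
    linarith

/-! ### The energy along projected variations -/

lemma abs_div_le_four_mul {x ρ : ℝ} (hρ : 1 / 4 ≤ ρ) : |x / ρ| ≤ 4 * |x| := by
  rw [abs_div, abs_of_pos (by linarith : 0 < ρ), div_le_iff₀ (by linarith)]
  nlinarith [abs_nonneg x]

/-- First order expansion of `α / ρ - β² / ρ²` in `ε` with `α = g + 2εA₁ + ε²A₂`,
`β = εβ₁ + ε²β₂` and `ρ = 1 + εμ + ε²n`. -/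
lemma abs_quotient_expansion_le {g A₁ A₂ μ n β₁ β₂ ε B D ρ : ℝ} (hρ : ρ = 1 + ε * μ + ε ^ 2 * n)
    (hρ4 : 1 / 4 ≤ ρ) (hε : |ε| ≤ 1) (hB : 0 ≤ B) (hμ : |μ| ≤ 2 * B) (hn0 : 0 ≤ n)
    (hn : n ≤ B ^ 2) (hg0 : 0 ≤ g) (hg : g ≤ D) (hA0 : 0 ≤ A₂) (hA : A₂ ≤ D) (hA1 : 2 * |A₁| ≤ D)
    (hβ : (|β₁| + |β₂|) ^ 2 ≤ 2 * (1 + B) ^ 2 * D) :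
    |(g + 2 * ε * A₁ + ε ^ 2 * A₂) / ρ - (ε * β₁ + ε ^ 2 * β₂) ^ 2 / ρ ^ 2 - g -
      ε * (2 * A₁ - g * μ)| ≤
      (4 * (1 + B ^ 2 + (1 + 2 * B) * (2 * B + B ^ 2)) + 32 * (1 + B) ^ 2) * D * ε ^ 2 := by
  have hρ0 : ρ ≠ 0 := by linarith
  have hD : 0 ≤ D := hg0.trans hg
  have hid : (g + 2 * ε * A₁ + ε ^ 2 * A₂) / ρ - (ε * β₁ + ε ^ 2 * β₂) ^ 2 / ρ ^ 2 - g -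
      ε * (2 * A₁ - g * μ) = ε ^ 2 * ((A₂ - g * n - (2 * A₁ - g * μ) * (μ + ε * n)) / ρ -
        (β₁ + ε * β₂) ^ 2 / ρ / ρ) := by
    field_simp
    rw [hρ]
    ring
  have h1 : |A₂ - g * n| ≤ D * (1 + B ^ 2) := by
    rw [abs_le]
    constructor <;> nlinarith [mul_nonneg hg0 hn0, mul_le_mul hg hn hn0 hD, mul_nonneg hD (sq_nonneg B)]
  have h2 : |2 * A₁ - g * μ| ≤ D * (1 + 2 * B) := by
    refine (abs_sub _ _).trans ?_
    rw [abs_mul, abs_mul, abs_of_nonneg hg0, abs_two]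
    nlinarith [mul_le_mul hg hμ (abs_nonneg μ) hD]
  have h3 : |μ + ε * n| ≤ 2 * B + B ^ 2 := by
    refine (abs_add_le _ _).trans ?_
    rw [abs_mul, abs_of_nonneg hn0]
    nlinarith [mul_le_mul hε hn hn0 zero_le_one]
  have h4 : |A₂ - g * n - (2 * A₁ - g * μ) * (μ + ε * n)| ≤
      D * (1 + B ^ 2) + D * (1 + 2 * B) * (2 * B + B ^ 2) := by
    refine (abs_sub _ _).trans (add_le_add h1 ?_)
    rw [abs_mul]
    exact mul_le_mul h2 h3 (abs_nonneg _) (by positivity)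
  have h5 : |(β₁ + ε * β₂) ^ 2| ≤ 2 * (1 + B) ^ 2 * D := by
    refine le_trans ?_ hβ
    rw [abs_pow]
    refine pow_le_pow_left₀ (abs_nonneg _) ((abs_add_le _ _).trans ?_) 2
    rw [abs_mul]
    nlinarith [abs_nonneg β₂]
  rw [hid, abs_mul, abs_of_nonneg (sq_nonneg ε), mul_comm _ (ε ^ 2)]
  refine mul_le_mul_of_nonneg_left ?_ (sq_nonneg ε)
  refine (abs_sub _ _).trans ?_
  have h6 := abs_div_le_four_mul (x := A₂ - g * n - (2 * A₁ - g * μ) * (μ + ε * n)) hρ4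
  have h7 := abs_div_le_four_mul (x := (β₁ + ε * β₂) ^ 2 / ρ) hρ4
  have h8 := abs_div_le_four_mul (x := (β₁ + ε * β₂) ^ 2) hρ4
  nlinarith

/-- Second order expansion of the same quotient in the tangential case `μ = β₁ = 0`. -/
lemma abs_quotient_expansion_two_le {g A₁ A₂ n β₂ ε B D ρ : ℝ} (hρ : ρ = 1 + ε ^ 2 * n)
    (hε : |ε| ≤ 1) (hn0 : 0 ≤ n)
    (hn : n ≤ B ^ 2) (hg0 : 0 ≤ g) (hg : g ≤ D) (hA0 : 0 ≤ A₂) (hA : A₂ ≤ D) (hA1 : 2 * |A₁| ≤ D)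
    (hβ : β₂ ^ 2 ≤ B ^ 2 * D) :
    |(g + 2 * ε * A₁ + ε ^ 2 * A₂) / ρ - (ε ^ 2 * β₂) ^ 2 / ρ ^ 2 - g -
      ε * (2 * A₁) - ε ^ 2 * (A₂ - g * n)| ≤
      (B ^ 2 * (1 + B ^ 2) + 2 * B ^ 2) * D * |ε| ^ 3 := by
  have hρ1 : 1 ≤ ρ := by rw [hρ]; nlinarith [mul_nonneg (sq_nonneg ε) hn0]
  have hρ0 : ρ ≠ 0 := by linarith
  have hD : 0 ≤ D := hg0.trans hg
  have hdiv : ∀ x : ℝ, |x / ρ| ≤ |x| := fun x => by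
    rw [abs_div, abs_of_pos (by linarith : 0 < ρ)]
    exact div_le_self (abs_nonneg x) hρ1
  have hid : (g + 2 * ε * A₁ + ε ^ 2 * A₂) / ρ - (ε ^ 2 * β₂) ^ 2 / ρ ^ 2 - g -
      ε * (2 * A₁) - ε ^ 2 * (A₂ - g * n) =
      ε ^ 3 * ((-(ε * ((A₂ - g * n) * n)) - 2 * A₁ * n) / ρ - ε * β₂ ^ 2 / ρ / ρ) := by
    field_simp
    rw [hρ]
    ring
  have h1 : |A₂ - g * n| ≤ D * (1 + B ^ 2) := by
    rw [abs_le]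
    constructor <;> nlinarith [mul_nonneg hg0 hn0, mul_le_mul hg hn hn0 hD, mul_nonneg hD (sq_nonneg B)]
  have h2 : |-(ε * ((A₂ - g * n) * n)) - 2 * A₁ * n| ≤ D * (1 + B ^ 2) * B ^ 2 + D * B ^ 2 := by
    refine (abs_sub _ _).trans ?_
    rw [abs_neg, abs_mul, abs_mul, abs_mul (2 * A₁), abs_mul 2, abs_of_nonneg hn0, abs_two]
    have h3 := mul_le_mul h1 hn hn0 (by positivity)
    have h4 := mul_le_mul hA1 hn hn0 hD
    have h5 := mul_le_mul hε h3 (mul_nonneg (abs_nonneg _) hn0) zero_le_one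
    linarith
  have h3 : |ε * β₂ ^ 2| ≤ B ^ 2 * D := by
    rw [abs_mul, abs_of_nonneg (sq_nonneg β₂)]
    nlinarith [mul_le_mul hε hβ (sq_nonneg β₂) zero_le_one]
  rw [hid, abs_mul, abs_pow, mul_comm _ (|ε| ^ 3)]
  refine mul_le_mul_of_nonneg_left ?_ (by positivity)
  refine (abs_sub _ _).trans ?_
  have h6 := hdiv (-(ε * ((A₂ - g * n) * n)) - 2 * A₁ * n)
  have h7 := (hdiv (ε * β₂ ^ 2 / ρ)).trans (hdiv (ε * β₂ ^ 2))
  nlinarith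

lemma HasH1Gradient.integrable_norm_sq {u : S2 → E3} {G : Fin 3 → S2 → E3}
    (hu : HasH1Gradient u G) (i : Fin 3) : Integrable (fun x => ‖G i x‖ ^ 2) surf :=
  (hu.2.1 i).integrable_norm_pow two_ne_zero

lemma HasH1Gradient.integrable_density {u : S2 → E3} {G : Fin 3 → S2 → E3}
    (hu : HasH1Gradient u G) (κ : ℝ) : Integrable (energyDensity κ u G) surf := by
  refine (integrable_finsetSum _ fun i _ => hu.integrable_norm_sq i).add
    (Integrable.const_mul ((integrable_const 1).sub ?_) κ)
  refine (hu.1.integrable_norm_pow two_ne_zero).mono'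
    ((hu.1.1.inner continuous_subtype_val.aestronglyMeasurable).pow 2)
    (Eventually.of_forall fun x => ?_)
  rw [norm_pow]
  gcongr
  refine (norm_inner_le_norm _ _).trans ?_
  rw [x.norm_coe, mul_one]

/-- The squared norm of the derivative of `y ↦ y / ‖y‖` in the direction `v`. -/
lemma norm_sq_fderiv_normalize {y v : E3} (hy : y ≠ 0) :
    ‖‖y‖⁻¹ • v - (‖y‖⁻¹ ^ 3 * inner ℝ y v) • y‖ ^ 2 =
      ‖v‖ ^ 2 / ‖y‖ ^ 2 - inner ℝ y v ^ 2 / (‖y‖ ^ 2) ^ 2 := by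
  have hn : ‖y‖ ≠ 0 := norm_ne_zero_iff.2 hy
  rw [norm_sub_sq_real, norm_smul, norm_smul, real_inner_smul_left, real_inner_smul_right,
    real_inner_comm y v]
  simp only [mul_pow, norm_mul, Real.norm_eq_abs, sq_abs, abs_pow, abs_inv, abs_norm]
  field_simp
  ring

/-- The energy density along a projected variation, with `ρ = |m + εφ|²`. -/
lemma variation_density_eq {m φ p : E3} {G H : Fin 3 → E3} {ε : ℝ} (κ : ℝ)
    (hy : m + ε • φ ≠ 0) :
    (∑ i, ‖‖m + ε • φ‖⁻¹ • (G i + ε • H i) -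
      (‖m + ε • φ‖⁻¹ ^ 3 * inner ℝ (m + ε • φ) (G i + ε • H i)) • (m + ε • φ)‖ ^ 2) +
      κ * (1 - (inner ℝ (‖m + ε • φ‖⁻¹ • (m + ε • φ)) p) ^ 2) =
    (∑ i, (‖G i + ε • H i‖ ^ 2 / ‖m + ε • φ‖ ^ 2 -
      inner ℝ (m + ε • φ) (G i + ε • H i) ^ 2 / (‖m + ε • φ‖ ^ 2) ^ 2)) +
      κ * (1 - (inner ℝ m p + ε * inner ℝ φ p) ^ 2 / ‖m + ε • φ‖ ^ 2) := by
  congr 1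
  · exact Finset.sum_congr rfl fun i _ => norm_sq_fderiv_normalize hy
  · rw [real_inner_smul_left, inner_add_left, real_inner_smul_left, mul_pow, inv_pow]
    ring

lemma norm_sq_add_smul (a b : E3) (ε : ℝ) :
    ‖a + ε • b‖ ^ 2 = ‖a‖ ^ 2 + 2 * ε * inner ℝ a b + ε ^ 2 * ‖b‖ ^ 2 := by
  rw [norm_add_sq_real, norm_smul, real_inner_smul_right, mul_pow, Real.norm_eq_abs, sq_abs]
  ring

/-- The density of the first variation of the energy at `m` in the direction `φ`. -/
noncomputable def firstVariationDensity (κ : ℝ) (m φ : S2 → E3) (G H : Fin 3 → S2 → E3)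
    (x : S2) : ℝ :=
  (∑ i, (2 * inner ℝ (G i x) (H i x) - ‖G i x‖ ^ 2 * (2 * inner ℝ (m x) (φ x)))) -
    κ * (2 * (inner ℝ (m x) (x : E3) * inner ℝ (φ x) (x : E3)) -
      inner ℝ (m x) (x : E3) ^ 2 * (2 * inner ℝ (m x) (φ x)))

lemma two_mul_abs_inner_le (a b : E3) : 2 * |inner ℝ a b| ≤ ‖a‖ ^ 2 + ‖b‖ ^ 2 := by
  nlinarith [abs_real_inner_le_norm a b, sq_nonneg (‖a‖ - ‖b‖)]

/-- First order expansion of the energy density along a projected variation. -/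
lemma exists_density_expansion (κ B : ℝ) (hB : 0 ≤ B) : ∃ K : ℝ, ∀ (m φ : S2 → E3)
    (G H : Fin 3 → S2 → E3) (x : S2) (ε : ℝ), ‖m x‖ = 1 → (∀ i, inner ℝ (m x) (G i x) = 0) →
    ‖φ x‖ ≤ B → |ε| ≤ 1 → |ε| * B < 1 / 2 →
    |((∑ i, (‖G i x + ε • H i x‖ ^ 2 / ‖m x + ε • φ x‖ ^ 2 -
      inner ℝ (m x + ε • φ x) (G i x + ε • H i x) ^ 2 / (‖m x + ε • φ x‖ ^ 2) ^ 2)) +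
      κ * (1 - (inner ℝ (m x) x + ε * inner ℝ (φ x) x) ^ 2 / ‖m x + ε • φ x‖ ^ 2)) -
      ((∑ i, ‖G i x‖ ^ 2) + κ * (1 - (inner ℝ (m x) (x : E3)) ^ 2)) -
      ε * firstVariationDensity κ m φ G H x| ≤
      K * ((∑ i, (‖G i x‖ ^ 2 + ‖H i x‖ ^ 2)) + 1) * ε ^ 2 := by
  set K₀ := 4 * (1 + B ^ 2 + (1 + 2 * B) * (2 * B + B ^ 2)) + 32 * (1 + B) ^ 2 with hK₀
  have hK₀0 : 0 ≤ K₀ := by positivity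
  refine ⟨K₀ + |κ| * (K₀ * (1 + B ^ 2)), fun m φ G H x ε hm hmG hφ hε hεB => ?_⟩
  set ρ := ‖m x + ε • φ x‖ ^ 2 with hρd
  have hρ : ρ = 1 + ε * (2 * inner ℝ (m x) (φ x)) + ε ^ 2 * ‖φ x‖ ^ 2 := by
    rw [hρd, norm_sq_add_smul, hm]; ring
  have hρ4 : 1 / 4 ≤ ρ := by
    have h3 : ‖ε • φ x‖ < 1 / 2 := by
      rw [norm_smul, Real.norm_eq_abs]
      exact (mul_le_mul_of_nonneg_left hφ (abs_nonneg _)).trans_lt hεB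
    have h5 := norm_sub_le (m x + ε • φ x) (ε • φ x)
    rw [add_sub_cancel_right, hm] at h5
    nlinarith
  have hμ : |2 * inner ℝ (m x) (φ x)| ≤ 2 * B := by
    rw [abs_mul, abs_two]
    have := abs_real_inner_le_norm (m x) (φ x)
    rw [hm] at this
    linarith
  have hn : ‖φ x‖ ^ 2 ≤ B ^ 2 := pow_le_pow_left₀ (norm_nonneg _) hφ 2
  have hi : ∀ i, |‖G i x + ε • H i x‖ ^ 2 / ρ -
      inner ℝ (m x + ε • φ x) (G i x + ε • H i x) ^ 2 / ρ ^ 2 - ‖G i x‖ ^ 2 -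
      ε * (2 * inner ℝ (G i x) (H i x) - ‖G i x‖ ^ 2 * (2 * inner ℝ (m x) (φ x)))| ≤
      K₀ * (‖G i x‖ ^ 2 + ‖H i x‖ ^ 2) * ε ^ 2 := by
    intro i
    have h1 : inner ℝ (m x + ε • φ x) (G i x + ε • H i x) =
        ε * (inner ℝ (m x) (H i x) + inner ℝ (φ x) (G i x)) + ε ^ 2 * inner ℝ (φ x) (H i x) := by
      simp only [inner_add_left, inner_add_right, real_inner_smul_left, real_inner_smul_right,
        hmG i]
      ring
    rw [h1, norm_sq_add_smul]
    refine abs_quotient_expansion_le hρ hρ4 hε hB hμ (sq_nonneg _) hn (sq_nonneg _) ?_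
      (sq_nonneg _) ?_ (two_mul_abs_inner_le _ _) ?_
    · linarith [sq_nonneg ‖H i x‖]
    · linarith [sq_nonneg ‖G i x‖]
    · have a1 := abs_real_inner_le_norm (m x) (H i x)
      have a2 := abs_real_inner_le_norm (φ x) (G i x)
      have a3 := abs_real_inner_le_norm (φ x) (H i x)
      have a4 := abs_add_le (inner ℝ (m x) (H i x)) (inner ℝ (φ x) (G i x))
      rw [hm, one_mul] at a1
      have a5 := mul_le_mul_of_nonneg_right hφ (norm_nonneg (G i x))
      have a6 := mul_le_mul_of_nonneg_right hφ (norm_nonneg (H i x))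
      have a7 : |inner ℝ (m x) (H i x) + inner ℝ (φ x) (G i x)| + |inner ℝ (φ x) (H i x)| ≤
          (1 + B) * (‖G i x‖ + ‖H i x‖) := by nlinarith [norm_nonneg (G i x)]
      refine (pow_le_pow_left₀ (by positivity) a7 2).trans ?_
      rw [mul_pow, mul_comm 2, mul_assoc]
      refine mul_le_mul_of_nonneg_left ?_ (sq_nonneg _)
      nlinarith [sq_nonneg (‖G i x‖ - ‖H i x‖)]
  have hs : |inner ℝ (m x) (x : E3)| ≤ 1 := by
    have := abs_real_inner_le_norm (m x) (x : E3)
    rwa [hm, x.norm_coe, one_mul] at this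
  have hσ : |inner ℝ (φ x) (x : E3)| ≤ B := by
    have := abs_real_inner_le_norm (φ x) (x : E3)
    rw [x.norm_coe, mul_one] at this
    exact this.trans hφ
  have hpot : |(inner ℝ (m x) (x : E3) ^ 2 + 2 * ε * (inner ℝ (m x) (x : E3) *
      inner ℝ (φ x) (x : E3)) + ε ^ 2 * inner ℝ (φ x) (x : E3) ^ 2) / ρ -
      (ε * 0 + ε ^ 2 * 0) ^ 2 / ρ ^ 2 - inner ℝ (m x) (x : E3) ^ 2 -
      ε * (2 * (inner ℝ (m x) (x : E3) * inner ℝ (φ x) (x : E3)) -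
        inner ℝ (m x) (x : E3) ^ 2 * (2 * inner ℝ (m x) (φ x)))| ≤ K₀ * (1 + B ^ 2) * ε ^ 2 := by
    have hs2 : inner ℝ (m x) (x : E3) ^ 2 ≤ 1 := by
      rw [← sq_abs]; exact pow_le_one₀ (abs_nonneg _) hs
    have hσ2 : inner ℝ (φ x) (x : E3) ^ 2 ≤ B ^ 2 := by
      rw [← sq_abs]; exact pow_le_pow_left₀ (abs_nonneg _) hσ 2
    refine abs_quotient_expansion_le hρ hρ4 hε hB hμ (sq_nonneg _) hn (sq_nonneg _) ?_
      (sq_nonneg _) ?_ ?_ ?_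
    · nlinarith
    · nlinarith
    · rw [abs_mul]
      nlinarith [sq_abs (inner ℝ (m x) (x : E3)), sq_abs (inner ℝ (φ x) (x : E3)),
        sq_nonneg (|inner ℝ (m x) (x : E3)| - |inner ℝ (φ x) (x : E3)|)]
    · rw [abs_zero, add_zero, zero_pow two_ne_zero]
      positivity
  have hsum := (Finset.abs_sum_le_sum_abs _ _).trans
    (Finset.sum_le_sum fun i (_ : i ∈ Finset.univ) => hi i)
  rw [← Finset.sum_mul, ← Finset.mul_sum] at hsum
  have hκ := mul_le_mul_of_nonneg_left hpot (abs_nonneg κ)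
  rw [← abs_mul] at hκ
  have hdec : ∀ {a b c d e : ℝ}, |a| ≤ b → |c| ≤ d → e = a - c → |e| ≤ b + d := by
    rintro a b c d e h1 h2 rfl
    exact (abs_sub _ _).trans (add_le_add h1 h2)
  refine (hdec hsum hκ ?_).trans ?_
  · simp only [Finset.sum_sub_distrib, ← Finset.mul_sum, firstVariationDensity]
    ring
  · have h0 : 0 ≤ ∑ i, (‖G i x‖ ^ 2 + ‖H i x‖ ^ 2) := Finset.sum_nonneg fun i _ => by positivity
    have h1 : 0 ≤ |κ| * (K₀ * (1 + B ^ 2)) := by positivity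
    have h2 := mul_nonneg h1 h0
    have h3 := mul_nonneg h2 (sq_nonneg ε)
    have h4 := mul_nonneg hK₀0 (sq_nonneg ε)
    nlinarith

lemma integrable_firstVariationDensity {κ C : ℝ} {m φ : S2 → E3} {G H : Fin 3 → S2 → E3}
    (hm : HasH1Gradient m G) (hφ : HasH1Gradient φ H) (hm1 : ∀ x, ‖m x‖ = 1)
    (hGC : ∀ i x, ‖G i x‖ ≤ C) :
    Integrable (firstVariationDensity κ m φ G H) surf := by
  have hφi : Integrable φ surf := hφ.1.integrable one_le_two
  have hmφ : Integrable (fun x => inner ℝ (m x) (φ x)) surf := by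
    refine hφi.norm.mono' (hm.1.1.inner hφi.1) (Eventually.of_forall fun x => ?_)
    have := norm_inner_le_norm (𝕜 := ℝ) (m x) (φ x)
    rwa [hm1, one_mul] at this
  have hxm : AEStronglyMeasurable (fun x : S2 => (x : E3)) surf :=
    continuous_subtype_val.aestronglyMeasurable
  have hφx : Integrable (fun x => inner ℝ (φ x) (x : E3)) surf := by
    refine hφi.norm.mono' (hφi.1.inner hxm) (Eventually.of_forall fun x => ?_)
    have := norm_inner_le_norm (𝕜 := ℝ) (φ x) (x : E3)
    rwa [x.norm_coe, mul_one] at this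
  have hs : ∀ x, ‖inner ℝ (m x) (x : E3)‖ ≤ 1 := fun x => by
    have := norm_inner_le_norm (𝕜 := ℝ) (m x) (x : E3)
    rwa [hm1, x.norm_coe, one_mul] at this
  refine (integrable_finsetSum _ fun i _ => ?_).sub (Integrable.const_mul ?_ κ)
  · refine Integrable.sub (Integrable.const_mul ?_ 2) ?_
    · refine (((hφ.2.1 i).integrable one_le_two).norm.const_mul C).mono'
        ((hm.2.1 i).1.inner (hφ.2.1 i).1) (Eventually.of_forall fun x => ?_)
      refine (norm_inner_le_norm _ _).trans ?_
      gcongr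
      exact hGC i x
    · refine (hmφ.const_mul 2).bdd_mul (c := C ^ 2) ((hm.2.1 i).1.norm.pow 2)
        (Eventually.of_forall fun x => ?_)
      simp only [norm_pow, norm_norm]
      gcongr
      exact hGC i x
  · refine Integrable.sub (Integrable.const_mul ?_ 2) ?_
    · exact hφx.bdd_mul (c := 1) (hm.1.1.inner hxm) (Eventually.of_forall hs)
    · refine (hmφ.const_mul 2).bdd_mul (c := 1 ^ 2) ((hm.1.1.inner hxm).pow 2)
        (Eventually.of_forall fun x => ?_)
      simp only [norm_pow]
      gcongr
      exact hs x

lemma hasDerivAt_zero_of_abs_le {f : ℝ → ℝ} {L K δ : ℝ} (hδ : 0 < δ)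
    (h : ∀ ε, |ε| < δ → |f ε - f 0 - ε * L| ≤ K * ε ^ 2) : HasDerivAt f L 0 := by
  rw [hasDerivAt_iff_isLittleO_nhds_zero]
  simp only [zero_add, smul_eq_mul]
  have h1 : (fun ε : ℝ => f ε - f 0 - ε * L) =O[𝓝 0] fun ε => ε ^ 2 := by
    refine Asymptotics.IsBigO.of_bound K ?_
    filter_upwards [Metric.ball_mem_nhds (0 : ℝ) hδ] with ε hε
    rw [mem_ball_zero_iff, Real.norm_eq_abs] at hε
    simpa using h ε hε
  refine h1.trans_isLittleO ?_
  simpa using Asymptotics.isLittleO_pow_id (one_lt_two)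

lemma variation_zero {m : S2 → E3} (hm1 : ∀ x, ‖m x‖ = 1) (φ : S2 → E3) : variation m φ 0 = m := by
  ext1 x; simp [variation, hm1]

lemma add_smul_ne_zero {a b : E3} {ε B : ℝ} (ha : ‖a‖ = 1) (hb : ‖b‖ ≤ B) (hε : |ε| * B < 1 / 2) :
    a + ε • b ≠ 0 := by
  intro h
  have h1 : ‖ε • b‖ ≤ |ε| * B := by
    rw [norm_smul, Real.norm_eq_abs]; gcongr
  have h2 := norm_sub_le (a + ε • b) (ε • b)
  rw [add_sub_cancel_right, ha, h, norm_zero] at h2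
  linarith

/-- The energy density of `(m + εφ) / |m + εφ|`, written without normalization. -/
noncomputable def variationDensity (κ : ℝ) (m φ : S2 → E3) (G H : Fin 3 → S2 → E3) (ε : ℝ)
    (x : S2) : ℝ :=
  (∑ i, (‖G i x + ε • H i x‖ ^ 2 / ‖m x + ε • φ x‖ ^ 2 -
      inner ℝ (m x + ε • φ x) (G i x + ε • H i x) ^ 2 / (‖m x + ε • φ x‖ ^ 2) ^ 2)) +
      κ * (1 - (inner ℝ (m x) x + ε * inner ℝ (φ x) x) ^ 2 / ‖m x + ε • φ x‖ ^ 2)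

section

variable {m φ : S2 → E3} {G H : Fin 3 → S2 → E3} {B C : ℝ}

lemma energy_variation_eq (hm : HasH1Gradient m G) (hφ : HasH1Gradient φ H)
    (hm1 : ∀ x, ‖m x‖ = 1) (hB : ∀ᵐ x ∂surf, ‖φ x‖ ≤ B) {ε : ℝ} (hε : |ε| * B < 1 / 2) (κ : ℝ) :
    Integrable (variationDensity κ m φ G H ε) surf ∧
    energy κ (variation m φ ε) = (1 / 2) * ∫ x, variationDensity κ m φ G H ε x ∂surf := by
  have hv := hm.variation hφ (Eventually.of_forall hm1) hB hε
  have hae : ∀ᵐ x ∂surf, (∑ i, ‖‖m x + ε • φ x‖⁻¹ • (G i x + ε • H i x) -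
      (‖m x + ε • φ x‖⁻¹ ^ 3 * inner ℝ (m x + ε • φ x) (G i x + ε • H i x)) •
        (m x + ε • φ x)‖ ^ 2) + κ * (1 - (inner ℝ (variation m φ ε x) (x : E3)) ^ 2) =
      variationDensity κ m φ G H ε x := by
    filter_upwards [hB] with x hx
    exact variation_density_eq κ (add_smul_ne_zero (hm1 x) hx hε)
  refine ⟨(hv.integrable_density κ).congr hae, ?_⟩
  rw [hv.energy_eq]
  exact congrArg _ (integral_congr_ae hae)

/-- The first variation of the energy. -/
lemma hasDerivAt_energy_variation (hm : HasH1Gradient m G) (hφ : HasH1Gradient φ H)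
    (hm1 : ∀ x, ‖m x‖ = 1) (hmG : ∀ i x, inner ℝ (m x) (G i x) = 0) (hGC : ∀ i x, ‖G i x‖ ≤ C)
    (hB : ∀ᵐ x ∂surf, ‖φ x‖ ≤ B) (hB0 : 0 ≤ B) (κ : ℝ) :
    HasDerivAt (fun ε => energy κ (variation m φ ε))
      ((1 / 2) * ∫ x, firstVariationDensity κ m φ G H x ∂surf) 0 := by
  obtain ⟨K, hK⟩ := exists_density_expansion κ B hB0
  have hPi : Integrable (fun x => (∑ i, (‖G i x‖ ^ 2 + ‖H i x‖ ^ 2)) + 1) surf :=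
    (integrable_finsetSum _ fun i _ => (hm.integrable_norm_sq i).add
      (hφ.integrable_norm_sq i)).add (integrable_const 1)
  have hB1 : 0 < 2 * B + 2 := by linarith
  refine hasDerivAt_zero_of_abs_le (K := (1 / 2) * (K * ∫ x, ((∑ i, (‖G i x‖ ^ 2 +
    ‖H i x‖ ^ 2)) + 1) ∂surf)) (δ := 1 / (2 * B + 2)) (by positivity) fun ε hε => ?_
  rw [lt_div_iff₀ hB1] at hε
  have hε1 : |ε| ≤ 1 := by nlinarith [abs_nonneg ε]
  have hεB : |ε| * B < 1 / 2 := by nlinarith [abs_nonneg ε]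
  obtain ⟨hvi, hv⟩ := energy_variation_eq hm hφ hm1 hB hεB κ
  have h1i := integrable_firstVariationDensity (κ := κ) hm hφ hm1 hGC
  rw [hv, variation_zero hm1, hm.energy_eq]
  have hsub : (1 / 2) * ∫ x, variationDensity κ m φ G H ε x ∂surf -
      (1 / 2) * ∫ x, energyDensity κ m G x ∂surf -
      ε * ((1 / 2) * ∫ x, firstVariationDensity κ m φ G H x ∂surf) =
      (1 / 2) * ∫ x, (variationDensity κ m φ G H ε x -
        energyDensity κ m G x -
        ε * firstVariationDensity κ m φ G H x) ∂surf := by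
    have i1 : Integrable (fun x => variationDensity κ m φ G H ε x - energyDensity κ m G x) surf :=
      hvi.sub (hm.integrable_density κ)
    rw [integral_sub i1 (h1i.const_mul ε),
      integral_sub hvi (hm.integrable_density κ), integral_const_mul]
    ring
  rw [hsub, abs_mul, abs_of_pos (by norm_num : (0 : ℝ) < 1 / 2), mul_assoc]
  gcongr
  rw [← Real.norm_eq_abs]
  have hle : ∫ x, K * ((∑ i, (‖G i x‖ ^ 2 + ‖H i x‖ ^ 2)) + 1) * ε ^ 2 ∂surf =
      K * (∫ x, ((∑ i, (‖G i x‖ ^ 2 + ‖H i x‖ ^ 2)) + 1) ∂surf) * ε ^ 2 := by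
    rw [integral_mul_const, integral_const_mul]
  rw [← hle]
  refine norm_integral_le_of_norm_le ((hPi.const_mul K).mul_const _) ?_
  filter_upwards [hB] with x hx
  exact hK m φ G H x ε (hm1 x) (fun i => hmG i x) hx hε1 hεB

/-- The density of the second variation of the energy at `m` in a direction `φ` orthogonal
to `m`. -/
noncomputable def secondVariationDensity (κ : ℝ) (m φ : S2 → E3) (G H : Fin 3 → S2 → E3)
    (x : S2) : ℝ :=
  (∑ i, (‖H i x‖ ^ 2 - ‖G i x‖ ^ 2 * ‖φ x‖ ^ 2)) -
    κ * (inner ℝ (φ x) (x : E3) ^ 2 - inner ℝ (m x) (x : E3) ^ 2 * ‖φ x‖ ^ 2)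

/-- Second order expansion of the energy along a bounded variation orthogonal to `m`. -/
lemma exists_energy_variation_expansion (hm : HasH1Gradient m G) (hφ : HasH1Gradient φ H)
    (hm1 : ∀ x, ‖m x‖ = 1) (hmG : ∀ i x, inner ℝ (m x) (G i x) = 0) (hGC : ∀ i x, ‖G i x‖ ≤ C)
    (hB : ∀ x, ‖φ x‖ ≤ B) (hHC : ∀ i x, ‖H i x‖ ≤ C) (hmφ : ∀ x, inner ℝ (m x) (φ x) = 0)
    (hmH : ∀ i x, inner ℝ (m x) (H i x) + inner ℝ (φ x) (G i x) = 0) (κ : ℝ)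
    (hcrit : ∫ x, firstVariationDensity κ m φ G H x ∂surf = 0) :
    ∃ K : ℝ, ∀ ε, |ε| ≤ 1 → |ε| * B < 1 / 2 →
      |energy κ (variation m φ ε) - energy κ m -
        ε ^ 2 * ((1 / 2) * ∫ x, secondVariationDensity κ m φ G H x ∂surf)| ≤ K * |ε| ^ 3 := by
  have hC0 : 0 ≤ C := (norm_nonneg _).trans (hGC 0 ⟨EuclideanSpace.single 0 1, by simp⟩)
  have hB0 : 0 ≤ B := (norm_nonneg _).trans (hB ⟨EuclideanSpace.single 0 1, by simp⟩)
  set K₀ := B ^ 2 * (1 + B ^ 2) + 2 * B ^ 2 with hK₀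
  have hK₀0 : 0 ≤ K₀ := by positivity
  set K₁ := 3 * (K₀ * (C ^ 2 + C ^ 2)) + |κ| * (K₀ * (1 + B ^ 2)) with hK₁
  refine ⟨(1 / 2) * (K₁ * surf.real univ), fun ε hε1 hεB => ?_⟩
  obtain ⟨hvi, hv⟩ := energy_variation_eq hm hφ hm1 (Eventually.of_forall hB) hεB κ
  have h1i := integrable_firstVariationDensity (κ := κ) hm hφ hm1 hGC
  have hxm : AEStronglyMeasurable (fun x : S2 => (x : E3)) surf :=
    continuous_subtype_val.aestronglyMeasurable
  have h2i : Integrable (secondVariationDensity κ m φ G H) surf := by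
    refine Integrable.of_bound (C := 3 * (C ^ 2 + C ^ 2 * B ^ 2) + |κ| * (B ^ 2 + B ^ 2)) ?_ ?_
    · refine (Finset.aestronglyMeasurable_fun_sum _ fun i _ => ((hφ.2.1 i).1.norm.pow 2).sub
        (((hm.2.1 i).1.norm.pow 2).mul (hφ.1.1.norm.pow 2))).sub
        ((((hφ.1.1.inner hxm).pow 2).sub
        (((hm.1.1.inner hxm).pow 2).mul (hφ.1.1.norm.pow 2))).const_mul κ)
    · refine Eventually.of_forall fun x => ?_
      have e1 : ‖φ x‖ ^ 2 ≤ B ^ 2 := pow_le_pow_left₀ (norm_nonneg _) (hB x) 2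
      have e2 : inner ℝ (φ x) (x : E3) ^ 2 ≤ B ^ 2 := by
        have := abs_real_inner_le_norm (φ x) (x : E3)
        rw [x.norm_coe, mul_one] at this
        rw [← sq_abs]
        exact pow_le_pow_left₀ (abs_nonneg _) (this.trans (hB x)) 2
      have e3 : inner ℝ (m x) (x : E3) ^ 2 ≤ 1 := by
        have := abs_real_inner_le_norm (m x) (x : E3)
        rw [x.norm_coe, mul_one, hm1] at this
        rw [← sq_abs]
        exact pow_le_one₀ (abs_nonneg _) this
      have e4 : inner ℝ (m x) (x : E3) ^ 2 * ‖φ x‖ ^ 2 ≤ B ^ 2 := by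
        nlinarith [mul_le_mul e3 e1 (sq_nonneg _) zero_le_one]
      rw [Real.norm_eq_abs, secondVariationDensity]
      refine (abs_sub _ _).trans (add_le_add ((Finset.abs_sum_le_sum_abs _ _).trans ?_) ?_)
      · refine (Finset.sum_le_sum (g := fun _ => C ^ 2 + C ^ 2 * B ^ 2) fun i _ => ?_).trans
          (by simp [mul_add])
        have f1 : ‖H i x‖ ^ 2 ≤ C ^ 2 := pow_le_pow_left₀ (norm_nonneg _) (hHC i x) 2
        have f2 : ‖G i x‖ ^ 2 ≤ C ^ 2 := pow_le_pow_left₀ (norm_nonneg _) (hGC i x) 2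
        have f3 := mul_le_mul f2 e1 (sq_nonneg _) (sq_nonneg C)
        rw [abs_le]
        constructor <;> nlinarith [sq_nonneg ‖H i x‖, mul_nonneg (sq_nonneg ‖G i x‖)
          (sq_nonneg ‖φ x‖), sq_nonneg C, mul_nonneg (sq_nonneg C) (sq_nonneg B)]
      · rw [abs_mul]
        refine mul_le_mul_of_nonneg_left ?_ (abs_nonneg κ)
        rw [abs_le]
        constructor <;> nlinarith [sq_nonneg (inner ℝ (φ x) (x : E3)),
          mul_nonneg (sq_nonneg (inner ℝ (m x) (x : E3))) (sq_nonneg ‖φ x‖), sq_nonneg B]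
  rw [hv, hm.energy_eq]
  have hsub : (1 / 2) * ∫ x, variationDensity κ m φ G H ε x ∂surf -
      (1 / 2) * ∫ x, energyDensity κ m G x ∂surf -
      ε ^ 2 * ((1 / 2) * ∫ x, secondVariationDensity κ m φ G H x ∂surf) =
      (1 / 2) * ∫ x, (variationDensity κ m φ G H ε x -
        energyDensity κ m G x -
        ε * firstVariationDensity κ m φ G H x -
        ε ^ 2 * secondVariationDensity κ m φ G H x) ∂surf := by
    have i1 : Integrable (fun x => variationDensity κ m φ G H ε x - energyDensity κ m G x) surf :=
      hvi.sub (hm.integrable_density κ)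
    have i2 : Integrable (fun x => variationDensity κ m φ G H ε x - energyDensity κ m G x -
        ε * firstVariationDensity κ m φ G H x) surf := i1.sub (h1i.const_mul ε)
    rw [integral_sub i2 (h2i.const_mul (ε ^ 2)), integral_sub i1 (h1i.const_mul ε),
      integral_sub hvi (hm.integrable_density κ), integral_const_mul, integral_const_mul, hcrit]
    ring
  rw [hsub, abs_mul, abs_of_pos (by norm_num : (0 : ℝ) < 1 / 2), mul_assoc]
  gcongr
  rw [← Real.norm_eq_abs, mul_right_comm]
  refine norm_integral_le_of_norm_le_const (Eventually.of_forall fun x => ?_)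
  rw [Real.norm_eq_abs]
  set ρ := ‖m x + ε • φ x‖ ^ 2 with hρd
  have hρ : ρ = 1 + ε ^ 2 * ‖φ x‖ ^ 2 := by
    rw [hρd, norm_sq_add_smul, hm1, hmφ]; ring
  have hn : ‖φ x‖ ^ 2 ≤ B ^ 2 := pow_le_pow_left₀ (norm_nonneg _) (hB x) 2
  have hi : ∀ i, |‖G i x + ε • H i x‖ ^ 2 / ρ -
      inner ℝ (m x + ε • φ x) (G i x + ε • H i x) ^ 2 / ρ ^ 2 - ‖G i x‖ ^ 2 -
      ε * (2 * inner ℝ (G i x) (H i x)) - ε ^ 2 * (‖H i x‖ ^ 2 - ‖G i x‖ ^ 2 * ‖φ x‖ ^ 2)| ≤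
      K₀ * (C ^ 2 + C ^ 2) * |ε| ^ 3 := by
    intro i
    have h1 : inner ℝ (m x + ε • φ x) (G i x + ε • H i x) = ε ^ 2 * inner ℝ (φ x) (H i x) := by
      simp only [inner_add_left, inner_add_right, real_inner_smul_left, real_inner_smul_right,
        hmG i]
      linear_combination ε * hmH i x
    have f1 : ‖H i x‖ ^ 2 ≤ C ^ 2 := pow_le_pow_left₀ (norm_nonneg _) (hHC i x) 2
    have f2 : ‖G i x‖ ^ 2 ≤ C ^ 2 := pow_le_pow_left₀ (norm_nonneg _) (hGC i x) 2
    rw [h1, norm_sq_add_smul]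
    refine abs_quotient_expansion_two_le hρ hε1 (sq_nonneg _) hn (sq_nonneg _) ?_
      (sq_nonneg _) ?_ ((two_mul_abs_inner_le _ _).trans ?_) ?_
    · linarith [sq_nonneg C]
    · linarith [sq_nonneg C]
    · linarith
    · have a3 := abs_real_inner_le_norm (φ x) (H i x)
      rw [← sq_abs]
      refine (pow_le_pow_left₀ (abs_nonneg _) a3 2).trans ?_
      rw [mul_pow]
      exact mul_le_mul hn (by linarith [sq_nonneg C]) (sq_nonneg _) (sq_nonneg _)
  have hs : |inner ℝ (m x) (x : E3)| ≤ 1 := by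
    have := abs_real_inner_le_norm (m x) (x : E3)
    rwa [hm1, x.norm_coe, one_mul] at this
  have hσ : |inner ℝ (φ x) (x : E3)| ≤ B := by
    have := abs_real_inner_le_norm (φ x) (x : E3)
    rw [x.norm_coe, mul_one] at this
    exact this.trans (hB x)
  have hpot : |(inner ℝ (m x) (x : E3) ^ 2 + 2 * ε * (inner ℝ (m x) (x : E3) *
      inner ℝ (φ x) (x : E3)) + ε ^ 2 * inner ℝ (φ x) (x : E3) ^ 2) / ρ -
      (ε ^ 2 * 0) ^ 2 / ρ ^ 2 - inner ℝ (m x) (x : E3) ^ 2 -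
      ε * (2 * (inner ℝ (m x) (x : E3) * inner ℝ (φ x) (x : E3))) -
      ε ^ 2 * (inner ℝ (φ x) (x : E3) ^ 2 - inner ℝ (m x) (x : E3) ^ 2 * ‖φ x‖ ^ 2)| ≤
      K₀ * (1 + B ^ 2) * |ε| ^ 3 := by
    have hs2 : inner ℝ (m x) (x : E3) ^ 2 ≤ 1 := by
      rw [← sq_abs]; exact pow_le_one₀ (abs_nonneg _) hs
    have hσ2 : inner ℝ (φ x) (x : E3) ^ 2 ≤ B ^ 2 := by
      rw [← sq_abs]; exact pow_le_pow_left₀ (abs_nonneg _) hσ 2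
    refine abs_quotient_expansion_two_le hρ hε1 (sq_nonneg _) hn (sq_nonneg _) ?_
      (sq_nonneg _) ?_ ?_ ?_
    · nlinarith
    · nlinarith
    · rw [abs_mul]
      nlinarith [sq_abs (inner ℝ (m x) (x : E3)), sq_abs (inner ℝ (φ x) (x : E3)),
        sq_nonneg (|inner ℝ (m x) (x : E3)| - |inner ℝ (φ x) (x : E3)|)]
    · rw [zero_pow two_ne_zero]
      positivity
  have hsum := (Finset.abs_sum_le_sum_abs _ _).trans
    (Finset.sum_le_sum fun i (_ : i ∈ Finset.univ) => hi i)
  rw [Finset.sum_const, Finset.card_univ, Fintype.card_fin, nsmul_eq_mul] at hsum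
  have hκ := mul_le_mul_of_nonneg_left hpot (abs_nonneg κ)
  rw [← abs_mul] at hκ
  have hdec : ∀ {a b c d e : ℝ}, |a| ≤ b → |c| ≤ d → e = a - c → |e| ≤ b + d := by
    rintro a b c d e h1 h2 rfl
    exact (abs_sub _ _).trans (add_le_add h1 h2)
  refine (hdec hsum hκ ?_).trans (le_of_eq ?_)
  · simp only [Fin.sum_univ_three, firstVariationDensity, energyDensity,
      secondVariationDensity, variationDensity, hmφ, ← hρd]
    ring
  · rw [hK₁]
    push_cast
    ring

end

/-! ### Zonal maps: `H¹`-regularity and the weak form of the Laplacian -/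

/-- The vector `(x₀ s, x₁ s, t)`. A map of the form `x ↦ (x₀ a(x₂), x₁ a(x₂), b(x₂))` on the sphere
commutes with the rotations about the third axis; such maps are called zonal below. -/
noncomputable def zonalPt (x : E3) (s t : ℝ) : E3 := !₂[x 0 * s, x 1 * s, t]

/-- The derivative of `x ↦ (x₀ a(x₂), x₁ a(x₂), b(x₂))` in the direction `τ`, where `s`, `s'`, `t'`
are the values of `a`, `a'`, `b'` at `x₂`. -/
noncomputable def zonalDir (x τ : E3) (s s' t' : ℝ) : E3 :=
  !₂[τ 0 * s + x 0 * (s' * τ 2), τ 1 * s + x 1 * (s' * τ 2), t' * τ 2]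

lemma norm_vec3_le (u v w : ℝ) : ‖(!₂[u, v, w] : E3)‖ ≤ |u| + |v| + |w| := by
  rw [EuclideanSpace.norm_eq, Fin.sum_univ_three]
  refine Real.sqrt_le_iff.2 ⟨by positivity, ?_⟩
  simp only [Real.norm_eq_abs]
  change |u| ^ 2 + |v| ^ 2 + |w| ^ 2 ≤ _
  nlinarith [mul_nonneg (abs_nonneg u) (abs_nonneg v), mul_nonneg (abs_nonneg u) (abs_nonneg w),
    mul_nonneg (abs_nonneg v) (abs_nonneg w)]

lemma inner_vec3 (a b : E3) : inner ℝ a b = a 0 * b 0 + a 1 * b 1 + a 2 * b 2 := by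
  simp only [PiLp.inner_apply, Fin.sum_univ_three]
  simp [mul_comm]

lemma abs_tangField_le (i k : Fin 3) (x : S2) : |tangField i x k| ≤ 2 := by
  have h1 := mul_le_mul (x.abs_apply_le i) (x.abs_apply_le k) (abs_nonneg _) zero_le_one
  rw [← abs_mul] at h1
  simp only [tangField, PiLp.sub_apply, PiLp.smul_apply, smul_eq_mul, PiLp.single_apply]
  refine (abs_sub _ _).trans ?_
  split_ifs
  · rw [abs_one]; linarith
  · rw [abs_zero]; linarith

lemma norm_zonalPt_le (x : S2) (s t : ℝ) : ‖zonalPt x s t‖ ≤ 2 * |s| + |t| := by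
  refine (norm_vec3_le _ _ _).trans ?_
  rw [abs_mul, abs_mul]
  nlinarith [abs_nonneg s, x.abs_apply_le 0, x.abs_apply_le 1]

lemma norm_zonalDir_le (x : S2) (i : Fin 3) (s s' t' : ℝ) :
    ‖zonalDir x (tangField i x) s s' t'‖ ≤ 4 * |s| + 4 * |s'| + 2 * |t'| := by
  refine (norm_vec3_le _ _ _).trans ?_
  have h : ∀ k : Fin 3, |tangField i x k * s + (x : E3) k * (s' * tangField i x 2)| ≤
      2 * |s| + 2 * |s'| := fun k => by
    refine (abs_add_le _ _).trans (add_le_add ?_ ?_)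
    · rw [abs_mul]
      exact mul_le_mul_of_nonneg_right (abs_tangField_le _ _ _) (abs_nonneg _)
    · rw [abs_mul, abs_mul]
      nlinarith [mul_le_mul_of_nonneg_left (abs_tangField_le i 2 x) (abs_nonneg s'),
        x.abs_apply_le k, mul_nonneg (abs_nonneg s') (abs_nonneg (tangField i x 2))]
  have h2 : |t' * tangField i x 2| ≤ 2 * |t'| := by
    rw [abs_mul, mul_comm]
    exact mul_le_mul_of_nonneg_right (abs_tangField_le _ _ _) (abs_nonneg _)
  linarith [h 0, h 1]

/-- The poles form a null set. -/
lemma ae_apply_two_mem_Ioo : ∀ᵐ x : S2 ∂surf, (x : E3) 2 ∈ Ioo (-1 : ℝ) 1 := by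
  have hnull : ∀ p : S2, surf {p} = 0 := by
    intro p
    rw [surf, Measure.toSphere_apply' _ (measurableSet_singleton p)]
    refine mul_eq_zero_of_right _ (measure_mono_null (t := (Submodule.span ℝ {(p : E3)} : Set E3))
      ?_ (Measure.addHaar_submodule _ _ ?_))
    · rintro _ ⟨r, -, _, ⟨y, rfl, rfl⟩, rfl⟩
      exact Submodule.smul_mem _ _ (Submodule.mem_span_singleton_self _)
    · intro h
      have h1 := finrank_span_singleton (K := ℝ) (v := (p : E3)) (by
        intro h0; have := p.norm_coe; rw [h0, norm_zero] at this; exact zero_ne_one this)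
      rw [h, finrank_top, finrank_euclideanSpace, Fintype.card_fin] at h1
      norm_num at h1
  have hpole : ∀ c : ℝ, c ^ 2 = 1 → ∀ᵐ x : S2 ∂surf, (x : E3) 2 ≠ c := by
    intro c hc
    have hp : ‖EuclideanSpace.single (2 : Fin 3) c‖ = 1 := by
      rw [PiLp.norm_single, Real.norm_eq_abs, ← Real.sqrt_sq_eq_abs, hc, Real.sqrt_one]
    have := compl_mem_ae_iff.2 (hnull ⟨EuclideanSpace.single (2 : Fin 3) c, by simpa using hp⟩)
    filter_upwards [this] with x hx h2
    apply hx
    have h := x.sq_sum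
    rw [h2, hc] at h
    have h0 : (x : E3) 0 = 0 := by nlinarith [sq_nonneg ((x : E3) 0), sq_nonneg ((x : E3) 1)]
    have h1 : (x : E3) 1 = 0 := by nlinarith [sq_nonneg ((x : E3) 0), sq_nonneg ((x : E3) 1)]
    rw [mem_singleton_iff]
    ext k
    fin_cases k <;> simp [h0, h1, h2]
  filter_upwards [hpole 1 (by norm_num), hpole (-1) (by norm_num)] with x h1 h2
  have h := abs_le.1 (x.abs_apply_le 2)
  exact ⟨lt_of_le_of_ne h.1 (Ne.symm h2), lt_of_le_of_ne h.2 h1⟩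

/-- Smooth functions are `C¹`-dense on `[-1, 1]`. -/
lemma exists_contDiff_near {f f' : ℝ → ℝ} (hf : ∀ z ∈ Icc (-1 : ℝ) 1, HasDerivAt f (f' z) z)
    (hf' : ContinuousOn f' (Icc (-1) 1)) {ε : ℝ} (hε : 0 < ε) :
    ∃ P : ℝ → ℝ, ContDiff ℝ ∞ P ∧ ∀ z ∈ Icc (-1 : ℝ) 1,
      |P z - f z| ≤ ε ∧ |deriv P z - f' z| ≤ ε := by
  obtain ⟨p, hp⟩ := exists_polynomial_near_of_continuousOn (-1) 1 f' hf' ε hε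
  have hpc : Continuous fun t => p.eval t := p.continuous
  have hd : ∀ z, HasDerivAt (fun z => f 0 + ∫ t in (0 : ℝ)..z, p.eval t) (p.eval z) z := fun z =>
    (intervalIntegral.integral_hasDerivAt_right (hpc.intervalIntegrable _ _)
      (hpc.stronglyMeasurableAtFilter _ _) hpc.continuousAt).const_add _
  have hdd : deriv (fun z => f 0 + ∫ t in (0 : ℝ)..z, p.eval t) = fun z => p.eval z :=
    funext fun z => (hd z).deriv
  refine ⟨fun z => f 0 + ∫ t in (0 : ℝ)..z, p.eval t, ?_, fun z hz => ⟨?_, ?_⟩⟩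
  · exact contDiff_infty_iff_deriv.2 ⟨fun z => (hd z).differentiableAt, by
      rw [hdd]; simpa using p.contDiff_aeval (𝕜 := ℝ) ∞⟩
  · have := (convex_Icc (-1 : ℝ) 1).norm_image_sub_le_of_norm_hasDerivWithin_le
      (f := fun z => (f 0 + ∫ t in (0 : ℝ)..z, p.eval t) - f z) (C := ε)
      (fun z hz => ((hd z).sub (hf z hz)).hasDerivWithinAt)
      (fun z hz => (hp z hz).le) (show (0 : ℝ) ∈ Icc (-1 : ℝ) 1 by simp) hz
    simp only [intervalIntegral.integral_same, add_zero, sub_self, sub_zero,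
      Real.norm_eq_abs] at this
    refine this.trans ?_
    have := abs_le.2 hz
    nlinarith
  · rw [hdd]
    exact (hp z hz).le

lemma contDiff_zonalPt {P Q : ℝ → ℝ} (hP : ContDiff ℝ ∞ P) (hQ : ContDiff ℝ ∞ Q) :
    ContDiff ℝ ∞ fun y : E3 => zonalPt y (P (y 2)) (Q (y 2)) := by
  rw [contDiff_euclidean]
  intro k
  fin_cases k <;> simp [zonalPt] <;> fun_prop

lemma tangDeriv_zonalPt {P Q : ℝ → ℝ} (hP : ContDiff ℝ ∞ P) (hQ : ContDiff ℝ ∞ Q) (i : Fin 3)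
    (x : S2) : tangDeriv (fun y => zonalPt y (P (y 2)) (Q (y 2))) i x =
      zonalDir x (tangField i x) (P ((x : E3) 2)) (deriv P ((x : E3) 2))
        (deriv Q ((x : E3) 2)) := by
  have hx : ∀ k, HasFDerivAt (fun y : E3 => y k) (EuclideanSpace.proj k : E3 →L[ℝ] ℝ) (x : E3) :=
    fun k => (EuclideanSpace.proj k : E3 →L[ℝ] ℝ).hasFDerivAt
  have hPx := (hP.differentiable (by simp) ((x : E3) 2)).hasDerivAt.comp_hasFDerivAt (x : E3) (hx 2)
  have hQx := (hQ.differentiable (by simp) ((x : E3) 2)).hasDerivAt.comp_hasFDerivAt (x : E3) (hx 2)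
  have hd := (contDiff_zonalPt hP hQ).differentiable (by simp) (x : E3)
  rw [tangDeriv_eq]
  ext k
  have hk : fderiv ℝ (fun y : E3 => zonalPt y (P (y 2)) (Q (y 2))) x (tangField i x) k =
      fderiv ℝ (fun y : E3 => zonalPt y (P (y 2)) (Q (y 2)) k) x (tangField i x) := by
    have := ((EuclideanSpace.proj k : E3 →L[ℝ] ℝ).hasFDerivAt.comp (x : E3) hd.hasFDerivAt)
    have h2 : HasFDerivAt (fun y : E3 => zonalPt y (P (y 2)) (Q (y 2)) k) _ (x : E3) := this
    rw [h2.fderiv]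
    rfl
  rw [hk]
  fin_cases k
  · have : HasFDerivAt (fun y : E3 => zonalPt y (P (y 2)) (Q (y 2)) 0) _ (x : E3) :=
      (hx 0).mul hPx
    simp only [Fin.zero_eta]
    rw [this.fderiv]
    simp [zonalDir]; ring
  · have : HasFDerivAt (fun y : E3 => zonalPt y (P (y 2)) (Q (y 2)) 1) _ (x : E3) :=
      (hx 1).mul hPx
    simp only [Fin.mk_one]
    rw [this.fderiv]
    simp [zonalDir]; ring
  · have : HasFDerivAt (fun y : E3 => zonalPt y (P (y 2)) (Q (y 2)) 2) _ (x : E3) := hQx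
    change fderiv ℝ (fun y : E3 => zonalPt y (P (y 2)) (Q (y 2)) 2) x (tangField i x) = _
    rw [this.fderiv]
    simp [zonalDir]

/-- Bounded `C¹`-data on `(-1, 1)` for a zonal map `x ↦ (x₀ a(x₂), x₁ a(x₂), b(x₂))`. -/
structure ZonalData (a b a' b' : ℝ → ℝ) (M : ℝ) : Prop where
  hasDerivAt_a : ∀ z ∈ Ioo (-1 : ℝ) 1, HasDerivAt a (a' z) z
  hasDerivAt_b : ∀ z ∈ Ioo (-1 : ℝ) 1, HasDerivAt b (b' z) z
  continuousOn_a' : ContinuousOn a' (Ioo (-1) 1)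
  continuousOn_b' : ContinuousOn b' (Ioo (-1) 1)
  abs_a_le : ∀ z ∈ Icc (-1 : ℝ) 1, |a z| ≤ M
  abs_b_le : ∀ z ∈ Icc (-1 : ℝ) 1, |b z| ≤ M
  abs_a'_le : ∀ z ∈ Icc (-1 : ℝ) 1, |a' z| ≤ M
  abs_b'_le : ∀ z ∈ Icc (-1 : ℝ) 1, |b' z| ≤ M

/-- The zonal map with the data `a`, `b`. -/
noncomputable def zonalMap (a b : ℝ → ℝ) (x : S2) : E3 :=
  zonalPt x (a ((x : E3) 2)) (b ((x : E3) 2))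

/-- The surface gradient of the zonal map with the data `a`, `b`. -/
noncomputable def zonalGrad (a a' b' : ℝ → ℝ) (i : Fin 3) (x : S2) : E3 :=
  zonalDir x (tangField i x) (a ((x : E3) 2)) (a' ((x : E3) 2)) (b' ((x : E3) 2))

/-- The dilation factors `r_n = 1 - 1 / (n + 2)`. -/
noncomputable def dil (n : ℕ) : ℝ := 1 - 1 / ((n : ℝ) + 2)

lemma dil_pos (n : ℕ) : 0 < dil n := by
  have : 1 / ((n : ℝ) + 2) < 1 := by
    rw [div_lt_one (by positivity)]; linarith [(Nat.cast_nonneg n : (0 : ℝ) ≤ n)]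
  unfold dil; linarith

lemma dil_lt_one (n : ℕ) : dil n < 1 := by
  have : 0 < 1 / ((n : ℝ) + 2) := by positivity
  unfold dil; linarith

lemma tendsto_one_div_add_two : Tendsto (fun n : ℕ => 1 / ((n : ℝ) + 2)) atTop (𝓝 0) := by
  simp_rw [one_div]
  exact tendsto_inv_atTop_zero.comp
    (tendsto_atTop_add_const_right _ _ tendsto_natCast_atTop_atTop)

lemma tendsto_dil : Tendsto dil atTop (𝓝 1) := by
  have := tendsto_one_div_add_two.const_sub 1
  rwa [sub_zero] at this

lemma dil_mul_mem {n : ℕ} {z : ℝ} (hz : z ∈ Icc (-1 : ℝ) 1) : dil n * z ∈ Ioo (-1 : ℝ) 1 := by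
  have h1 := dil_pos n
  have h2 := dil_lt_one n
  constructor <;> nlinarith [hz.1, hz.2]

lemma S2.apply_mem_Icc (x : S2) (i : Fin 3) : (x : E3) i ∈ Icc (-1 : ℝ) 1 :=
  abs_le.1 (x.abs_apply_le i)

lemma tendsto_comp_dil {f : ℝ → ℝ} {z : ℝ} (hf : ContinuousAt f z) :
    Tendsto (fun n => f (dil n * z)) atTop (𝓝 (f z)) := by
  refine hf.tendsto.comp ?_
  simpa using tendsto_dil.mul_const z

/-- A zonal map with bounded data is in `H¹`: the data are dilated by a factor less than one, which
makes them `C¹` up to the poles, and then approximated by smooth functions. -/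
lemma ZonalData.hasH1Gradient {a b a' b' : ℝ → ℝ} {M : ℝ} (h : ZonalData a b a' b' M) :
    HasH1Gradient (zonalMap a b) (zonalGrad a a' b') := by
  have happ : ∀ {f f' : ℝ → ℝ}, (∀ z ∈ Ioo (-1 : ℝ) 1, HasDerivAt f (f' z) z) →
      ContinuousOn f' (Ioo (-1) 1) → ∀ n : ℕ, ∃ P : ℝ → ℝ, ContDiff ℝ ∞ P ∧
      ∀ z ∈ Icc (-1 : ℝ) 1, |P z - f (dil n * z)| ≤ 1 / ((n : ℝ) + 2) ∧
        |deriv P z - dil n * f' (dil n * z)| ≤ 1 / ((n : ℝ) + 2) := by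
    intro f f' hf hf' n
    refine exists_contDiff_near (fun z hz => ?_) ?_ (by positivity)
    · have := (hf _ (dil_mul_mem (n := n) hz)).comp z ((hasDerivAt_id z).const_mul (dil n))
      simpa [mul_comm, Function.comp_def] using this
    · exact continuousOn_const.mul (hf'.comp (by fun_prop) fun z hz => dil_mul_mem hz)
  choose P hPs hP using happ h.hasDerivAt_a h.continuousOn_a'
  choose Q hQs hQ using happ h.hasDerivAt_b h.continuousOn_b'
  have hconv : ∀ {u : ℕ → ℝ} {v : ℕ → ℝ} {l : ℝ}, (∀ n, |u n - v n| ≤ 1 / ((n : ℝ) + 2)) →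
      Tendsto v atTop (𝓝 l) → Tendsto u atTop (𝓝 l) := by
    intro u v l huv hv
    have h0 : Tendsto (fun n => u n - v n) atTop (𝓝 0) :=
      squeeze_zero_norm huv tendsto_one_div_add_two
    simpa using h0.add hv
  have hbound : ∀ {f : ℝ → ℝ} {u v : ℝ} {n : ℕ}, (∀ z ∈ Icc (-1 : ℝ) 1, |f z| ≤ M) → v ∈ Icc (-1 : ℝ) 1 →
      |u - f v| ≤ 1 / ((n : ℝ) + 2) → |u| ≤ M + 1 := by
    intro f u v n hf hv hu
    have h1 : 1 / ((n : ℝ) + 2) ≤ 1 := by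
      rw [div_le_one (by positivity)]; linarith [(Nat.cast_nonneg n : (0 : ℝ) ≤ n)]
    have h2 := abs_sub_abs_le_abs_sub u (f v)
    linarith [hf v hv]
  have hbound' : ∀ {f : ℝ → ℝ} {u v : ℝ} {n : ℕ}, (∀ z ∈ Icc (-1 : ℝ) 1, |f z| ≤ M) → v ∈ Icc (-1 : ℝ) 1 →
      |u - dil n * f v| ≤ 1 / ((n : ℝ) + 2) → |u| ≤ M + 1 := by
    intro f u v n hf hv hu
    refine hbound (f := fun z => dil n * f z) (v := v) (fun z hz => ?_) hv hu
    rw [abs_mul, abs_of_pos (dil_pos n)]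
    nlinarith [hf z hz, dil_lt_one n, dil_pos n, abs_nonneg (f z)]
  have hpt : ∀ x : S2, (x : E3) 2 ∈ Ioo (-1 : ℝ) 1 →
      Tendsto (fun n => zonalPt x (P n ((x : E3) 2)) (Q n ((x : E3) 2))) atTop
        (𝓝 (zonalMap a b x)) ∧
      ∀ i, Tendsto (fun n => zonalDir x (tangField i x) (P n ((x : E3) 2))
        (deriv (P n) ((x : E3) 2)) (deriv (Q n) ((x : E3) 2))) atTop (𝓝 (zonalGrad a a' b' i x)) := by
    intro x hx
    have hxI := x.apply_mem_Icc 2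
    have t1 := hconv (fun n => (hP n _ hxI).1) (tendsto_comp_dil (h.hasDerivAt_a _ hx).continuousAt)
    have t2 := hconv (fun n => (hQ n _ hxI).1) (tendsto_comp_dil (h.hasDerivAt_b _ hx).continuousAt)
    have t3 := hconv (fun n => (hP n _ hxI).2) (tendsto_dil.mul
      (tendsto_comp_dil (h.continuousOn_a'.continuousAt (isOpen_Ioo.mem_nhds hx))))
    have t4 := hconv (fun n => (hQ n _ hxI).2) (tendsto_dil.mul
      (tendsto_comp_dil (h.continuousOn_b'.continuousAt (isOpen_Ioo.mem_nhds hx))))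
    rw [one_mul] at t3 t4
    constructor
    · have hc : Continuous fun p : ℝ × ℝ => zonalPt x p.1 p.2 := by
        unfold zonalPt; fun_prop
      exact (hc.tendsto (a ((x : E3) 2), b ((x : E3) 2))).comp (t1.prodMk_nhds t2)
    · intro i
      have hc : Continuous fun p : ℝ × ℝ × ℝ => zonalDir x (tangField i x) p.1 p.2.1 p.2.2 := by
        unfold zonalDir; fun_prop
      exact (hc.tendsto (a ((x : E3) 2), a' ((x : E3) 2), b' ((x : E3) 2))).comp
        (t1.prodMk_nhds (t3.prodMk_nhds t4))
  have hUc : ∀ n, Continuous fun x : S2 => zonalPt x (P n ((x : E3) 2)) (Q n ((x : E3) 2)) :=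
    fun n => (contDiff_zonalPt (hPs n) (hQs n)).continuous.comp continuous_subtype_val
  have hdc : ∀ n i, Continuous fun x : S2 => zonalDir x (tangField i x) (P n ((x : E3) 2))
      (deriv (P n) ((x : E3) 2)) (deriv (Q n) ((x : E3) 2)) := fun n i => by
    simp_rw [← tangDeriv_zonalPt (hPs n) (hQs n) i]
    exact continuous_tangDeriv ((contDiff_zonalPt (hPs n) (hQs n)).of_le (by simp)) i
  have hm : AEStronglyMeasurable (zonalMap a b) surf :=
    aestronglyMeasurable_of_tendsto_ae atTop (fun n => (hUc n).aestronglyMeasurable)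
      (ae_apply_two_mem_Ioo.mono fun x hx => (hpt x hx).1)
  have hg : ∀ i, AEStronglyMeasurable (zonalGrad a a' b' i) surf := fun i =>
    aestronglyMeasurable_of_tendsto_ae atTop (fun n => (hdc n i).aestronglyMeasurable)
      (ae_apply_two_mem_Ioo.mono fun x hx => (hpt x hx).2 i)
  have hmb : ∀ x, ‖zonalMap a b x‖ ≤ 3 * M := fun x => by
    have := norm_zonalPt_le x (a ((x : E3) 2)) (b ((x : E3) 2))
    simp only [zonalMap]
    linarith [h.abs_a_le _ (x.apply_mem_Icc 2), h.abs_b_le _ (x.apply_mem_Icc 2)]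
  have hgb : ∀ i x, ‖zonalGrad a a' b' i x‖ ≤ 10 * M := fun i x => by
    have := norm_zonalDir_le x i (a ((x : E3) 2)) (a' ((x : E3) 2)) (b' ((x : E3) 2))
    simp only [zonalGrad]
    linarith [h.abs_a_le _ (x.apply_mem_Icc 2), h.abs_a'_le _ (x.apply_mem_Icc 2), h.abs_b'_le _ (x.apply_mem_Icc 2)]
  refine ⟨MemLp.of_bound hm _ (Eventually.of_forall hmb),
    fun i => MemLp.of_bound (hg i) _ (Eventually.of_forall (hgb i)),
    fun n y => zonalPt y (P n (y 2)) (Q n (y 2)), fun n => contDiff_zonalPt (hPs n) (hQs n),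
    ?_, fun i => ?_⟩
  · refine tendsto_eLpNorm_two_of_dominated (g := fun _ => 3 * (M + 1) + 3 * M)
      (Eventually.of_forall fun n => (hUc n).aestronglyMeasurable.sub hm) (memLp_const _)
      (Eventually.of_forall fun n => Eventually.of_forall fun x => ?_) ?_
    · refine (norm_sub_le _ _).trans (add_le_add ((norm_zonalPt_le x _ _).trans ?_) (hmb x))
      have hxI := x.apply_mem_Icc 2
      have hxn := Ioo_subset_Icc_self (dil_mul_mem (n := n) hxI)
      linarith [hbound h.abs_a_le hxn (hP n _ hxI).1, hbound h.abs_b_le hxn (hQ n _ hxI).1]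
    · filter_upwards [ae_apply_two_mem_Ioo] with x hx
      simpa using (hpt x hx).1.sub_const (zonalMap a b x)
  · simp_rw [tangDeriv_zonalPt (hPs _) (hQs _)]
    refine tendsto_eLpNorm_two_of_dominated (g := fun _ => 10 * (M + 1) + 10 * M)
      (Eventually.of_forall fun n => (hdc n i).aestronglyMeasurable.sub (hg i)) (memLp_const _)
      (Eventually.of_forall fun n => Eventually.of_forall fun x => ?_) ?_
    · refine (norm_sub_le _ _).trans (add_le_add ((norm_zonalDir_le x i _ _ _).trans ?_) (hgb i x))
      have hxI := x.apply_mem_Icc 2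
      have hxn := Ioo_subset_Icc_self (dil_mul_mem (n := n) hxI)
      linarith [hbound h.abs_a_le hxn (hP n _ hxI).1, hbound' h.abs_b'_le hxn (hQ n _ hxI).2,
        hbound' h.abs_a'_le hxn (hP n _ hxI).2]
    · filter_upwards [ae_apply_two_mem_Ioo] with x hx
      simpa using ((hpt x hx).2 i).sub_const (zonalGrad a a' b' i x)

lemma ZonalData.norm_zonalGrad_le {a b a' b' : ℝ → ℝ} {M : ℝ} (h : ZonalData a b a' b' M)
    (i : Fin 3) (x : S2) : ‖zonalGrad a a' b' i x‖ ≤ 10 * M := by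
  have := norm_zonalDir_le x i (a ((x : E3) 2)) (a' ((x : E3) 2)) (b' ((x : E3) 2))
  simp only [zonalGrad]
  linarith [h.abs_a_le _ (x.apply_mem_Icc 2), h.abs_a'_le _ (x.apply_mem_Icc 2), h.abs_b'_le _ (x.apply_mem_Icc 2)]

/-- The Laplacian at `x` on the sphere of the zonal map with data `a`, `b`, where `s`, `s'`, `s''`,
`t'`, `t''` are the values of `a`, `a'`, `a''`, `b'`, `b''` at `x₂`. -/
noncomputable def zonalLap (x : E3) (s s' s'' t' t'' : ℝ) : E3 :=
  !₂[x 0 * ((1 - x 2 ^ 2) * s'' - 4 * x 2 * s' - 2 * s),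
    x 1 * ((1 - x 2 ^ 2) * s'' - 4 * x 2 * s' - 2 * s), (1 - x 2 ^ 2) * t'' - 2 * x 2 * t']

/-- On the sphere the inner product of two tangential gradients can be computed with the three
Killing fields instead of the three tangential projections. Here `p` and `q` are the gradients
in `ℝ³`. -/
lemma sum_tangField_eq_sum_rotField (x : S2) (p₀ p₁ p₂ q₀ q₁ q₂ : ℝ) :
    ∑ i, (p₀ * tangField i x 0 + p₁ * tangField i x 1 + p₂ * tangField i x 2) *
      (q₀ * tangField i x 0 + q₁ * tangField i x 1 + q₂ * tangField i x 2) =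
    ((x : E3) 0 * p₁ - (x : E3) 1 * p₀) * ((x : E3) 0 * q₁ - (x : E3) 1 * q₀) +
    ((x : E3) 0 * p₂ - (x : E3) 2 * p₀) * ((x : E3) 0 * q₂ - (x : E3) 2 * q₀) +
    ((x : E3) 1 * p₂ - (x : E3) 2 * p₁) * ((x : E3) 1 * q₂ - (x : E3) 2 * q₁) := by
  have h := x.sq_sum
  simp only [Fin.sum_univ_three, tangField, PiLp.sub_apply, PiLp.smul_apply, smul_eq_mul,
    PiLp.single_apply]
  simp
  linear_combination (((x : E3) 0 * p₀ + (x : E3) 1 * p₁ + (x : E3) 2 * p₂) *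
    ((x : E3) 0 * q₀ + (x : E3) 1 * q₁ + (x : E3) 2 * q₂) - (p₀ * q₀ + p₁ * q₁ + p₂ * q₂)) * h

lemma clm_apply_eq_sum {F : Type*} [NormedAddCommGroup F] [NormedSpace ℝ F] (A : E3 →L[ℝ] F)
    (v : E3) : A v = v 0 • A (EuclideanSpace.single 0 1) + v 1 • A (EuclideanSpace.single 1 1) +
      v 2 • A (EuclideanSpace.single 2 1) := by
  have : v = v 0 • EuclideanSpace.single (0 : Fin 3) (1 : ℝ) +
      v 1 • EuclideanSpace.single (1 : Fin 3) (1 : ℝ) +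
      v 2 • EuclideanSpace.single (2 : Fin 3) (1 : ℝ) := by
    ext k
    fin_cases k <;> simp
  conv_lhs => rw [this]
  simp only [map_add, map_smul]

lemma contDiffAt_one_of_hasDerivAt {f f' : ℝ → ℝ} {s : Set ℝ} (hs : IsOpen s)
    (hf : ∀ z ∈ s, HasDerivAt f (f' z) z) (hf' : ContinuousOn f' s) {z : ℝ} (hz : z ∈ s) :
    ContDiffAt ℝ 1 f z := by
  have h : ContDiffOn ℝ 1 f s := by
    rw [show (1 : WithTop ℕ∞) = 0 + 1 from rfl, contDiffOn_succ_iff_deriv_of_isOpen hs]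
    refine ⟨fun z hz => (hf z hz).differentiableAt.differentiableWithinAt, by simp, ?_⟩
    exact contDiffOn_zero.2 (hf'.congr fun z hz => (hf z hz).deriv)
  exact h.contDiffAt (hs.mem_nhds hz)

lemma S2.apply_mem_of_one_lt {R : ℝ} (hR : 1 < R) (x : S2) (i : Fin 3) :
    (x : E3) i ∈ Ioo (-R) R := by
  have := x.apply_mem_Icc i
  exact ⟨by linarith [this.1], by linarith [this.2]⟩

/-- The weak form of the Laplacian of a zonal map whose data are `C²` beyond the poles. -/
lemma integral_zonal_dirichlet_of_one_lt {a a' a'' b' b'' : ℝ → ℝ} {R : ℝ} (hR : 1 < R)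
    (ha : ∀ z ∈ Ioo (-R) R, HasDerivAt a (a' z) z)
    (ha' : ∀ z ∈ Ioo (-R) R, HasDerivAt a' (a'' z) z) (ha'' : ContinuousOn a'' (Ioo (-R) R))
    (hb' : ∀ z ∈ Ioo (-R) R, HasDerivAt b' (b'' z) z) (hb'' : ContinuousOn b'' (Ioo (-R) R))
    {U : E3 → E3} (hU : ContDiff ℝ ∞ U) :
    ∫ x : S2, ((∑ i, inner ℝ (zonalDir x (tangField i x) (a ((x : E3) 2)) (a' ((x : E3) 2))
      (b' ((x : E3) 2))) (tangDeriv U i x)) + inner ℝ (zonalLap x (a ((x : E3) 2))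
        (a' ((x : E3) 2)) (a'' ((x : E3) 2)) (b' ((x : E3) 2)) (b'' ((x : E3) 2))) (U x))
      ∂surf = 0 := by
  have hU1 : ContDiff ℝ 1 U := hU.of_le (by simp)
  have hUk : ∀ k, ContDiff ℝ 1 fun y => U y k := fun k => contDiff_euclidean.1 hU1 k
  have hcomp : ∀ {f f' : ℝ → ℝ}, (∀ z ∈ Ioo (-R) R, HasDerivAt f (f' z) z) →
      ContinuousOn f' (Ioo (-R) R) → ∀ x : S2, ContDiffAt ℝ 1 (fun y : E3 => f (y 2)) x := by
    intro f f' hf hf' x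
    exact ContDiffAt.comp (x : E3) (g := f) (f := fun y : E3 => y 2)
      (contDiffAt_one_of_hasDerivAt isOpen_Ioo hf hf' (x.apply_mem_of_one_lt hR 2)) (by fun_prop)
  have hca : ContinuousOn a' (Ioo (-R) R) := fun z hz => (ha' z hz).continuousAt.continuousWithinAt
  have hcb : ContinuousOn b' (Ioo (-R) R) := fun z hz => (hb' z hz).continuousAt.continuousWithinAt
  have cda := hcomp ha hca
  have cda' := hcomp ha' ha''
  have cdb' := hcomp hb' hb''
  have cx : ∀ k (x : S2), ContDiffAt ℝ 1 (fun y : E3 => y k) x := fun k x => by fun_prop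
  -- The pairings of `U` with the derivatives of the zonal map along the three Killing fields.
  let g₀ : E3 → ℝ := fun y => -(y 1 * a (y 2)) * U y 0 + y 0 * a (y 2) * U y 1
  let g₁ : E3 → ℝ := fun y => (y 0 * y 0 * a' (y 2) - y 2 * a (y 2)) * U y 0 +
    y 0 * y 1 * a' (y 2) * U y 1 + y 0 * b' (y 2) * U y 2
  let g₂ : E3 → ℝ := fun y => y 0 * y 1 * a' (y 2) * U y 0 +
    (y 1 * y 1 * a' (y 2) - y 2 * a (y 2)) * U y 1 + y 1 * b' (y 2) * U y 2
  have hg₀ : ∀ x : S2, ContDiffAt ℝ 1 g₀ x := fun x =>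
    ((((cx 1 x).mul (cda x)).neg).mul (hUk 0).contDiffAt).add
      (((cx 0 x).mul (cda x)).mul (hUk 1).contDiffAt)
  have hg₁ : ∀ x : S2, ContDiffAt ℝ 1 g₁ x := fun x =>
    ((((((cx 0 x).mul (cx 0 x)).mul (cda' x)).sub ((cx 2 x).mul (cda x))).mul
      (hUk 0).contDiffAt).add ((((cx 0 x).mul (cx 1 x)).mul (cda' x)).mul (hUk 1).contDiffAt)).add
      (((cx 0 x).mul (cdb' x)).mul (hUk 2).contDiffAt)
  have hg₂ : ∀ x : S2, ContDiffAt ℝ 1 g₂ x := fun x =>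
    (((((cx 0 x).mul (cx 1 x)).mul (cda' x)).mul (hUk 0).contDiffAt).add
      (((((cx 1 x).mul (cx 1 x)).mul (cda' x)).sub ((cx 2 x).mul (cda x))).mul
        (hUk 1).contDiffAt)).add (((cx 1 x).mul (cdb' x)).mul (hUk 2).contDiffAt)
  have hint : ∀ {g : E3 → ℝ}, (∀ x : S2, ContDiffAt ℝ 1 g x) → ∀ i j : Fin 3,
      Integrable (fun x : S2 => fderiv ℝ g x (rotField i j x)) surf := fun hg i j =>
    Continuous.integrable_surf ((continuous_fderiv_sphere hg).clm_apply
      ((continuous_rotField i j).comp continuous_subtype_val))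
  have hz := congrArg₂ (· + ·) (congrArg₂ (· + ·)
    (integral_fderiv_rotField hg₀ (i := 0) (j := 1) (by decide))
    (integral_fderiv_rotField hg₁ (i := 0) (j := 2) (by decide)))
    (integral_fderiv_rotField hg₂ (i := 1) (j := 2) (by decide))
  simp only [add_zero] at hz
  have i01 : Integrable (fun x : S2 => fderiv ℝ g₀ x (rotField 0 1 x) +
    fderiv ℝ g₁ x (rotField 0 2 x)) surf := (hint hg₀ 0 1).add (hint hg₁ 0 2)
  rw [← integral_add (hint hg₀ 0 1) (hint hg₁ 0 2), ← integral_add i01 (hint hg₂ 1 2)] at hz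
  rw [← hz]
  congr 1
  ext x
  have hx : ∀ k, HasFDerivAt (fun y : E3 => y k) (EuclideanSpace.proj k : E3 →L[ℝ] ℝ) (x : E3) :=
    fun k => (EuclideanSpace.proj k : E3 →L[ℝ] ℝ).hasFDerivAt
  have hxR := x.apply_mem_of_one_lt hR 2
  have da : HasFDerivAt (fun y : E3 => a (y 2)) _ (x : E3) :=
    (ha _ hxR).comp_hasFDerivAt (x : E3) (hx 2)
  have da' : HasFDerivAt (fun y : E3 => a' (y 2)) _ (x : E3) :=
    (ha' _ hxR).comp_hasFDerivAt (x : E3) (hx 2)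
  have db' : HasFDerivAt (fun y : E3 => b' (y 2)) _ (x : E3) :=
    (hb' _ hxR).comp_hasFDerivAt (x : E3) (hx 2)
  have dU : ∀ k, HasFDerivAt (fun y => U y k)
      ((EuclideanSpace.proj k : E3 →L[ℝ] ℝ).comp (fderiv ℝ U x)) (x : E3) := fun k =>
    (EuclideanSpace.proj k : E3 →L[ℝ] ℝ).hasFDerivAt.comp (x : E3)
      (hU1.differentiable one_ne_zero _).hasFDerivAt
  have d₀ : HasFDerivAt g₀ _ (x : E3) :=
    ((((hx 1).mul da).neg).mul (dU 0)).add (((hx 0).mul da).mul (dU 1))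
  have d₁ : HasFDerivAt g₁ _ (x : E3) :=
    ((((((hx 0).mul (hx 0)).mul da').sub ((hx 2).mul da)).mul
      (dU 0)).add ((((hx 0).mul (hx 1)).mul da').mul (dU 1))).add
      (((hx 0).mul db').mul (dU 2))
  have d₂ : HasFDerivAt g₂ _ (x : E3) :=
    (((((hx 0).mul (hx 1)).mul da').mul (dU 0)).add
      (((((hx 1).mul (hx 1)).mul da').sub ((hx 2).mul da)).mul
        (dU 1))).add (((hx 1).mul db').mul (dU 2))
  rw [d₀.fderiv, d₁.fderiv, d₂.fderiv]
  set D₀ := fderiv ℝ U x (EuclideanSpace.single 0 1) with hD₀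
  set D₁ := fderiv ℝ U x (EuclideanSpace.single 1 1) with hD₁
  set D₂ := fderiv ℝ U x (EuclideanSpace.single 2 1) with hD₂
  have ht : ∀ i, tangDeriv U i x = tangField i x 0 • D₀ + tangField i x 1 • D₁ +
      tangField i x 2 • D₂ := fun i => clm_apply_eq_sum _ _
  simp only [inner_vec3, ht]
  have e₀ := sum_tangField_eq_sum_rotField x (a ((x : E3) 2)) 0 ((x : E3) 0 * a' ((x : E3) 2))
    (D₀ 0) (D₁ 0) (D₂ 0)
  have e₁ := sum_tangField_eq_sum_rotField x 0 (a ((x : E3) 2)) ((x : E3) 1 * a' ((x : E3) 2))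
    (D₀ 1) (D₁ 1) (D₂ 1)
  have e₂ := sum_tangField_eq_sum_rotField x 0 0 (b' ((x : E3) 2)) (D₀ 2) (D₁ 2) (D₂ 2)
  have hdec : ∀ i : Fin 3, zonalDir x (tangField i x) (a ((x : E3) 2)) (a' ((x : E3) 2))
      (b' ((x : E3) 2)) 0 * (tangField i x 0 • D₀ + tangField i x 1 • D₁ + tangField i x 2 • D₂) 0 +
      zonalDir x (tangField i x) (a ((x : E3) 2)) (a' ((x : E3) 2)) (b' ((x : E3) 2)) 1 *
        (tangField i x 0 • D₀ + tangField i x 1 • D₁ + tangField i x 2 • D₂) 1 +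
      zonalDir x (tangField i x) (a ((x : E3) 2)) (a' ((x : E3) 2)) (b' ((x : E3) 2)) 2 *
        (tangField i x 0 • D₀ + tangField i x 1 • D₁ + tangField i x 2 • D₂) 2 =
      (a ((x : E3) 2) * tangField i x 0 + 0 * tangField i x 1 + (x : E3) 0 * a' ((x : E3) 2) *
        tangField i x 2) * (D₀ 0 * tangField i x 0 + D₁ 0 * tangField i x 1 +
          D₂ 0 * tangField i x 2) +
      (0 * tangField i x 0 + a ((x : E3) 2) * tangField i x 1 + (x : E3) 1 * a' ((x : E3) 2) *
        tangField i x 2) * (D₀ 1 * tangField i x 0 + D₁ 1 * tangField i x 1 +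
          D₂ 1 * tangField i x 2) +
      (0 * tangField i x 0 + 0 * tangField i x 1 + b' ((x : E3) 2) *
        tangField i x 2) * (D₀ 2 * tangField i x 0 + D₁ 2 * tangField i x 1 +
          D₂ 2 * tangField i x 2) := by
    intro i
    simp [zonalDir]
    ring
  simp only [hdec, Finset.sum_add_distrib]
  rw [e₀, e₁, e₂]
  have h := x.sq_sum
  have r₀ : fderiv ℝ U x (rotField 0 1 x) = (x : E3) 0 • D₁ - (x : E3) 1 • D₀ := by
    simp only [rotField, map_sub, map_smul, hD₀, hD₁]
  have r₁ : fderiv ℝ U x (rotField 0 2 x) = (x : E3) 0 • D₂ - (x : E3) 2 • D₀ := by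
    simp only [rotField, map_sub, map_smul, hD₀, hD₂]
  have r₂ : fderiv ℝ U x (rotField 1 2 x) = (x : E3) 1 • D₂ - (x : E3) 2 • D₁ := by
    simp only [rotField, map_sub, map_smul, hD₁, hD₂]
  simp only [add_apply, sub_apply,
    neg_apply, smul_apply, ContinuousLinearMap.comp_apply,
    smul_eq_mul, r₀, r₁, r₂, PiLp.proj_apply, PiLp.sub_apply, PiLp.smul_apply]
  simp [zonalLap, rotField]
  linear_combination (-((x : E3) 0 * a'' ((x : E3) 2) * U x 0 +
    (x : E3) 1 * a'' ((x : E3) 2) * U x 1 + b'' ((x : E3) 2) * U x 2)) * h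

lemma norm_zonalLap_le (x : S2) {s s' s'' t' t'' M N : ℝ} (hs : |s| ≤ M) (hs' : |s'| ≤ M)
    (hs'' : (1 - (x : E3) 2 ^ 2) * |s''| ≤ N) (ht' : |t'| ≤ M)
    (ht'' : (1 - (x : E3) 2 ^ 2) * |t''| ≤ N) : ‖zonalLap x s s' s'' t' t''‖ ≤ 14 * M + 3 * N := by
  have hz := x.abs_apply_le 2
  have hz2 : 0 ≤ 1 - (x : E3) 2 ^ 2 := by
    have := abs_le.1 hz; nlinarith
  have key : ∀ {u v : ℝ}, |u| ≤ M → (1 - (x : E3) 2 ^ 2) * |v| ≤ N →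
      |(1 - (x : E3) 2 ^ 2) * v| ≤ N ∧ |(x : E3) 2 * u| ≤ M := fun hu hv =>
    ⟨by rwa [abs_mul, abs_of_nonneg hz2], by
      rw [abs_mul]; nlinarith [abs_nonneg ((x : E3) 2), (abs_nonneg _).trans hu]⟩
  obtain ⟨h1, h2⟩ := key hs' hs''
  obtain ⟨h3, h4⟩ := key ht' ht''
  have hA : |(1 - (x : E3) 2 ^ 2) * s'' - 4 * (x : E3) 2 * s' - 2 * s| ≤ 6 * M + N := by
    rw [abs_le] at *; constructor <;> linarith
  have hB : |(1 - (x : E3) 2 ^ 2) * t'' - 2 * (x : E3) 2 * t'| ≤ 2 * M + N := by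
    rw [abs_le] at *; constructor <;> linarith
  refine (norm_vec3_le _ _ _).trans ?_
  rw [abs_mul, abs_mul]
  nlinarith [x.abs_apply_le 0, x.abs_apply_le 1, abs_nonneg ((x : E3) 0), abs_nonneg ((x : E3) 1),
    abs_nonneg ((1 - (x : E3) 2 ^ 2) * s'' - 4 * (x : E3) 2 * s' - 2 * s)]

lemma tendsto_zonalDir {ι : Type*} {l : Filter ι} (x τ : E3) {s s' t' : ι → ℝ} {s₀ s₀' t₀' : ℝ}
    (hs : Tendsto s l (𝓝 s₀)) (hs' : Tendsto s' l (𝓝 s₀')) (ht' : Tendsto t' l (𝓝 t₀')) :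
    Tendsto (fun n => zonalDir x τ (s n) (s' n) (t' n)) l (𝓝 (zonalDir x τ s₀ s₀' t₀')) := by
  have hc : Continuous fun p : ℝ × ℝ × ℝ => zonalDir x τ p.1 p.2.1 p.2.2 := by
    unfold zonalDir; fun_prop
  exact (hc.tendsto (s₀, s₀', t₀')).comp (hs.prodMk_nhds (hs'.prodMk_nhds ht'))

lemma tendsto_zonalLap {ι : Type*} {l : Filter ι} (x : E3) {s s' s'' t' t'' : ι → ℝ}
    {s₀ s₀' s₀'' t₀' t₀'' : ℝ} (hs : Tendsto s l (𝓝 s₀)) (hs' : Tendsto s' l (𝓝 s₀'))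
    (hs'' : Tendsto s'' l (𝓝 s₀'')) (ht' : Tendsto t' l (𝓝 t₀')) (ht'' : Tendsto t'' l (𝓝 t₀'')) :
    Tendsto (fun n => zonalLap x (s n) (s' n) (s'' n) (t' n) (t'' n)) l
      (𝓝 (zonalLap x s₀ s₀' s₀'' t₀' t₀'')) := by
  have hc : Continuous fun p : ℝ × ℝ × ℝ × ℝ × ℝ =>
      zonalLap x p.1 p.2.1 p.2.2.1 p.2.2.2.1 p.2.2.2.2 := by
    unfold zonalLap; fun_prop
  have ht : Tendsto (fun n => (s n, s' n, s'' n, t' n, t'' n)) l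
      (𝓝 (s₀, s₀', s₀'', t₀', t₀'')) :=
    hs.prodMk_nhds (hs'.prodMk_nhds (hs''.prodMk_nhds (ht'.prodMk_nhds ht'')))
  have := (hc.tendsto (s₀, s₀', s₀'', t₀', t₀'')).comp ht
  simpa only [Function.comp_def] using this

lemma continuous_zonalDir_comp {p p' q' : ℝ → ℝ} (hp : ContinuousOn p (Icc (-1) 1))
    (hp' : ContinuousOn p' (Icc (-1) 1)) (hq' : ContinuousOn q' (Icc (-1) 1)) (i : Fin 3) :
    Continuous fun x : S2 => zonalDir x (tangField i x) (p ((x : E3) 2)) (p' ((x : E3) 2))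
      (q' ((x : E3) 2)) := by
  have hc : ∀ {f : ℝ → ℝ}, ContinuousOn f (Icc (-1) 1) → Continuous fun x : S2 => f ((x : E3) 2) :=
    fun hf => hf.comp_continuous (by fun_prop) fun x => x.apply_mem_Icc 2
  have h1 := hc hp
  have h2 := hc hp'
  have h3 := hc hq'
  have h4 : Continuous fun x : S2 => tangField i (x : E3) :=
    (continuous_tangField i).comp continuous_subtype_val
  have hd : Continuous fun p : E3 × E3 × ℝ × ℝ × ℝ =>
      zonalDir p.1 p.2.1 p.2.2.1 p.2.2.2.1 p.2.2.2.2 := by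
    unfold zonalDir; fun_prop
  exact hd.comp (continuous_subtype_val.prodMk (h4.prodMk (h1.prodMk (h2.prodMk h3))))

lemma continuous_zonalLap_comp {p p' p'' q' q'' : ℝ → ℝ} (hp : ContinuousOn p (Icc (-1) 1))
    (hp' : ContinuousOn p' (Icc (-1) 1)) (hp'' : ContinuousOn p'' (Icc (-1) 1))
    (hq' : ContinuousOn q' (Icc (-1) 1)) (hq'' : ContinuousOn q'' (Icc (-1) 1)) :
    Continuous fun x : S2 => zonalLap x (p ((x : E3) 2)) (p' ((x : E3) 2)) (p'' ((x : E3) 2))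
      (q' ((x : E3) 2)) (q'' ((x : E3) 2)) := by
  have hc : ∀ {f : ℝ → ℝ}, ContinuousOn f (Icc (-1) 1) → Continuous fun x : S2 => f ((x : E3) 2) :=
    fun hf => hf.comp_continuous (by fun_prop) fun x => x.apply_mem_Icc 2
  have h1 := hc hp
  have h2 := hc hp'
  have h3 := hc hp''
  have h4 := hc hq'
  have h5 := hc hq''
  have hd : Continuous fun p : E3 × ℝ × ℝ × ℝ × ℝ × ℝ =>
      zonalLap p.1 p.2.1 p.2.2.1 p.2.2.2.1 p.2.2.2.2.1 p.2.2.2.2.2 := by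
    unfold zonalLap; fun_prop
  exact hd.comp (continuous_subtype_val.prodMk
    (h1.prodMk (h2.prodMk (h3.prodMk (h4.prodMk h5)))))

/-- The Laplacian of the zonal map with data `a`, `b`. -/
noncomputable def zonalLaplacian (a a' a'' b' b'' : ℝ → ℝ) (x : S2) : E3 :=
  zonalLap x (a ((x : E3) 2)) (a' ((x : E3) 2)) (a'' ((x : E3) 2)) (b' ((x : E3) 2))
    (b'' ((x : E3) 2))

section

variable {a b a' b' a'' b'' : ℝ → ℝ} {M N : ℝ}

/-- Green's formula for the zonal map with dilated data `z ↦ a (dil n * z)`, `z ↦ b (dil n * z)`. The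
dilation moves the poles into the interior of the interval on which the data are smooth. -/
lemma ZonalData.dilated (h : ZonalData a b a' b' M)
    (ha' : ∀ z ∈ Ioo (-1 : ℝ) 1, HasDerivAt a' (a'' z) z) (ha'' : ContinuousOn a'' (Ioo (-1) 1))
    (hb' : ∀ z ∈ Ioo (-1 : ℝ) 1, HasDerivAt b' (b'' z) z) (hb'' : ContinuousOn b'' (Ioo (-1) 1))
    {U : E3 → E3} (hU : ContDiff ℝ ∞ U) (n : ℕ) :
    ∫ x : S2, ((∑ i, inner ℝ (zonalGrad (fun z => a (dil n * z)) (fun z => dil n * a' (dil n * z))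
      (fun z => dil n * b' (dil n * z)) i x) (tangDeriv U i x)) + inner ℝ
      (zonalLaplacian (fun z => a (dil n * z)) (fun z => dil n * a' (dil n * z))
        (fun z => dil n * (dil n * a'' (dil n * z))) (fun z => dil n * b' (dil n * z))
        (fun z => dil n * (dil n * b'' (dil n * z))) x) (U x)) ∂surf = 0 := by
  have hr := dil_pos n
  have hmem : ∀ z ∈ Ioo (-(dil n)⁻¹) (dil n)⁻¹, dil n * z ∈ Ioo (-1 : ℝ) 1 := by
    intro z hz
    have h1 := mul_lt_mul_of_pos_left hz.1 hr
    have h2 := mul_lt_mul_of_pos_left hz.2 hr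
    rw [mul_neg, mul_inv_cancel₀ hr.ne'] at h1
    rw [mul_inv_cancel₀ hr.ne'] at h2
    exact ⟨h1, h2⟩
  have hd : ∀ {f f' : ℝ → ℝ}, (∀ z ∈ Ioo (-1 : ℝ) 1, HasDerivAt f (f' z) z) →
      ∀ z ∈ Ioo (-(dil n)⁻¹) (dil n)⁻¹,
        HasDerivAt (fun z => f (dil n * z)) (dil n * f' (dil n * z)) z := by
    intro f f' hf z hz
    have := (hf _ (hmem z hz)).comp z ((hasDerivAt_id z).const_mul (dil n))
    simpa [mul_comm, Function.comp_def] using this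
  have hcont : ∀ {f : ℝ → ℝ}, ContinuousOn f (Ioo (-1) 1) →
      ContinuousOn (fun z => dil n * (dil n * f (dil n * z))) (Ioo (-(dil n)⁻¹) (dil n)⁻¹) :=
    fun hf => continuousOn_const.mul (continuousOn_const.mul
      (hf.comp (by fun_prop) fun z hz => hmem z hz))
  exact integral_zonal_dirichlet_of_one_lt ((one_lt_inv₀ hr).2 (dil_lt_one n))
    (hd h.hasDerivAt_a) (fun z hz => (hd ha' z hz).const_mul _) (hcont ha'')
    (fun z hz => (hd hb' z hz).const_mul _) (hcont hb'') hU

/-- The weak form of the Laplacian of a zonal map, tested with a smooth map. The second derivatives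
of the data may blow up at the poles like `1 / (1 - z²)`; the dilations of the data have no
singularity, and the identity passes to the limit. -/
lemma ZonalData.integral_dirichlet_smooth (h : ZonalData a b a' b' M)
    (ha' : ∀ z ∈ Ioo (-1 : ℝ) 1, HasDerivAt a' (a'' z) z) (ha'' : ContinuousOn a'' (Ioo (-1) 1))
    (hb' : ∀ z ∈ Ioo (-1 : ℝ) 1, HasDerivAt b' (b'' z) z) (hb'' : ContinuousOn b'' (Ioo (-1) 1))
    (ha''N : ∀ z ∈ Ioo (-1 : ℝ) 1, (1 - z ^ 2) * |a'' z| ≤ N)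
    (hb''N : ∀ z ∈ Ioo (-1 : ℝ) 1, (1 - z ^ 2) * |b'' z| ≤ N) {U : E3 → E3} (hU : ContDiff ℝ ∞ U) :
    ∫ x : S2, ((∑ i, inner ℝ (zonalGrad a a' b' i x) (tangDeriv U i x)) +
      inner ℝ (zonalLaplacian a a' a'' b' b'' x) (U x)) ∂surf = 0 := by
  have hUc : Continuous fun x : S2 => U x := hU.continuous.comp continuous_subtype_val
  have hdU : ∀ i, Continuous (tangDeriv U i) := continuous_tangDeriv (hU.of_le (by simp))
  obtain ⟨C₀, hC₀⟩ := (isCompact_univ (X := S2)).exists_bound_of_continuousOn hUc.continuousOn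
  choose C hC using fun i => (isCompact_univ (X := S2)).exists_bound_of_continuousOn
    (hdU i).continuousOn
  have hM : 0 ≤ M := (abs_nonneg _).trans (h.abs_a_le 0 (by simp))
  have hr : ∀ {f : ℝ → ℝ} (n : ℕ), (∀ z ∈ Icc (-1 : ℝ) 1, |f z| ≤ M) → ∀ x : S2,
      |dil n * f (dil n * (x : E3) 2)| ≤ M := by
    intro f n hf x
    rw [abs_mul, abs_of_pos (dil_pos n)]
    nlinarith [hf _ (Ioo_subset_Icc_self (dil_mul_mem (n := n) (x.apply_mem_Icc 2))),
      dil_lt_one n, dil_pos n, abs_nonneg (f (dil n * (x : E3) 2))]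
  have hr2 : ∀ {f : ℝ → ℝ} (n : ℕ), (∀ z ∈ Ioo (-1 : ℝ) 1, (1 - z ^ 2) * |f z| ≤ N) → ∀ x : S2,
      (1 - (x : E3) 2 ^ 2) * |dil n * (dil n * f (dil n * (x : E3) 2))| ≤ N := by
    intro f n hf x
    have h1 := hf _ (dil_mul_mem (n := n) (x.apply_mem_Icc 2))
    rw [abs_mul, abs_mul, abs_of_pos (dil_pos n)]
    set v := |f (dil n * (x : E3) 2)|
    have hv : 0 ≤ v := abs_nonneg _
    have h3 : dil n ^ 2 ≤ 1 := by nlinarith [dil_lt_one n, dil_pos n]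
    have hx2 : (x : E3) 2 ^ 2 ≤ 1 := by
      have := x.apply_mem_Icc 2; nlinarith [this.1, this.2]
    refine le_trans ?_ h1
    calc (1 - (x : E3) 2 ^ 2) * (dil n * (dil n * v))
        = ((1 - (x : E3) 2 ^ 2) * dil n ^ 2) * v := by ring
      _ ≤ (1 - (dil n * (x : E3) 2) ^ 2) * v := by
        refine mul_le_mul_of_nonneg_right ?_ hv
        nlinarith
  have hcI : ∀ {f f' : ℝ → ℝ}, (∀ z ∈ Ioo (-1 : ℝ) 1, HasDerivAt f (f' z) z) →
      ContinuousOn f (Ioo (-1) 1) := fun hf z hz => (hf z hz).continuousAt.continuousWithinAt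
  have hdil : ∀ {f : ℝ → ℝ} (n : ℕ), ContinuousOn f (Ioo (-1) 1) →
      ContinuousOn (fun z => f (dil n * z)) (Icc (-1) 1) := fun n hf =>
    hf.comp (by fun_prop) fun z hz => dil_mul_mem hz
  have hlim := tendsto_integral_of_dominated_convergence (μ := surf)
    (F := fun n x => (∑ i, inner ℝ (zonalGrad (fun z => a (dil n * z))
      (fun z => dil n * a' (dil n * z)) (fun z => dil n * b' (dil n * z)) i x) (tangDeriv U i x)) +
      inner ℝ (zonalLaplacian (fun z => a (dil n * z)) (fun z => dil n * a' (dil n * z))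
        (fun z => dil n * (dil n * a'' (dil n * z))) (fun z => dil n * b' (dil n * z))
        (fun z => dil n * (dil n * b'' (dil n * z))) x) (U x))
    (f := fun x => (∑ i, inner ℝ (zonalGrad a a' b' i x) (tangDeriv U i x)) +
      inner ℝ (zonalLaplacian a a' a'' b' b'' x) (U x))
    (fun _ => (∑ i, 10 * M * C i) + (14 * M + 3 * N) * C₀) ?_ (integrable_const _) ?_ ?_
  · simp_rw [h.dilated ha' ha'' hb' hb'' hU] at hlim
    exact (tendsto_nhds_unique hlim tendsto_const_nhds)
  · intro n
    refine Continuous.aestronglyMeasurable ?_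
    have ca := hdil n (hcI h.hasDerivAt_a)
    have ca' : ContinuousOn (fun z => dil n * a' (dil n * z)) (Icc (-1) 1) :=
      continuousOn_const.mul (hdil n h.continuousOn_a')
    have cb' : ContinuousOn (fun z => dil n * b' (dil n * z)) (Icc (-1) 1) :=
      continuousOn_const.mul (hdil n h.continuousOn_b')
    have ca'' : ContinuousOn (fun z => dil n * (dil n * a'' (dil n * z))) (Icc (-1) 1) :=
      continuousOn_const.mul (continuousOn_const.mul (hdil n ha''))
    have cb'' : ContinuousOn (fun z => dil n * (dil n * b'' (dil n * z))) (Icc (-1) 1) :=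
      continuousOn_const.mul (continuousOn_const.mul (hdil n hb''))
    have c₁ : ∀ i, Continuous (zonalGrad (fun z => a (dil n * z))
        (fun z => dil n * a' (dil n * z)) (fun z => dil n * b' (dil n * z)) i) :=
      fun i => continuous_zonalDir_comp ca ca' cb' i
    have c₂ : Continuous (zonalLaplacian (fun z => a (dil n * z))
        (fun z => dil n * a' (dil n * z)) (fun z => dil n * (dil n * a'' (dil n * z)))
        (fun z => dil n * b' (dil n * z)) (fun z => dil n * (dil n * b'' (dil n * z)))) :=
      continuous_zonalLap_comp ca ca' ca'' cb' cb''
    exact (continuous_finsetSum _ fun i _ => (c₁ i).inner (hdU i)).add (c₂.inner hUc)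
  · intro n
    refine Eventually.of_forall fun x => (norm_add_le _ _).trans (add_le_add
      ((norm_sum_le _ _).trans (Finset.sum_le_sum fun i _ => ?_)) ?_)
    · refine (norm_inner_le_norm _ _).trans (mul_le_mul ?_ (hC i x (mem_univ _)) (norm_nonneg _)
        (by positivity))
      refine (norm_zonalDir_le x i _ _ _).trans ?_
      have h1 := h.abs_a_le _ (Ioo_subset_Icc_self (dil_mul_mem (n := n) (x.apply_mem_Icc 2)))
      linarith [hr n h.abs_a'_le x, hr n h.abs_b'_le x]
    · have h1 := norm_zonalLap_le x
        (h.abs_a_le _ (Ioo_subset_Icc_self (dil_mul_mem (n := n) (x.apply_mem_Icc 2))))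
        (hr n h.abs_a'_le x) (hr2 n ha''N x) (hr n h.abs_b'_le x) (hr2 n hb''N x)
      exact (norm_inner_le_norm _ _).trans (mul_le_mul h1 (hC₀ x (mem_univ _)) (norm_nonneg _)
        ((norm_nonneg _).trans h1))
  · filter_upwards [ae_apply_two_mem_Ioo] with x hx
    have hnx := isOpen_Ioo.mem_nhds hx
    have ta := tendsto_comp_dil (h.hasDerivAt_a _ hx).continuousAt
    have ta' := tendsto_dil.mul (tendsto_comp_dil (h.continuousOn_a'.continuousAt hnx))
    have tb' := tendsto_dil.mul (tendsto_comp_dil (h.continuousOn_b'.continuousAt hnx))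
    have ta'' := tendsto_dil.mul (tendsto_dil.mul (tendsto_comp_dil (ha''.continuousAt hnx)))
    have tb'' := tendsto_dil.mul (tendsto_dil.mul (tendsto_comp_dil (hb''.continuousAt hnx)))
    rw [one_mul] at ta' tb' ta'' tb''
    rw [one_mul] at ta'' tb''
    have t₁ : ∀ i, Tendsto (fun n => zonalGrad (fun z => a (dil n * z))
        (fun z => dil n * a' (dil n * z)) (fun z => dil n * b' (dil n * z)) i x) atTop
        (𝓝 (zonalGrad a a' b' i x)) := fun i => tendsto_zonalDir x (tangField i x) ta ta' tb'
    have t₂ : Tendsto (fun n => zonalLaplacian (fun z => a (dil n * z))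
        (fun z => dil n * a' (dil n * z)) (fun z => dil n * (dil n * a'' (dil n * z)))
        (fun z => dil n * b' (dil n * z)) (fun z => dil n * (dil n * b'' (dil n * z))) x) atTop
        (𝓝 (zonalLaplacian a a' a'' b' b'' x)) := tendsto_zonalLap x ta ta' ta'' tb' tb''
    exact (tendsto_finsetSum _ fun i _ => (t₁ i).inner tendsto_const_nhds).add
      (t₂.inner tendsto_const_nhds)

lemma ZonalData.norm_zonalLaplacian_le (h : ZonalData a b a' b' M)
    (ha''N : ∀ z ∈ Icc (-1 : ℝ) 1, (1 - z ^ 2) * |a'' z| ≤ N)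
    (hb''N : ∀ z ∈ Icc (-1 : ℝ) 1, (1 - z ^ 2) * |b'' z| ≤ N) (x : S2) :
    ‖zonalLaplacian a a' a'' b' b'' x‖ ≤ 14 * M + 3 * N :=
  norm_zonalLap_le x (h.abs_a_le _ (x.apply_mem_Icc 2)) (h.abs_a'_le _ (x.apply_mem_Icc 2))
    (ha''N _ (x.apply_mem_Icc 2)) (h.abs_b'_le _ (x.apply_mem_Icc 2)) (hb''N _ (x.apply_mem_Icc 2))

/-- The weak form of the Laplacian of a zonal map, tested with an `H¹`-map. -/
lemma ZonalData.integral_dirichlet (h : ZonalData a b a' b' M)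
    (ha' : ∀ z ∈ Ioo (-1 : ℝ) 1, HasDerivAt a' (a'' z) z) (ha'' : ContinuousOn a'' (Ioo (-1) 1))
    (hb' : ∀ z ∈ Ioo (-1 : ℝ) 1, HasDerivAt b' (b'' z) z) (hb'' : ContinuousOn b'' (Ioo (-1) 1))
    (ha''N : ∀ z ∈ Icc (-1 : ℝ) 1, (1 - z ^ 2) * |a'' z| ≤ N)
    (hb''N : ∀ z ∈ Icc (-1 : ℝ) 1, (1 - z ^ 2) * |b'' z| ≤ N) {φ : S2 → E3} {H : Fin 3 → S2 → E3}
    (hφ : HasH1Gradient φ H) :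
    ∫ x : S2, ((∑ i, inner ℝ (zonalGrad a a' b' i x) (H i x)) +
      inner ℝ (zonalLaplacian a a' a'' b' b'' x) (φ x)) ∂surf = 0 := by
  obtain ⟨hφ2, hH2, U, hU, hUφ, hUH⟩ := hφ
  have hG : ∀ i, AEStronglyMeasurable (zonalGrad a a' b' i) surf := fun i => (h.hasH1Gradient.2.1 i).1
  have hL : AEStronglyMeasurable (zonalLaplacian a a' a'' b' b'') surf := by
    have hd : ∀ {f : ℝ → ℝ} (n : ℕ), ContinuousOn f (Ioo (-1) 1) →
      ContinuousOn (fun z => f (dil n * z)) (Icc (-1) 1) := fun n hf =>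
        hf.comp (by fun_prop) fun z hz => dil_mul_mem hz
    have hcI : ∀ {f f' : ℝ → ℝ}, (∀ z ∈ Ioo (-1 : ℝ) 1, HasDerivAt f (f' z) z) →
      ContinuousOn f (Ioo (-1) 1) := fun hf z hz => (hf z hz).continuousAt.continuousWithinAt
    refine aestronglyMeasurable_of_tendsto_ae atTop (fun n => (continuous_zonalLap_comp
      (hd n (hcI h.hasDerivAt_a)) (hd n h.continuousOn_a') (hd n ha'') (hd n h.continuousOn_b')
      (hd n hb'')).aestronglyMeasurable) ?_
    filter_upwards [ae_apply_two_mem_Ioo] with x hx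
    have hnx := isOpen_Ioo.mem_nhds hx
    exact tendsto_zonalLap x (tendsto_comp_dil (h.hasDerivAt_a _ hx).continuousAt)
      (tendsto_comp_dil (h.continuousOn_a'.continuousAt hnx))
      (tendsto_comp_dil (ha''.continuousAt hnx))
      (tendsto_comp_dil (h.continuousOn_b'.continuousAt hnx))
      (tendsto_comp_dil (hb''.continuousAt hnx))
  have hUc : ∀ j, Continuous fun x : S2 => U j x := fun j =>
    (hU j).continuous.comp continuous_subtype_val
  have hdU : ∀ j i, Continuous (tangDeriv (U j) i) := fun j =>
    continuous_tangDeriv ((hU j).of_le (by simp))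
  have hi : ∀ {g f : S2 → E3} {C : ℝ}, AEStronglyMeasurable g surf → (∀ x, ‖g x‖ ≤ C) →
      MemLp f 2 surf → Integrable (fun x => inner ℝ (g x) (f x)) surf := by
    intro g f C hg hgC hf
    refine ((hf.integrable one_le_two).norm.const_mul C).mono' (hg.inner hf.1)
      (Eventually.of_forall fun x => (norm_inner_le_norm _ _).trans ?_)
    gcongr
    exact hgC x
  have hGb := h.norm_zonalGrad_le
  have hLb := h.norm_zonalLaplacian_le ha''N hb''N
  have hsplit : ∀ {f : S2 → E3} {F : Fin 3 → S2 → E3}, MemLp f 2 surf → (∀ i, MemLp (F i) 2 surf) →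
      ∫ x : S2, ((∑ i, inner ℝ (zonalGrad a a' b' i x) (F i x)) +
        inner ℝ (zonalLaplacian a a' a'' b' b'' x) (f x)) ∂surf =
      (∑ i, ∫ x, inner ℝ (zonalGrad a a' b' i x) (F i x) ∂surf) +
        ∫ x, inner ℝ (zonalLaplacian a a' a'' b' b'' x) (f x) ∂surf := by
    intro f F hf hF
    rw [integral_add (integrable_finsetSum _ fun i _ => hi (hG i) (hGb i) (hF i)) (hi hL hLb hf),
      integral_finsetSum _ fun i _ => hi (hG i) (hGb i) (hF i)]
  rw [hsplit hφ2 hH2]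
  have hlim := (tendsto_finsetSum Finset.univ fun i _ => tendsto_integral_inner (hG i) (hGb i)
    (fun j => (hdU j i).memLp_surf 2) (hH2 i) (hUH i)).add
    (tendsto_integral_inner hL hLb (fun j => (hUc j).memLp_surf 2) hφ2 hUφ)
  refine tendsto_nhds_unique hlim (tendsto_const_nhds.congr fun j => ?_)
  rw [← hsplit ((hUc j).memLp_surf 2) fun i => (hdU j i).memLp_surf 2]
  exact (h.integral_dirichlet_smooth ha' ha'' hb' hb''
    (fun z hz => ha''N z (Ioo_subset_Icc_self hz)) (fun z hz => hb''N z (Ioo_subset_Icc_self hz))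
    (hU j)).symm

end

/-! ### Critical zonal maps -/

lemma sum_norm_zonalDir_sq (x : S2) (s s' t' : ℝ) :
    ∑ i, ‖zonalDir x (tangField i x) s s' t'‖ ^ 2 =
      ((1 - (x : E3) 2 ^ 2) * s' - (x : E3) 2 * s) ^ 2 + s ^ 2 + (1 - (x : E3) 2 ^ 2) * t' ^ 2 := by
  have e₀ := sum_tangField_eq_sum_rotField x s 0 ((x : E3) 0 * s') s 0 ((x : E3) 0 * s')
  have e₁ := sum_tangField_eq_sum_rotField x 0 s ((x : E3) 1 * s') 0 s ((x : E3) 1 * s')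
  have e₂ := sum_tangField_eq_sum_rotField x 0 0 t' 0 0 t'
  have hi : ∀ i, ‖zonalDir x (tangField i x) s s' t'‖ ^ 2 =
      (s * tangField i x 0 + 0 * tangField i x 1 + (x : E3) 0 * s' * tangField i x 2) *
        (s * tangField i x 0 + 0 * tangField i x 1 + (x : E3) 0 * s' * tangField i x 2) +
      (0 * tangField i x 0 + s * tangField i x 1 + (x : E3) 1 * s' * tangField i x 2) *
        (0 * tangField i x 0 + s * tangField i x 1 + (x : E3) 1 * s' * tangField i x 2) +
      (0 * tangField i x 0 + 0 * tangField i x 1 + t' * tangField i x 2) *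
        (0 * tangField i x 0 + 0 * tangField i x 1 + t' * tangField i x 2) := by
    intro i
    rw [← real_inner_self_eq_norm_sq, inner_vec3]
    simp [zonalDir]
    ring
  simp only [hi, Finset.sum_add_distrib]
  rw [e₀, e₁, e₂]
  have h : (x : E3) 0 ^ 2 = 1 - (x : E3) 1 ^ 2 - (x : E3) 2 ^ 2 := by linarith [x.sq_sum]
  ring_nf
  simp only [h, show (x : E3) 0 ^ 4 = ((x : E3) 0 ^ 2) ^ 2 by ring]
  ring

/-- The tangential fields are orthogonal to the position vector. -/
lemma tangField_orthogonal (x : S2) (i : Fin 3) : (x : E3) 0 * tangField i x 0 +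
    (x : E3) 1 * tangField i x 1 + (x : E3) 2 * tangField i x 2 = 0 := by
  have h := x.sq_sum
  have hs : (x : E3) 0 * (EuclideanSpace.single i (1 : ℝ) : E3) 0 +
      (x : E3) 1 * (EuclideanSpace.single i (1 : ℝ) : E3) 1 +
      (x : E3) 2 * (EuclideanSpace.single i (1 : ℝ) : E3) 2 = (x : E3) i := by
    fin_cases i <;> simp
  simp only [tangField, PiLp.sub_apply, PiLp.smul_apply, smul_eq_mul]
  linear_combination hs - (x : E3) i * h

/-- At the poles the third component of every tangential field vanishes. -/
lemma mem_Ioo_or_tangField_eq_zero (x : S2) (i : Fin 3) :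
    (x : E3) 2 ∈ Ioo (-1 : ℝ) 1 ∨ tangField i x 2 = 0 := by
  by_cases hx : (x : E3) 2 ∈ Ioo (-1 : ℝ) 1
  · exact Or.inl hx
  · right
    have h2 : (x : E3) 2 ^ 2 = 1 := by
      have h1 := x.apply_mem_Icc 2
      by_contra hne
      refine hx ⟨lt_of_le_of_ne h1.1 fun h => hne ?_, lt_of_le_of_ne h1.2 fun h => hne ?_⟩
      · rw [← h]; norm_num
      · rw [h]; norm_num
    have h := x.sq_sum
    rw [h2] at h
    have h0 : (x : E3) 0 = 0 := by nlinarith [sq_nonneg ((x : E3) 0), sq_nonneg ((x : E3) 1)]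
    have h1 : (x : E3) 1 = 0 := by nlinarith [sq_nonneg ((x : E3) 0), sq_nonneg ((x : E3) 1)]
    fin_cases i <;> simp [tangField, h0, h1]
    linarith

lemma inner_zonalPt_zonalDir (x : S2) (i : Fin 3) (s t σ σ' τ' : ℝ) :
    inner ℝ (zonalPt x s t) (zonalDir x (tangField i x) σ σ' τ') =
      tangField i x 2 * (-(x : E3) 2 * s * σ + (1 - (x : E3) 2 ^ 2) * s * σ' + t * τ') := by
  have h := x.sq_sum
  have ho := tangField_orthogonal x i
  rw [inner_vec3]
  simp only [zonalPt, zonalDir]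
  simp
  linear_combination s * σ * ho + s * σ' * tangField i x 2 * h

lemma inner_zonalPt (x : S2) (s t σ τ : ℝ) : inner ℝ (zonalPt x s t) (zonalPt x σ τ) =
    (1 - (x : E3) 2 ^ 2) * s * σ + t * τ := by
  have h := x.sq_sum
  rw [inner_vec3]
  simp only [zonalPt]
  simp
  linear_combination s * σ * h

lemma inner_zonalPt_self (x : S2) (s t : ℝ) : inner ℝ (zonalPt x s t) (x : E3) =
    (1 - (x : E3) 2 ^ 2) * s + (x : E3) 2 * t := by
  have h := x.sq_sum
  rw [inner_vec3]
  simp only [zonalPt]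
  simp
  linear_combination s * h

/-- The profile equation in the variable `z = cos θ`: if `h` is the profile, then
`a = sin h / sin θ`, `b = cos h` and `y = h'`. All quantities are bounded up to the poles. -/
structure ZonalSolution (κ : ℝ) (a b y a' y' : ℝ → ℝ) (M : ℝ) : Prop where
  hasDerivAt_a : ∀ z ∈ Ioo (-1 : ℝ) 1, HasDerivAt a (a' z) z
  hasDerivAt_b : ∀ z ∈ Ioo (-1 : ℝ) 1, HasDerivAt b (a z * y z) z
  hasDerivAt_y : ∀ z ∈ Ioo (-1 : ℝ) 1, HasDerivAt y (y' z) z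
  a'_eq : ∀ z ∈ Ioo (-1 : ℝ) 1, (1 - z ^ 2) * a' z = z * a z - b z * y z
  y'_eq : ∀ z ∈ Ioo (-1 : ℝ) 1, (1 - z ^ 2) * y' z = z * y z - a z * b z -
    κ * ((1 - z ^ 2) * ((1 - z ^ 2) * a z + z * b z) * (z * a z - b z))
  sq_add_sq : ∀ z ∈ Icc (-1 : ℝ) 1, (1 - z ^ 2) * a z ^ 2 + b z ^ 2 = 1
  one_le : 1 ≤ M
  abs_a_le : ∀ z ∈ Icc (-1 : ℝ) 1, |a z| ≤ M
  abs_y_le : ∀ z ∈ Icc (-1 : ℝ) 1, |y z| ≤ M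
  abs_a'_le : ∀ z ∈ Icc (-1 : ℝ) 1, |a' z| ≤ M
  abs_y'_le : ∀ z ∈ Icc (-1 : ℝ) 1, |y' z| ≤ M

lemma one_sub_sq_pos {z : ℝ} (hz : z ∈ Ioo (-1 : ℝ) 1) : 0 < 1 - z ^ 2 := by
  nlinarith [hz.1, hz.2]

lemma one_sub_sq_mem {z : ℝ} (hz : z ∈ Icc (-1 : ℝ) 1) : 0 ≤ 1 - z ^ 2 ∧ 1 - z ^ 2 ≤ 1 := by
  constructor <;> nlinarith [hz.1, hz.2]

namespace ZonalSolution

variable {κ M : ℝ} {a b y a' y' : ℝ → ℝ}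

lemma abs_b_le (h : ZonalSolution κ a b y a' y' M) {z : ℝ} (hz : z ∈ Icc (-1 : ℝ) 1) :
    |b z| ≤ 1 := by
  have h1 := h.sq_add_sq z hz
  refine abs_le_one_iff_mul_self_le_one.2 ?_
  nlinarith [mul_nonneg (one_sub_sq_mem hz).1 (sq_nonneg (a z))]

lemma continuousOn_a (h : ZonalSolution κ a b y a' y' M) : ContinuousOn a (Ioo (-1) 1) :=
  fun z hz => (h.hasDerivAt_a z hz).continuousAt.continuousWithinAt

lemma continuousOn_b (h : ZonalSolution κ a b y a' y' M) : ContinuousOn b (Ioo (-1) 1) :=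
  fun z hz => (h.hasDerivAt_b z hz).continuousAt.continuousWithinAt

lemma continuousOn_y (h : ZonalSolution κ a b y a' y' M) : ContinuousOn y (Ioo (-1) 1) :=
  fun z hz => (h.hasDerivAt_y z hz).continuousAt.continuousWithinAt

lemma continuousOn_a' (h : ZonalSolution κ a b y a' y' M) : ContinuousOn a' (Ioo (-1) 1) := by
  have hc : ContinuousOn (fun z => (z * a z - b z * y z) / (1 - z ^ 2)) (Ioo (-1) 1) :=
    ((continuousOn_id.mul h.continuousOn_a).sub (h.continuousOn_b.mul h.continuousOn_y)).div
      (by fun_prop) fun z hz => (one_sub_sq_pos hz).ne'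
  refine hc.congr fun z hz => ?_
  rw [eq_div_iff (one_sub_sq_pos hz).ne', ← h.a'_eq z hz, mul_comm]

lemma continuousOn_y' (h : ZonalSolution κ a b y a' y' M) : ContinuousOn y' (Ioo (-1) 1) := by
  have ca := h.continuousOn_a
  have cb := h.continuousOn_b
  have cy := h.continuousOn_y
  have hc : ContinuousOn (fun z => (z * y z - a z * b z - κ * ((1 - z ^ 2) *
      ((1 - z ^ 2) * a z + z * b z) * (z * a z - b z))) / (1 - z ^ 2)) (Ioo (-1) 1) :=
    ContinuousOn.div (by fun_prop) (by fun_prop) fun z hz => (one_sub_sq_pos hz).ne'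
  refine hc.congr fun z hz => ?_
  rw [eq_div_iff (one_sub_sq_pos hz).ne', ← h.y'_eq z hz, mul_comm]

lemma zonalData (h : ZonalSolution κ a b y a' y' M) :
    ZonalData a b a' (fun z => a z * y z) (M ^ 2) := by
  have hM := h.one_le
  have hM2 : M ≤ M ^ 2 := by nlinarith
  exact ⟨h.hasDerivAt_a, h.hasDerivAt_b, h.continuousOn_a', h.continuousOn_a.mul h.continuousOn_y,
    fun z hz => (h.abs_a_le z hz).trans hM2, fun z hz => (h.abs_b_le hz).trans (hM.trans hM2),
    fun z hz => (h.abs_a'_le z hz).trans hM2, fun z hz => by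
      rw [abs_mul, sq]
      exact mul_le_mul (h.abs_a_le z hz) (h.abs_y_le z hz) (abs_nonneg _) (by linarith)⟩

lemma norm_zonalMap (h : ZonalSolution κ a b y a' y' M) (x : S2) : ‖zonalMap a b x‖ = 1 := by
  have h1 := inner_zonalPt x (a ((x : E3) 2)) (b ((x : E3) 2)) (a ((x : E3) 2)) (b ((x : E3) 2))
  rw [real_inner_self_eq_norm_sq] at h1
  have h2 := h.sq_add_sq _ (x.apply_mem_Icc 2)
  have h3 : ‖zonalMap a b x‖ ^ 2 = 1 := by
    simp only [zonalMap]
    rw [h1]; linarith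
  exact (pow_eq_one_iff_of_nonneg (norm_nonneg _) two_ne_zero).1 h3

lemma inner_zonalMap_zonalGrad (h : ZonalSolution κ a b y a' y' M) (i : Fin 3) (x : S2) :
    inner ℝ (zonalMap a b x) (zonalGrad a a' (fun z => a z * y z) i x) = 0 := by
  simp only [zonalMap, zonalGrad]
  rw [inner_zonalPt_zonalDir]
  rcases mem_Ioo_or_tangField_eq_zero x i with hx | hx
  · linear_combination (tangField i x 2 * a ((x : E3) 2)) * h.a'_eq _ hx
  · rw [hx, zero_mul]

lemma sum_norm_zonalGrad_sq (h : ZonalSolution κ a b y a' y' M) {x : S2}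
    (hx : (x : E3) 2 ∈ Ioo (-1 : ℝ) 1) :
    ∑ i, ‖zonalGrad a a' (fun z => a z * y z) i x‖ ^ 2 =
      a ((x : E3) 2) ^ 2 + y ((x : E3) 2) ^ 2 := by
  simp only [zonalGrad]
  rw [sum_norm_zonalDir_sq, h.a'_eq _ hx]
  linear_combination (y ((x : E3) 2) ^ 2) * h.sq_add_sq _ (Ioo_subset_Icc_self hx)

/-- The second derivative of `a`. -/
noncomputable def secondA (a b y a' y' : ℝ → ℝ) (z : ℝ) : ℝ :=
  (3 * z * a' z + a z - a z * y z ^ 2 - b z * y' z) / (1 - z ^ 2)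

lemma hasDerivAt_a' (h : ZonalSolution κ a b y a' y' M) {z : ℝ} (hz : z ∈ Ioo (-1 : ℝ) 1) :
    HasDerivAt a' (secondA a b y a' y' z) z := by
  have hd := (one_sub_sq_pos hz).ne'
  have h1 : HasDerivAt (fun z => (z * a z - b z * y z) / (1 - z ^ 2)) _ z :=
    (((hasDerivAt_id z).mul (h.hasDerivAt_a z hz)).sub
      ((h.hasDerivAt_b z hz).mul (h.hasDerivAt_y z hz))).div
      (((hasDerivAt_id z).pow 2).const_sub 1) hd
  have h2 : HasDerivAt a' _ z := h1.congr_of_eventuallyEq <| by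
    filter_upwards [isOpen_Ioo.mem_nhds hz] with t ht
    rw [eq_div_iff (one_sub_sq_pos ht).ne', ← h.a'_eq t ht, mul_comm]
  convert h2 using 1
  simp only [id, Pi.mul_apply, Pi.sub_apply]
  have h3 := h.a'_eq z hz
  rw [← h3, secondA]
  field_simp
  ring

lemma integral_firstVariationDensity (h : ZonalSolution κ a b y a' y' M) {φ : S2 → E3}
    {H : Fin 3 → S2 → E3} (hφ : HasH1Gradient φ H) :
    ∫ x, firstVariationDensity κ (zonalMap a b) φ (zonalGrad a a' (fun z => a z * y z)) H x
      ∂surf = 0 := by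
  have hM := h.one_le
  have hmul : ∀ {u v : ℝ}, |u| ≤ M → |v| ≤ M → |u * v| ≤ M ^ 2 := fun hu hv => by
    rw [abs_mul, sq]
    exact mul_le_mul hu hv (abs_nonneg _) (by linarith)
  have hM2 : M ≤ M ^ 2 := by nlinarith
  have hM3 : M ^ 2 ≤ M ^ 3 := pow_le_pow_right₀ hM (by norm_num)
  have ca := h.continuousOn_a
  have cb := h.continuousOn_b
  have cy := h.continuousOn_y
  have ca' := h.continuousOn_a'
  have cy' := h.continuousOn_y'
  have key := h.zonalData.integral_dirichlet (a'' := secondA a b y a' y')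
    (b'' := fun z => a' z * y z + a z * y' z) (N := 6 * M ^ 3)
    (fun z hz => h.hasDerivAt_a' hz)
    (ContinuousOn.div (by fun_prop) (by fun_prop) fun z hz => (one_sub_sq_pos hz).ne')
    (fun z hz => (h.hasDerivAt_a z hz).mul (h.hasDerivAt_y z hz)) (by fun_prop) ?_ ?_ hφ
  · have hae : ∀ᵐ x ∂surf, firstVariationDensity κ (zonalMap a b) φ
        (zonalGrad a a' (fun z => a z * y z)) H x =
        2 * ((∑ i, inner ℝ (zonalGrad a a' (fun z => a z * y z) i x) (H i x)) +
          inner ℝ (zonalLaplacian a a' (secondA a b y a' y') (fun z => a z * y z)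
            (fun z => a' z * y z + a z * y' z) x) (φ x)) := by
      filter_upwards [ae_apply_two_mem_Ioo] with x hx
      -- The harmonic map equation with potential.
      have hL : zonalLaplacian a a' (secondA a b y a' y') (fun z => a z * y z)
            (fun z => a' z * y z + a z * y' z) x =
          (-(a ((x : E3) 2) ^ 2 + y ((x : E3) 2) ^ 2) +
            κ * inner ℝ (zonalMap a b x) (x : E3) ^ 2) • zonalMap a b x -
          (κ * inner ℝ (zonalMap a b x) (x : E3)) • (x : E3) := by
        have hs : inner ℝ (zonalMap a b x) (x : E3) = _ :=
          inner_zonalPt_self x (a ((x : E3) 2)) (b ((x : E3) 2))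
        rw [hs]
        have e1 := h.a'_eq _ hx
        have e2 := h.y'_eq _ hx
        have e3 := h.sq_add_sq _ (Ioo_subset_Icc_self hx)
        have hd := one_sub_sq_pos hx
        simp only [zonalLaplacian, zonalMap, secondA]
        set z := (x : E3) 2
        have e4 : (1 - z ^ 2) * ((3 * z * a' z + a z - a z * y z ^ 2 - b z * y' z) / (1 - z ^ 2)) -
            4 * z * a' z - 2 * a z = (-(a z ^ 2 + y z ^ 2) +
              κ * ((1 - z ^ 2) * a z + z * b z) ^ 2) * a z -
                κ * ((1 - z ^ 2) * a z + z * b z) := by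
          rw [mul_div_cancel₀ _ hd.ne']
          refine mul_left_cancel₀ hd.ne' ?_
          linear_combination (-z) * e1 - b z * e2 + (a z - κ * ((1 - z ^ 2) * a z + z * b z) *
            (1 - z ^ 2)) * e3
        ext k
        fin_cases k
        · simp [zonalLap, zonalPt]
          linear_combination ((x : E3) 0) * e4
        · simp [zonalLap, zonalPt]
          linear_combination ((x : E3) 1) * e4
        · simp [zonalLap, zonalPt]
          linear_combination (y z) * e1 + a z * e2 - κ * ((1 - z ^ 2) * a z + z * b z) * z * e3
      rw [hL, inner_sub_left, real_inner_smul_left, real_inner_smul_left, firstVariationDensity,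
        Finset.sum_sub_distrib, ← Finset.sum_mul, h.sum_norm_zonalGrad_sq hx, ← Finset.mul_sum,
        real_inner_comm (φ x) (x : E3)]
      ring
    rw [integral_congr_ae hae, integral_const_mul, key, mul_zero]
  · intro z hz
    have h1 : (1 - z ^ 2) * |secondA a b y a' y' z| ≤
        |3 * z * a' z + a z - a z * y z ^ 2 - b z * y' z| := by
      rw [secondA, abs_div, abs_of_nonneg (one_sub_sq_mem hz).1]
      by_cases h0 : 1 - z ^ 2 = 0
      · rw [h0, zero_mul]; exact abs_nonneg _
      · rw [mul_div_cancel₀ _ h0]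
    refine h1.trans ?_
    have b1 : |z * a' z| ≤ M := by
      rw [abs_mul]
      nlinarith [abs_le.2 hz, abs_nonneg z, h.abs_a'_le z hz, abs_nonneg (a' z)]
    have b2 : |a z * y z ^ 2| ≤ M ^ 3 := by
      have := mul_le_mul (h.abs_a_le z hz) (hmul (h.abs_y_le z hz) (h.abs_y_le z hz))
        (abs_nonneg _) (by linarith)
      rw [← abs_mul] at this
      calc |a z * y z ^ 2| = |a z * (y z * y z)| := by rw [sq]
        _ ≤ M * M ^ 2 := this
        _ = M ^ 3 := by ring
    have b3 : |b z * y' z| ≤ M := by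
      rw [abs_mul]
      nlinarith [h.abs_b_le hz, abs_nonneg (b z), h.abs_y'_le z hz, abs_nonneg (y' z)]
    have b4 := h.abs_a_le z hz
    rw [abs_le] at *
    constructor <;> linarith
  · intro z hz
    have b1 := hmul (h.abs_a'_le z hz) (h.abs_y_le z hz)
    have b2 := hmul (h.abs_a_le z hz) (h.abs_y'_le z hz)
    have b3 := (abs_add_le (a' z * y z) (a z * y' z)).trans (add_le_add b1 b2)
    have := (one_sub_sq_mem hz).2
    nlinarith [abs_nonneg (a' z * y z + a z * y' z)]

/-- A bounded solution of the profile equation gives a critical point. -/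
lemma isCriticalPoint (h : ZonalSolution κ a b y a' y' M) : IsCriticalPoint κ (zonalMap a b) := by
  refine ⟨⟨⟨_, h.zonalData.hasH1Gradient⟩, Eventually.of_forall h.norm_zonalMap⟩, ?_⟩
  rintro φ ⟨H, hφ⟩ hφb
  have hB : ∀ᵐ x ∂surf, ‖φ x‖ ≤ (eLpNorm φ ⊤ surf).toReal := by
    have := ae_le_eLpNormEssSup (f := φ) (μ := surf)
    filter_upwards [this] with x hx
    rw [← eLpNorm_exponent_top] at hx
    rw [← toReal_enorm]
    exact ENNReal.toReal_mono hφb.2.ne hx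
  have := hasDerivAt_energy_variation h.zonalData.hasH1Gradient hφ h.norm_zonalMap
    h.inner_zonalMap_zonalGrad h.zonalData.norm_zonalGrad_le hB ENNReal.toReal_nonneg κ
  rwa [h.integral_firstVariationDensity hφ, mul_zero] at this

end ZonalSolution

/-! ### Directions of negative and of positive second variation -/

/-- A bound for the gradient of the normalized perturbation `(m + φ) / |m + φ|`. -/
lemma norm_normalize_gradient_sub_le {m φ g h : E3} {C : ℝ} (hm : ‖m‖ = 1) (hφ : ‖φ‖ ≤ 1 / 2)
    (hg : ‖g‖ ≤ C) (hh : ‖h‖ ≤ C) :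
    ‖‖m + φ‖⁻¹ • (m + φ) - m‖ ≤ 2 ∧
    ‖‖m + φ‖⁻¹ • (g + h) - (‖m + φ‖⁻¹ ^ 3 * inner ℝ (m + φ) (g + h)) • (m + φ) - g‖ ≤ 69 * C := by
  have hC0 : 0 ≤ C := (norm_nonneg _).trans hg
  have hy1 : ‖m + φ‖ ≤ 2 := by
    have := norm_add_le m φ
    linarith
  have hy2 : 1 / 2 ≤ ‖m + φ‖ := by
    have := norm_sub_le (m + φ) φ
    rw [add_sub_cancel_right, hm] at this; linarith
  have hyi : ‖m + φ‖⁻¹ ≤ 2 := by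
    rw [inv_le_comm₀ (by linarith) two_pos]; linarith
  have hyi0 : 0 ≤ ‖m + φ‖⁻¹ := inv_nonneg.2 (norm_nonneg _)
  have hv : ‖g + h‖ ≤ 2 * C := by
    have := norm_add_le g h
    linarith
  constructor
  · refine (norm_sub_le _ _).trans ?_
    rw [hm, norm_smul, norm_inv, norm_norm, inv_mul_cancel₀ (by linarith)]
    norm_num
  · have h1 : ‖‖m + φ‖⁻¹ • (g + h)‖ ≤ 2 * (2 * C) := by
      rw [norm_smul, norm_inv, norm_norm]
      exact mul_le_mul hyi hv (norm_nonneg _) two_pos.le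
    have h2 : ‖(‖m + φ‖⁻¹ ^ 3 * inner ℝ (m + φ) (g + h)) • (m + φ)‖ ≤
        2 ^ 3 * (2 * (2 * C)) * 2 := by
      rw [norm_smul, norm_mul, norm_pow, norm_inv, norm_norm]
      refine mul_le_mul (mul_le_mul (pow_le_pow_left₀ hyi0 hyi 3)
        ((norm_inner_le_norm _ _).trans (mul_le_mul hy1 hv (norm_nonneg _) two_pos.le))
        (norm_nonneg _) (by norm_num)) hy1 (norm_nonneg _) (by positivity)
    refine (norm_sub_le _ _).trans ?_
    have := norm_sub_le (‖m + φ‖⁻¹ • (g + h))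
      ((‖m + φ‖⁻¹ ^ 3 * inner ℝ (m + φ) (g + h)) • (m + φ))
    linarith

/-- The variations of a bounded map along a bounded field converge in `H¹`. -/
lemma tendsto_h1Norm_variation_sub {m φ : S2 → E3} {G H : Fin 3 → S2 → E3} {B C : ℝ}
    (hm : HasH1Gradient m G) (hφ : HasH1Gradient φ H) (hm1 : ∀ x, ‖m x‖ = 1)
    (hmG : ∀ i x, inner ℝ (m x) (G i x) = 0) (hGC : ∀ i x, ‖G i x‖ ≤ C) (hB : ∀ x, ‖φ x‖ ≤ B)
    (hHC : ∀ i x, ‖H i x‖ ≤ C) :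
    Tendsto (fun ε => h1Norm (fun x => variation m φ ε x - m x)) (𝓝 0) (𝓝 0) := by
  have hC0 : 0 ≤ C := (norm_nonneg _).trans (hGC 0 ⟨EuclideanSpace.single 0 1, by simp⟩)
  have hB0 : 0 ≤ B := (norm_nonneg _).trans (hB ⟨EuclideanSpace.single 0 1, by simp⟩)
  obtain ⟨W, hW⟩ : ∃ W : ℝ → Fin 3 → S2 → E3, ∀ ε i x, W ε i x =
      ‖m x + ε • φ x‖⁻¹ • (G i x + ε • H i x) -
      (‖m x + ε • φ x‖⁻¹ ^ 3 * inner ℝ (m x + ε • φ x) (G i x + ε • H i x)) • (m x + ε • φ x) :=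
    ⟨_, fun _ _ _ => rfl⟩
  have hsmall : ∀ᶠ ε : ℝ in 𝓝 0, |ε| * B < 1 / 2 ∧ |ε| < 1 := by
    have h1 : Tendsto (fun ε : ℝ => |ε| * B) (𝓝 0) (𝓝 0) := by
      simpa using (continuous_abs.tendsto (0 : ℝ)).mul_const B
    have h2 : Tendsto (fun ε : ℝ => |ε|) (𝓝 0) (𝓝 0) := by
      simpa using continuous_abs.tendsto (0 : ℝ)
    exact (h1.eventually_lt_const (by norm_num)).and (h2.eventually_lt_const one_pos)
  have hgrad : ∀ ε : ℝ, |ε| * B < 1 / 2 →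
      HasH1Gradient (fun x => variation m φ ε x - m x) (fun i x => W ε i x - G i x) := fun ε hε => by
    simp only [hW]
    exact (hm.variation hφ (Eventually.of_forall hm1) (Eventually.of_forall hB) hε).sub hm
  have hev : (fun ε => h1Norm (fun x => variation m φ ε x - m x)) =ᶠ[𝓝 0] fun ε =>
      Real.sqrt (∫ x, (‖variation m φ ε x - m x‖ ^ 2 + ∑ i, ‖W ε i x - G i x‖ ^ 2) ∂surf) := by
    filter_upwards [hsmall] with ε hε using (hgrad ε hε.1).h1Norm_eq
  refine Tendsto.congr' hev.symm ?_
  rw [show (0 : ℝ) = Real.sqrt 0 by simp]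
  refine (Real.continuous_sqrt.tendsto 0).comp ?_
  have hlim := tendsto_integral_filter_of_dominated_convergence (μ := surf) (l := 𝓝 (0 : ℝ))
    (F := fun ε x => ‖variation m φ ε x - m x‖ ^ 2 + ∑ i, ‖W ε i x - G i x‖ ^ 2)
    (f := fun _ => 0) (fun _ => 2 ^ 2 + ∑ _i : Fin 3, (69 * C) ^ 2) ?_ ?_ (integrable_const _) ?_
  · simpa using hlim
  · filter_upwards [hsmall] with ε hε
    have := hgrad ε hε.1
    exact (this.1.1.norm.pow 2).add (Finset.aestronglyMeasurable_fun_sum _ fun i _ =>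
      ((this.2.1 i).1.norm.pow 2))
  · filter_upwards [hsmall] with ε hε
    refine Eventually.of_forall fun x => ?_
    have hεφ : ‖ε • φ x‖ ≤ 1 / 2 := by
      rw [norm_smul, Real.norm_eq_abs]
      nlinarith [hB x, abs_nonneg ε]
    have hεH : ∀ i, ‖ε • H i x‖ ≤ C := fun i => by
      rw [norm_smul, Real.norm_eq_abs]
      nlinarith [hHC i x, abs_nonneg ε, norm_nonneg (H i x)]
    have hvar : ‖variation m φ ε x - m x‖ ≤ 2 :=
      (norm_normalize_gradient_sub_le (hm1 x) hεφ (hGC 0 x) (hεH 0)).1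
    have hWG : ∀ i, ‖W ε i x - G i x‖ ≤ 69 * C := fun i => by
      rw [hW]
      exact (norm_normalize_gradient_sub_le (hm1 x) hεφ (hGC i x) (hεH i)).2
    have hnn : 0 ≤ ‖variation m φ ε x - m x‖ ^ 2 + ∑ i, ‖W ε i x - G i x‖ ^ 2 := by positivity
    rw [Real.norm_eq_abs, abs_of_nonneg hnn]
    gcongr
    exact hWG _
  · refine Eventually.of_forall fun x => ?_
    have hid : Tendsto (fun ε : ℝ => ε) (𝓝 0) (𝓝 0) := tendsto_id
    have ty : Tendsto (fun ε : ℝ => m x + ε • φ x) (𝓝 0) (𝓝 (m x)) := by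
      simpa using (hid.smul_const (φ x)).const_add (m x)
    have tv : ∀ i, Tendsto (fun ε : ℝ => G i x + ε • H i x) (𝓝 0) (𝓝 (G i x)) := fun i => by
      simpa using (hid.smul_const (H i x)).const_add (G i x)
    have ti : Tendsto (fun ε : ℝ => ‖m x + ε • φ x‖⁻¹) (𝓝 0) (𝓝 1) := by
      have := ty.norm.inv₀ (by rw [hm1]; exact one_ne_zero)
      rwa [hm1, inv_one] at this
    have t1 : Tendsto (fun ε => ‖variation m φ ε x - m x‖ ^ 2) (𝓝 0) (𝓝 0) := by
      have : Tendsto (fun ε => variation m φ ε x - m x) (𝓝 0) (𝓝 0) := by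
        simpa [variation] using (ti.smul ty).sub_const (m x)
      simpa using this.norm.pow 2
    have t2 : ∀ i, Tendsto (fun ε => ‖W ε i x - G i x‖ ^ 2) (𝓝 0) (𝓝 0) := by
      intro i
      have : Tendsto (fun ε => W ε i x - G i x) (𝓝 0) (𝓝 0) := by
        have := ((ti.smul (tv i)).sub (((ti.pow 3).mul (ty.inner (tv i))).smul ty)).sub_const (G i x)
        simp only [hW]
        simpa [hmG] using this
      simpa using this.norm.pow 2
    simpa using t1.add (tendsto_finsetSum Finset.univ fun i _ => t2 i)

/-- A bounded tangential direction of negative second variation rules out a local minimizer, one of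
positive second variation rules out a local maximizer. -/
lemma not_isLocalMinimizer_and_maximizer {κ : ℝ} {m φ : S2 → E3} {G H : Fin 3 → S2 → E3} {B C : ℝ}
    (hm : HasH1Gradient m G) (hφ : HasH1Gradient φ H) (hm1 : ∀ x, ‖m x‖ = 1)
    (hmG : ∀ i x, inner ℝ (m x) (G i x) = 0) (hGC : ∀ i x, ‖G i x‖ ≤ C) (hB : ∀ x, ‖φ x‖ ≤ B)
    (hHC : ∀ i x, ‖H i x‖ ≤ C) (hmφ : ∀ x, inner ℝ (m x) (φ x) = 0)
    (hmH : ∀ i x, inner ℝ (m x) (H i x) + inner ℝ (φ x) (G i x) = 0)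
    (hcrit : ∫ x, firstVariationDensity κ m φ G H x ∂surf = 0) :
    (∫ x, secondVariationDensity κ m φ G H x ∂surf < 0 → ¬ IsLocalMinimizer κ m) ∧
    (0 < ∫ x, secondVariationDensity κ m φ G H x ∂surf → ¬ IsLocalMaximizer κ m) := by
  obtain ⟨K, hK⟩ := exists_energy_variation_expansion hm hφ hm1 hmG hGC hB hHC hmφ hmH κ hcrit
  set Q := ∫ x, secondVariationDensity κ m φ G H x ∂surf
  have hlim := tendsto_h1Norm_variation_sub hm hφ hm1 hmG hGC hB hHC
  have hgood : ∀ δ > 0, Q ≠ 0 → ∃ ε : ℝ, 0 < ε ∧ MemH1Sphere (variation m φ ε) ∧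
      h1Norm (fun x => variation m φ ε x - m x) < δ ∧
      |energy κ (variation m φ ε) - energy κ m - ε ^ 2 * ((1 / 2) * Q)| < ε ^ 2 * ((1 / 2) * |Q|) := by
    intro δ hδ hQ
    have h1 : Tendsto (fun ε : ℝ => |ε| * B) (𝓝 0) (𝓝 0) := by
      simpa using (continuous_abs.tendsto (0 : ℝ)).mul_const B
    have h2 : Tendsto (fun ε : ℝ => |ε|) (𝓝 0) (𝓝 0) := by
      simpa using continuous_abs.tendsto (0 : ℝ)
    have h3 : Tendsto (fun ε : ℝ => |K| * |ε|) (𝓝 0) (𝓝 0) := by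
      simpa using h2.const_mul |K|
    have hev : ∀ᶠ ε : ℝ in 𝓝[>] 0, 0 < ε ∧ |ε| * B < 1 / 2 ∧ |ε| < 1 ∧
        |K| * |ε| < (1 / 2) * |Q| ∧ h1Norm (fun x => variation m φ ε x - m x) < δ := by
      refine eventually_mem_nhdsWithin.and (nhdsWithin_le_nhds ?_)
      exact (h1.eventually_lt_const (by norm_num)).and ((h2.eventually_lt_const one_pos).and
        ((h3.eventually_lt_const (by positivity)).and (hlim.eventually_lt_const hδ)))
    obtain ⟨ε, h0, hεB, hε1, hεK, hεδ⟩ := hev.exists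
    have hvar := hm.variation hφ (Eventually.of_forall hm1) (Eventually.of_forall hB) hεB
    refine ⟨ε, h0, ⟨⟨_, hvar⟩, Eventually.of_forall fun x => ?_⟩, hεδ, ?_⟩
    · have := add_smul_ne_zero (hm1 x) (hB x) hεB
      rw [variation, norm_smul, norm_inv, norm_norm, inv_mul_cancel₀ (norm_ne_zero_iff.2 this)]
    · refine (hK ε hε1.le hεB).trans_lt ?_
      rw [abs_of_pos h0] at hεK ⊢
      calc K * ε ^ 3 ≤ |K| * ε ^ 3 := by gcongr; exact le_abs_self K
        _ = ε ^ 2 * (|K| * ε) := by ring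
        _ < ε ^ 2 * ((1 / 2) * |Q|) := by gcongr
  constructor
  · rintro hQ ⟨δ, hδ, hmin⟩
    obtain ⟨ε, h0, hH1, hεδ, hlt⟩ := hgood δ hδ hQ.ne
    rw [abs_of_neg hQ, abs_lt] at hlt
    have := hmin _ hH1 hεδ
    linarith [hlt.2]
  · rintro hQ ⟨δ, hδ, hmax⟩
    obtain ⟨ε, h0, hH1, hεδ, hlt⟩ := hgood δ hδ hQ.ne'
    rw [abs_of_pos hQ, abs_lt] at hlt
    have := hmax _ hH1 hεδ
    linarith [hlt.1]

lemma surf_univ_pos : 0 < surf.real univ := by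
  have : surf ≠ 0 := Measure.toSphere_ne_zero _
  exact ENNReal.toReal_pos (Measure.measure_univ_ne_zero.2 this) (measure_ne_top _ _)

/-- The second moment of a coordinate on the sphere. -/
lemma integral_apply_two_sq : ∫ x : S2, (x : E3) 2 ^ 2 ∂surf = surf.real univ / 3 := by
  have hx : ∀ x : S2, HasFDerivAt (fun y : E3 => y 2) (EuclideanSpace.proj 2 : E3 →L[ℝ] ℝ) (x : E3) :=
    fun x => (EuclideanSpace.proj 2 : E3 →L[ℝ] ℝ).hasFDerivAt
  have h := integral_fderiv_tangField (f := fun y : E3 => y 2) (fun x => by fun_prop) 2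
  have h1 : ∀ x : S2, fderiv ℝ (fun y : E3 => y 2) (x : E3) (tangField 2 x) =
      1 - (x : E3) 2 ^ 2 := by
    intro x
    rw [(hx x).fderiv]
    simp [tangField]; ring
  simp_rw [h1] at h
  have c2 : Integrable (fun x : S2 => (x : E3) 2 ^ 2) surf :=
    Continuous.integrable_surf (by fun_prop)
  rw [integral_sub (integrable_const 1) c2, integral_const, smul_eq_mul, mul_one] at h
  simp_rw [← sq] at h
  linarith

/-- The fourth moment of a coordinate on the sphere. -/
lemma integral_apply_two_pow_four : ∫ x : S2, (x : E3) 2 ^ 4 ∂surf = surf.real univ / 5 := by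
  have hx : ∀ x : S2, HasFDerivAt (fun y : E3 => y 2 ^ 3) _ (x : E3) := fun x =>
    ((EuclideanSpace.proj 2 : E3 →L[ℝ] ℝ).hasFDerivAt).pow 3
  have h := integral_fderiv_tangField (f := fun y : E3 => y 2 ^ 3) (fun x => by fun_prop) 2
  have h1 : ∀ x : S2, fderiv ℝ (fun y : E3 => y 2 ^ 3) (x : E3) (tangField 2 x) =
      3 * (x : E3) 2 ^ 2 - 3 * (x : E3) 2 ^ 4 := by
    intro x
    rw [(hx x).fderiv]
    simp [tangField]; ring
  simp_rw [h1] at h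
  have c2 : Integrable (fun x : S2 => 3 * (x : E3) 2 ^ 2) surf :=
    Continuous.integrable_surf (by fun_prop)
  have c4 : Integrable (fun x : S2 => 3 * (x : E3) 2 ^ 4) surf :=
    Continuous.integrable_surf (by fun_prop)
  rw [integral_sub c2 c4, integral_const_mul, integral_const_mul, integral_apply_two_sq] at h
  have e : ∀ x : S2, (x : E3) 2 * (x : E3) 2 ^ 3 = (x : E3) 2 ^ 4 := fun x => by ring
  simp_rw [e] at h
  linarith

namespace ZonalSolution

variable {κ M δ : ℝ} {a b y a' y' : ℝ → ℝ}

/-- The second variation of the energy along the field obtained by varying the profile `h` by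
`ρ(cos θ) sin θ`, as a function of `z = cos θ`. -/
noncomputable def secondVariationProfile (κ : ℝ) (a b ρ ρ' : ℝ → ℝ) (z : ℝ) : ℝ :=
  (z * ρ z - (1 - z ^ 2) * ρ' z) ^ 2 + ρ z ^ 2 * (b z ^ 2 - (1 - z ^ 2) * a z ^ 2) -
    κ * ((1 - z ^ 2) * ρ z ^ 2 * ((1 - z ^ 2) * (b z - z * a z) ^ 2 -
      ((1 - z ^ 2) * a z + z * b z) ^ 2))

lemma not_isLocalMinimizer_and_maximizer (h : ZonalSolution κ a b y a' y' M) {ρ ρ' : ℝ → ℝ}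
    (hρ : ∀ z, HasDerivAt ρ (ρ' z) z) (hρ' : Continuous ρ')
    (hρ1 : ∀ z ∈ Icc (-1 : ℝ) 1, |ρ z| ≤ 1) (hρ'1 : ∀ z ∈ Icc (-1 : ℝ) 1, |ρ' z| ≤ 1) :
    (∫ x : S2, secondVariationProfile κ a b ρ ρ' ((x : E3) 2) ∂surf < 0 →
      ¬ IsLocalMinimizer κ (zonalMap a b)) ∧
    (0 < ∫ x : S2, secondVariationProfile κ a b ρ ρ' ((x : E3) 2) ∂surf →
      ¬ IsLocalMaximizer κ (zonalMap a b)) := by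
  have hM := h.one_le
  have hM2 : M ≤ M ^ 2 := by nlinarith
  have hρc : Continuous ρ := continuous_iff_continuousAt.2 fun z => (hρ z).continuousAt
  have ca := h.continuousOn_a
  have cb := h.continuousOn_b
  have cy := h.continuousOn_y
  have hmul1 : ∀ {u v K : ℝ}, |u| ≤ 1 → |v| ≤ K → |u * v| ≤ K := fun {u v K} hu hv => by
    rw [abs_mul]; nlinarith [abs_nonneg u, abs_nonneg v]
  have hq : ∀ z ∈ Icc (-1 : ℝ) 1, |1 - z ^ 2| ≤ 1 := fun z hz => by
    rw [abs_of_nonneg (one_sub_sq_mem hz).1]; exact (one_sub_sq_mem hz).2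
  have hay : ∀ z ∈ Icc (-1 : ℝ) 1, |a z * y z| ≤ M ^ 2 := fun z hz => by
    rw [abs_mul, sq]
    exact mul_le_mul (h.abs_a_le z hz) (h.abs_y_le z hz) (abs_nonneg _) (by linarith)
  have hφ : ZonalData (fun z => ρ z * b z) (fun z => -((1 - z ^ 2) * (ρ z * a z)))
      (fun z => ρ' z * b z + ρ z * (a z * y z))
      (fun z => z * (ρ z * a z) - (1 - z ^ 2) * (ρ' z * a z) + ρ z * (b z * y z)) (3 * M ^ 2) := by
    refine ⟨fun z hz => (hρ z).mul (h.hasDerivAt_b z hz), fun z hz => ?_, by fun_prop, by fun_prop,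
      fun z hz => ?_, fun z hz => ?_, fun z hz => ?_, fun z hz => ?_⟩
    · have : HasDerivAt (fun z => -((1 - z ^ 2) * (ρ z * a z))) _ z :=
        ((((hasDerivAt_id z).pow 2).const_sub 1).mul ((hρ z).mul (h.hasDerivAt_a z hz))).neg
      refine this.congr_deriv ?_
      simp only [Pi.mul_apply, Pi.pow_apply, id]
      linear_combination -ρ z * h.a'_eq z hz
    · linarith [hmul1 (hρ1 z hz) (h.abs_b_le hz)]
    · rw [abs_neg]
      linarith [hmul1 (hq z hz) (hmul1 (hρ1 z hz) (h.abs_a_le z hz))]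
    · have h1 := hmul1 (hρ'1 z hz) (h.abs_b_le hz)
      have h2 := hmul1 (hρ1 z hz) (hay z hz)
      linarith [abs_add_le (ρ' z * b z) (ρ z * (a z * y z))]
    · have h1 := hmul1 (abs_le.2 hz) (hmul1 (hρ1 z hz) (h.abs_a_le z hz))
      have h2 := hmul1 (hq z hz) (hmul1 (hρ'1 z hz) (h.abs_a_le z hz))
      have h3 := hmul1 (hρ1 z hz) (hmul1 (h.abs_b_le hz) (h.abs_y_le z hz))
      rw [abs_le] at *
      constructor <;> linarith
  have key := SphereSaddle.not_isLocalMinimizer_and_maximizer (κ := κ) (B := 3 * (3 * M ^ 2))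
    (C := 10 * (3 * M ^ 2))
    h.zonalData.hasH1Gradient hφ.hasH1Gradient h.norm_zonalMap h.inner_zonalMap_zonalGrad
    (fun i x => (h.zonalData.norm_zonalGrad_le i x).trans (by nlinarith)) (fun x => ?_)
    hφ.norm_zonalGrad_le (fun x => ?_) (fun i x => ?_)
    (h.integral_firstVariationDensity hφ.hasH1Gradient)
  · have hae : ∀ᵐ x ∂surf, secondVariationDensity κ (zonalMap a b)
        (zonalMap (fun z => ρ z * b z) (fun z => -((1 - z ^ 2) * (ρ z * a z))))
        (zonalGrad a a' (fun z => a z * y z)) (zonalGrad (fun z => ρ z * b z)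
          (fun z => ρ' z * b z + ρ z * (a z * y z))
          (fun z => z * (ρ z * a z) - (1 - z ^ 2) * (ρ' z * a z) + ρ z * (b z * y z))) x =
        secondVariationProfile κ a b ρ ρ' ((x : E3) 2) := by
      filter_upwards [ae_apply_two_mem_Ioo] with x hx
      have e3 := h.sq_add_sq _ (Ioo_subset_Icc_self hx)
      rw [secondVariationDensity, Finset.sum_sub_distrib, ← Finset.sum_mul,
        h.sum_norm_zonalGrad_sq hx]
      simp only [zonalGrad, zonalMap]
      rw [sum_norm_zonalDir_sq, ← real_inner_self_eq_norm_sq, inner_zonalPt, inner_zonalPt_self,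
        inner_zonalPt_self, secondVariationProfile]
      set z := (x : E3) 2
      have hb2 : b z ^ 2 = 1 - (1 - z ^ 2) * a z ^ 2 := by linarith
      have n1 : (1 - z ^ 2) * (ρ z * b z) * (ρ z * b z) +
          -((1 - z ^ 2) * (ρ z * a z)) * -((1 - z ^ 2) * (ρ z * a z)) = (1 - z ^ 2) * ρ z ^ 2 := by
        linear_combination (1 - z ^ 2) * ρ z ^ 2 * e3
      have n2 : ((1 - z ^ 2) * (ρ' z * b z + ρ z * (a z * y z)) - z * (ρ z * b z)) ^ 2 +
          (ρ z * b z) ^ 2 + (1 - z ^ 2) * (z * (ρ z * a z) - (1 - z ^ 2) * (ρ' z * a z) +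
            ρ z * (b z * y z)) ^ 2 = (z * ρ z - (1 - z ^ 2) * ρ' z) ^ 2 + ρ z ^ 2 * b z ^ 2 +
            (1 - z ^ 2) * ρ z ^ 2 * y z ^ 2 := by
        linear_combination ((z * ρ z - (1 - z ^ 2) * ρ' z) ^ 2 +
          (1 - z ^ 2) * ρ z ^ 2 * y z ^ 2) * e3
      rw [n1, n2]
      ring
    rwa [integral_congr_ae hae] at key
  · refine (norm_zonalPt_le x _ _).trans ?_
    have h1 := hφ.abs_a_le _ (x.apply_mem_Icc 2)
    have h2 := hφ.abs_b_le _ (x.apply_mem_Icc 2)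
    linarith
  · simp only [zonalMap]
    rw [inner_zonalPt]
    ring
  · simp only [zonalMap, zonalGrad]
    rw [inner_zonalPt_zonalDir, inner_zonalPt_zonalDir]
    rcases mem_Ioo_or_tangField_eq_zero x i with hx | hx
    · linear_combination (tangField i x 2 * (ρ ((x : E3) 2) * b ((x : E3) 2))) * h.a'_eq _ hx
    · rw [hx]; ring

/-- If `cos 2h` and `cos (2h - 2θ)` are close to their values for `h = 2θ`, and `κ` is close to `4`,
then the second variation is negative for `ρ = 1` and positive for `ρ = z`. -/
lemma isSaddlePoint (h : ZonalSolution κ a b y a' y' M) (hκ : |κ - 4| ≤ 1 / 20) (hδ0 : 0 ≤ δ)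
    (hδ : δ ≤ 1 / 50)
    (h1 : ∀ z ∈ Ioo (-1 : ℝ) 1, |b z ^ 2 - (1 - z ^ 2) * a z ^ 2 - (8 * z ^ 4 - 8 * z ^ 2 + 1)| ≤ δ)
    (h2 : ∀ z ∈ Ioo (-1 : ℝ) 1, |((1 - z ^ 2) * a z + z * b z) ^ 2 -
      (1 - z ^ 2) * (b z - z * a z) ^ 2 - (2 * z ^ 2 - 1)| ≤ δ) :
    IsSaddlePoint κ (zonalMap a b) := by
  have hκ' := abs_le.1 hκ
  have hS := surf_univ_pos
  -- Comparison with the second variation at `h = 2θ`, `κ = 4`.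
  have hcmp : ∀ {ρ ρ' : ℝ → ℝ} {p : ℝ → ℝ}, (∀ z, HasDerivAt ρ (ρ' z) z) → Continuous ρ' →
      (∀ z ∈ Icc (-1 : ℝ) 1, |ρ z| ≤ 1) → Continuous p →
      (∀ z, p z = (z * ρ z - (1 - z ^ 2) * ρ' z) ^ 2 + ρ z ^ 2 * (8 * z ^ 4 - 8 * z ^ 2 + 1) +
        4 * ((1 - z ^ 2) * ρ z ^ 2 * (2 * z ^ 2 - 1))) →
      |(∫ x : S2, secondVariationProfile κ a b ρ ρ' ((x : E3) 2) ∂surf) -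
        ∫ x : S2, p ((x : E3) 2) ∂surf| ≤ 1 / 5 * surf.real univ := by
    intro ρ ρ' p hρ hρ' hρ1 hp hpe
    have hpt : ∀ᵐ x : S2 ∂surf, ‖secondVariationProfile κ a b ρ ρ' ((x : E3) 2) -
        p ((x : E3) 2)‖ ≤ 1 / 5 := by
      filter_upwards [ae_apply_two_mem_Ioo] with x hx
      rw [hpe, secondVariationProfile, Real.norm_eq_abs]
      have g1 := h1 _ hx
      have g2 := h2 _ hx
      have hzI := Ioo_subset_Icc_self hx
      have g3 := hρ1 _ hzI
      obtain ⟨g4, g5⟩ := one_sub_sq_mem hzI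
      set z := (x : E3) 2
      set A := b z ^ 2 - (1 - z ^ 2) * a z ^ 2 - (8 * z ^ 4 - 8 * z ^ 2 + 1)
      set D := ((1 - z ^ 2) * a z + z * b z) ^ 2 - (1 - z ^ 2) * (b z - z * a z) ^ 2 -
        (2 * z ^ 2 - 1)
      have hr0 : 0 ≤ ρ z ^ 2 := sq_nonneg _
      have hr1 : ρ z ^ 2 ≤ 1 := by rw [← sq_abs]; nlinarith [abs_nonneg (ρ z)]
      have hq0 : 0 ≤ (1 - z ^ 2) * ρ z ^ 2 := mul_nonneg g4 hr0
      have hq1 : (1 - z ^ 2) * ρ z ^ 2 ≤ 1 := by nlinarith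
      have b1 : |ρ z ^ 2 * A| ≤ 1 / 50 := by
        rw [abs_mul, abs_of_nonneg hr0]; nlinarith [abs_nonneg A]
      have b2 : |(1 - z ^ 2) * ρ z ^ 2 * D| ≤ 1 / 50 := by
        rw [abs_mul, abs_of_nonneg hq0]; nlinarith [abs_nonneg D]
      have b3 : |(κ - 4) * ((1 - z ^ 2) * ρ z ^ 2 * (2 * z ^ 2 - 1))| ≤ 1 / 20 := by
        rw [abs_mul, abs_mul, abs_of_nonneg hq0]
        have : |2 * z ^ 2 - 1| ≤ 1 := abs_le.2 ⟨by nlinarith, by nlinarith⟩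
        have : (1 - z ^ 2) * ρ z ^ 2 * |2 * z ^ 2 - 1| ≤ 1 := by
          nlinarith [abs_nonneg (2 * z ^ 2 - 1)]
        nlinarith [abs_nonneg (κ - 4)]
      have b4 : |κ * ((1 - z ^ 2) * ρ z ^ 2 * D)| ≤ 5 * (1 / 50) := by
        rw [abs_mul, abs_of_pos (by linarith)]
        exact mul_le_mul (by linarith) b2 (abs_nonneg _) (by norm_num)
      have e : (z * ρ z - (1 - z ^ 2) * ρ' z) ^ 2 + ρ z ^ 2 * (b z ^ 2 - (1 - z ^ 2) * a z ^ 2) -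
          κ * ((1 - z ^ 2) * ρ z ^ 2 * ((1 - z ^ 2) * (b z - z * a z) ^ 2 -
            ((1 - z ^ 2) * a z + z * b z) ^ 2)) -
          ((z * ρ z - (1 - z ^ 2) * ρ' z) ^ 2 + ρ z ^ 2 * (8 * z ^ 4 - 8 * z ^ 2 + 1) +
          4 * ((1 - z ^ 2) * ρ z ^ 2 * (2 * z ^ 2 - 1))) =
          ρ z ^ 2 * A + κ * ((1 - z ^ 2) * ρ z ^ 2 * D) +
            (κ - 4) * ((1 - z ^ 2) * ρ z ^ 2 * (2 * z ^ 2 - 1)) := by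
        simp only [A, D]; ring
      rw [e]
      rw [abs_le] at *
      constructor <;> linarith
    have hpi : Integrable (fun x : S2 => p ((x : E3) 2)) surf :=
      Continuous.integrable_surf (hp.comp (by fun_prop))
    have hmeas : AEStronglyMeasurable (fun x : S2 =>
        secondVariationProfile κ a b ρ ρ' ((x : E3) 2)) surf := by
      have hρc : Continuous ρ := continuous_iff_continuousAt.2 fun z => (hρ z).continuousAt
      have ca := h.continuousOn_a
      have cb := h.continuousOn_b
      have hc : ContinuousOn (secondVariationProfile κ a b ρ ρ') (Ioo (-1) 1) := by
        unfold secondVariationProfile; fun_prop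
      refine aestronglyMeasurable_of_tendsto_ae atTop
        (f := fun n (x : S2) => secondVariationProfile κ a b ρ ρ' (dil n * (x : E3) 2))
        (fun n => Continuous.aestronglyMeasurable ?_) ?_
      · exact hc.comp_continuous (by fun_prop) fun x => dil_mul_mem (x.apply_mem_Icc 2)
      · filter_upwards [ae_apply_two_mem_Ioo] with x hx
        exact tendsto_comp_dil (hc.continuousAt (isOpen_Ioo.mem_nhds hx))
    have hdi : Integrable (fun x : S2 => secondVariationProfile κ a b ρ ρ' ((x : E3) 2) -
        p ((x : E3) 2)) surf :=
      (integrable_const (1 / 5 : ℝ)).mono' (hmeas.sub hpi.1) hpt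
    have hsi : Integrable (fun x : S2 => secondVariationProfile κ a b ρ ρ' ((x : E3) 2)) surf := by
      refine (hdi.add hpi).congr (Eventually.of_forall fun x => ?_)
      simp
    rw [← integral_sub hsi hpi, ← Real.norm_eq_abs]
    exact norm_integral_le_of_norm_le_const hpt
  have c2 : ∀ c : ℝ, Integrable (fun x : S2 => c * (x : E3) 2 ^ 2) surf := fun c =>
    Continuous.integrable_surf (by fun_prop)
  have c4 : ∀ c : ℝ, Integrable (fun x : S2 => c * (x : E3) 2 ^ 4) surf := fun c =>
    Continuous.integrable_surf (by fun_prop)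
  refine ⟨h.isCriticalPoint, ?_, ?_⟩
  · refine (h.not_isLocalMinimizer_and_maximizer (ρ := fun _ => 1) (ρ' := fun _ => 0)
      (fun z => hasDerivAt_const _ _) continuous_const (fun z _ => by simp) fun z _ => by simp).1 ?_
    have := hcmp (ρ := fun _ => 1) (ρ' := fun _ => 0) (p := fun z => 5 * z ^ 2 - 3)
      (fun z => hasDerivAt_const _ _) continuous_const (fun z _ => by simp) (by fun_prop)
      fun z => by ring
    rw [integral_sub (c2 5) (integrable_const 3), integral_const_mul, integral_apply_two_sq,
      integral_const, smul_eq_mul] at this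
    linarith [(abs_le.1 this).2]
  · refine (h.not_isLocalMinimizer_and_maximizer (ρ := fun z => z) (ρ' := fun _ => 1)
      (fun z => hasDerivAt_id _) continuous_const (fun z hz => abs_le.2 hz) fun z _ => by simp).2 ?_
    have := hcmp (ρ := fun z => z) (ρ' := fun _ => 1) (p := fun z => 8 * z ^ 4 - 7 * z ^ 2 + 1)
      (fun z => hasDerivAt_id _) continuous_const (fun z hz => abs_le.2 hz) (by fun_prop)
      fun z => by ring
    have c42 : Integrable (fun x : S2 => 8 * (x : E3) 2 ^ 4 - 7 * (x : E3) 2 ^ 2) surf :=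
      (c4 8).sub (c2 7)
    rw [integral_add c42 (integrable_const 1), integral_sub (c4 8) (c2 7), integral_const_mul,
      integral_const_mul, integral_apply_two_sq, integral_apply_two_pow_four,
      integral_const, smul_eq_mul] at this
    linarith [(abs_le.1 this).1]

end ZonalSolution

/-! ### The Green operator of the linearized profile equation -/

/-- Bounded continuous functions of `z = cos θ` on the upper half `0 < z < 1` of the sphere. -/
abbrev HalfFun : Type := BoundedContinuousFunction (Ioo (0 : ℝ) 1) ℝ

/-- The odd function `γ(z) = z v(|z|)` on `(-1, 1)`, extended by zero. -/
noncomputable def oddExt (v : HalfFun) (z : ℝ) : ℝ :=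
  z * Function.extend Subtype.val v 0 |z|

lemma extend_of_mem (v : HalfFun) {z : ℝ} (hz : z ∈ Ioo (0 : ℝ) 1) :
    Function.extend Subtype.val v 0 z = v ⟨z, hz⟩ :=
  Subtype.val_injective.extend_apply v 0 ⟨z, hz⟩

lemma extend_of_notMem (v : HalfFun) {z : ℝ} (hz : z ∉ Ioo (0 : ℝ) 1) :
    Function.extend Subtype.val v 0 z = 0 :=
  Function.extend_apply' _ _ _ fun ⟨t, ht⟩ => hz (ht ▸ t.2)

lemma abs_extend_le (v : HalfFun) (z : ℝ) : |Function.extend Subtype.val v 0 z| ≤ ‖v‖ := by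
  by_cases hz : z ∈ Ioo (0 : ℝ) 1
  · rw [extend_of_mem v hz]; exact v.norm_coe_le_norm _
  · rw [extend_of_notMem v hz]; simp

lemma oddExt_of_mem (v : HalfFun) {z : ℝ} (hz : z ∈ Ioo (0 : ℝ) 1) :
    oddExt v z = z * v ⟨z, hz⟩ := by
  have hz' : |z| = z := abs_of_pos hz.1
  rw [oddExt, hz', extend_of_mem v hz]

lemma oddExt_neg (v : HalfFun) (z : ℝ) : oddExt v (-z) = -oddExt v z := by
  simp [oddExt]

lemma abs_oddExt_le (v : HalfFun) (z : ℝ) : |oddExt v z| ≤ |z| * ‖v‖ := by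
  rw [oddExt, abs_mul]
  exact mul_le_mul_of_nonneg_left (abs_extend_le v _) (abs_nonneg _)

lemma abs_oddExt_le_norm (v : HalfFun) (z : ℝ) : |oddExt v z| ≤ ‖v‖ := by
  by_cases hz : |z| ∈ Ioo (0 : ℝ) 1
  · nlinarith [abs_oddExt_le v z, hz.2, norm_nonneg v]
  · rw [oddExt, extend_of_notMem v hz]; simp

lemma measurable_oddExt (v : HalfFun) : Measurable (oddExt v) := by
  have : Measurable (Function.extend Subtype.val v (0 : ℝ → ℝ)) :=
    (MeasurableEmbedding.subtype_coe measurableSet_Ioo).measurable_extend v.continuous.measurable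
      measurable_zero
  exact measurable_id.mul (this.comp measurable_abs)

lemma continuousOn_extend (v : HalfFun) :
    ContinuousOn (Function.extend Subtype.val v (0 : ℝ → ℝ)) (Ioo 0 1) := by
  rw [continuousOn_iff_continuous_domRestrict]
  convert v.continuous using 1
  ext z
  exact extend_of_mem v z.2

lemma continuousAt_oddExt (v : HalfFun) {z : ℝ} (hz : z ∈ Ioo (-1 : ℝ) 1) :
    ContinuousAt (oddExt v) z := by
  by_cases h0 : z = 0
  · subst h0
    have h : Tendsto (oddExt v) (𝓝 0) (𝓝 0) := by
      refine squeeze_zero_norm (fun z => abs_oddExt_le v z) ?_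
      simpa using (continuous_abs.tendsto (0 : ℝ)).mul_const ‖v‖
    have h2 : oddExt v 0 = 0 := by simp [oddExt]
    rw [ContinuousAt, h2]
    exact h
  · have hz' : |z| ∈ Ioo (0 : ℝ) 1 := ⟨abs_pos.2 h0, abs_lt.2 hz⟩
    exact continuousAt_id.mul (((continuousOn_extend v).continuousAt
      (isOpen_Ioo.mem_nhds hz')).comp continuous_abs.continuousAt)

lemma oddExt_add (v u : HalfFun) (z : ℝ) : oddExt (v + u) z = oddExt v z + oddExt u z := by
  by_cases hz : |z| ∈ Ioo (0 : ℝ) 1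
  · rw [oddExt, oddExt, oddExt, extend_of_mem _ hz, extend_of_mem _ hz, extend_of_mem _ hz]
    exact mul_add _ _ _
  · rw [oddExt, oddExt, oddExt, extend_of_notMem _ hz, extend_of_notMem _ hz, extend_of_notMem _ hz]
    ring

lemma oddExt_smul (c : ℝ) (v : HalfFun) (z : ℝ) : oddExt (c • v) z = c * oddExt v z := by
  by_cases hz : |z| ∈ Ioo (0 : ℝ) 1
  · rw [oddExt, oddExt, extend_of_mem _ hz, extend_of_mem _ hz]
    exact mul_left_comm _ _ _
  · rw [oddExt, oddExt, extend_of_notMem _ hz, extend_of_notMem _ hz]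
    ring

lemma intervalIntegrable_mul_oddExt {f : ℝ → ℝ} (hf : Continuous f) (v : HalfFun) (s t : ℝ) :
    IntervalIntegrable (fun c => f c * oddExt v c) volume s t := by
  have h : IntervalIntegrable (oddExt v) volume s t := by
    refine (intervalIntegrable_const (c := ‖v‖)).mono_fun
      (measurable_oddExt v).aestronglyMeasurable (Eventually.of_forall fun c => ?_)
    rw [norm_norm]
    exact abs_oddExt_le_norm v c
  exact h.continuousOn_mul hf.continuousOn

lemma hasDerivAt_integral_mul_oddExt {f : ℝ → ℝ} (hf : Continuous f) (v : HalfFun) (s : ℝ) {z : ℝ}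
    (hz : z ∈ Ioo (-1 : ℝ) 1) :
    HasDerivAt (fun z => ∫ c in s..z, f c * oddExt v c) (f z * oddExt v z) z :=
  intervalIntegral.integral_hasDerivAt_right (intervalIntegrable_mul_oddExt hf v s z)
    (hf.measurable.mul (measurable_oddExt v)).stronglyMeasurable.stronglyMeasurableAtFilter
    (hf.continuousAt.mul (continuousAt_oddExt v hz))

/-- The integral `½ ∫_z^1 (1 - c) γ(c) dc`. -/
noncomputable def greenA (v : HalfFun) (z : ℝ) : ℝ := (1 / 2) * ∫ c in z..1, (1 - c) * oddExt v c

/-- The integral `½ ∫_{-1}^z (1 + c) γ(c) dc`. -/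
noncomputable def greenB (v : HalfFun) (z : ℝ) : ℝ :=
  (1 / 2) * ∫ c in (-1)..z, (1 + c) * oddExt v c

/-- The solution `w` of `(1 - z²) w'' - 4 z w' - 2 w = -γ` that is bounded at the poles. -/
noncomputable def greenW (v : HalfFun) (z : ℝ) : ℝ :=
  greenA v z / (1 - z) + greenB v z / (1 + z)

/-- The derivative of `greenW v`. -/
noncomputable def greenW' (v : HalfFun) (z : ℝ) : ℝ :=
  greenA v z / (1 - z) ^ 2 - greenB v z / (1 + z) ^ 2

/-- The function `z w - (1 - z²) w'`, which at `z = cos θ` is the derivative of `sin θ w(cos θ)`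
with respect to `θ`. -/
noncomputable def greenD (v : HalfFun) (z : ℝ) : ℝ :=
  greenB v z / (1 + z) - greenA v z / (1 - z)

lemma greenA_neg (v : HalfFun) (z : ℝ) : greenA v (-z) = -greenB v z := by
  have h := intervalIntegral.integral_comp_neg (a := -z) (b := 1)
    (fun c => (1 + c) * oddExt v c)
  rw [neg_neg] at h
  rw [greenA, greenB, ← h, ← mul_neg, ← intervalIntegral.integral_neg]
  congr 2
  ext c
  rw [oddExt_neg]
  ring

lemma greenB_neg (v : HalfFun) (z : ℝ) : greenB v (-z) = -greenA v z := by
  rw [eq_neg_iff_add_eq_zero, ← neg_eq_zero, neg_add_rev, ← greenA_neg, neg_neg]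
  ring

lemma greenW_neg (v : HalfFun) (z : ℝ) : greenW v (-z) = -greenW v z := by
  rw [greenW, greenW, greenA_neg, greenB_neg]
  ring

lemma greenB_eq (v : HalfFun) (z : ℝ) :
    greenB v z = -greenA v z + ∫ c in (0 : ℝ)..z, c * oddExt v c := by
  have h0 := greenA_neg v 0
  rw [neg_zero] at h0
  have i1 := fun s t => intervalIntegrable_mul_oddExt (f := fun c => 1 - c) (by fun_prop) v s t
  have i2 := fun s t => intervalIntegrable_mul_oddExt (f := fun c => 1 + c) (by fun_prop) v s t
  have hA : greenA v 0 = (1 / 2) * (∫ c in (0 : ℝ)..z, (1 - c) * oddExt v c) + greenA v z := by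
    rw [greenA, greenA, ← mul_add, intervalIntegral.integral_add_adjacent_intervals (i1 _ _) (i1 _ _)]
  have hB : greenB v z = greenB v 0 + (1 / 2) * ∫ c in (0 : ℝ)..z, (1 + c) * oddExt v c := by
    rw [greenB, greenB, ← mul_add, intervalIntegral.integral_add_adjacent_intervals (i2 _ _) (i2 _ _)]
  have hI : ∫ c in (0 : ℝ)..z, c * oddExt v c =
      (1 / 2) * (∫ c in (0 : ℝ)..z, (1 + c) * oddExt v c) -
      (1 / 2) * ∫ c in (0 : ℝ)..z, (1 - c) * oddExt v c := by
    rw [← mul_sub, ← intervalIntegral.integral_sub (i2 _ _) (i1 _ _),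
      ← intervalIntegral.integral_const_mul]
    congr 1
    ext c
    ring
  linarith

lemma abs_greenA_le (v : HalfFun) (z : ℝ) : |greenA v z| ≤ (1 / 2) * (‖v‖ * (1 - z) ^ 2) := by
  rw [greenA, abs_mul, abs_of_pos (by norm_num : (0 : ℝ) < 1 / 2)]
  refine mul_le_mul_of_nonneg_left ?_ (by norm_num)
  have := intervalIntegral.norm_integral_le_of_norm_le_const (a := z) (b := 1)
    (C := |1 - z| * ‖v‖) (f := fun c => (1 - c) * oddExt v c) fun c hc => by
      rw [norm_mul, Real.norm_eq_abs, Real.norm_eq_abs]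
      refine mul_le_mul ?_ (abs_oddExt_le_norm v c) (abs_nonneg _) (abs_nonneg _)
      have := abs_sub_right_of_mem_uIcc (uIoc_subset_uIcc hc)
      rwa [abs_sub_comm] at this ⊢
  calc |∫ c in z..1, (1 - c) * oddExt v c| ≤ |1 - z| * ‖v‖ * |1 - z| := this
    _ = ‖v‖ * |1 - z| ^ 2 := by ring
    _ = ‖v‖ * (1 - z) ^ 2 := by rw [sq_abs]

lemma abs_greenB_le (v : HalfFun) (z : ℝ) : |greenB v z| ≤ (1 / 2) * (‖v‖ * (1 + z) ^ 2) := by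
  have := abs_greenA_le v (-z)
  rwa [greenA_neg, abs_neg, sub_neg_eq_add] at this

lemma hasDerivAt_greenA (v : HalfFun) {z : ℝ} (hz : z ∈ Ioo (-1 : ℝ) 1) :
    HasDerivAt (greenA v) (-(1 / 2) * ((1 - z) * oddExt v z)) z := by
  have h := (hasDerivAt_integral_mul_oddExt (f := fun c => 1 - c) (by fun_prop) v 1 hz).const_mul
    (-(1 / 2))
  refine h.congr_of_eventuallyEq (Eventually.of_forall fun t => ?_)
  rw [greenA, intervalIntegral.integral_symm]
  ring

lemma hasDerivAt_greenB (v : HalfFun) {z : ℝ} (hz : z ∈ Ioo (-1 : ℝ) 1) :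
    HasDerivAt (greenB v) ((1 / 2) * ((1 + z) * oddExt v z)) z :=
  (hasDerivAt_integral_mul_oddExt (f := fun c => 1 + c) (by fun_prop) v (-1) hz).const_mul (1 / 2)

lemma continuous_greenB (v : HalfFun) : Continuous (greenB v) :=
  continuous_const.mul (intervalIntegral.continuous_primitive
    (fun s t => intervalIntegrable_mul_oddExt (f := fun c => 1 + c) (by fun_prop) v s t) _)

lemma continuous_greenA (v : HalfFun) : Continuous (greenA v) := by
  have : greenA v = fun z => -greenB v (-z) := by
    ext z; rw [greenB_neg, neg_neg]
  rw [this]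
  exact ((continuous_greenB v).comp continuous_neg).neg

/-- A quotient `F / d` with `F = O(d²)` extends continuously by zero to the zeros of `d`, in
accordance with the convention `F / 0 = 0`. -/
lemma continuous_div_of_abs_le_sq {F d : ℝ → ℝ} {K : ℝ} (hF : Continuous F) (hd : Continuous d)
    (h : ∀ z, |F z| ≤ K * d z ^ 2) : Continuous fun z => F z / d z := by
  rw [continuous_iff_continuousAt]
  intro z
  by_cases h0 : d z = 0
  · have hb : ∀ t, ‖F t / d t‖ ≤ K * |d t| := by
      intro t
      rw [Real.norm_eq_abs, abs_div]
      by_cases ht : d t = 0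
      · simp [ht]
      · rw [div_le_iff₀ (abs_pos.2 ht), mul_assoc, ← sq, sq_abs]
        exact h t
    have ht : Tendsto (fun t => K * |d t|) (𝓝 z) (𝓝 0) := by
      have hc : Continuous fun t => K * |d t| := by fun_prop
      have := hc.tendsto z
      simpa [h0] using this
    rw [ContinuousAt, h0, div_zero]
    exact squeeze_zero_norm hb ht
  · exact hF.continuousAt.div hd.continuousAt h0

lemma continuous_greenA_div (v : HalfFun) : Continuous fun z => greenA v z / (1 - z) :=
  continuous_div_of_abs_le_sq (K := (1 / 2) * ‖v‖) (continuous_greenA v) (by fun_prop) fun z => by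
    rw [mul_assoc]; exact abs_greenA_le v z

lemma continuous_greenB_div (v : HalfFun) : Continuous fun z => greenB v z / (1 + z) :=
  continuous_div_of_abs_le_sq (K := (1 / 2) * ‖v‖) (continuous_greenB v) (by fun_prop) fun z => by
    rw [mul_assoc]; exact abs_greenB_le v z

lemma continuous_greenW (v : HalfFun) : Continuous (greenW v) :=
  (continuous_greenA_div v).add (continuous_greenB_div v)

lemma continuous_greenD (v : HalfFun) : Continuous (greenD v) :=
  (continuous_greenB_div v).sub (continuous_greenA_div v)

lemma abs_div_le_of_abs_le_sq {F d K : ℝ} (hd : 0 ≤ d) (hK : 0 ≤ K) (h : |F| ≤ K * d ^ 2) :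
    |F / d| ≤ K * d ∧ |F / d ^ 2| ≤ K := by
  rcases hd.eq_or_lt with h0 | h0
  · simp [← h0, hK]
  · rw [abs_div, abs_div, abs_of_pos h0, abs_of_pos (pow_pos h0 2), div_le_iff₀ h0,
      div_le_iff₀ (pow_pos h0 2)]
    exact ⟨by linarith, h⟩

lemma abs_green_le (v : HalfFun) {z : ℝ} (hz : z ∈ Icc (-1 : ℝ) 1) :
    |greenW v z| ≤ ‖v‖ ∧ |greenD v z| ≤ ‖v‖ ∧ |greenW' v z| ≤ ‖v‖ := by
  have hK : 0 ≤ (1 / 2) * ‖v‖ := by positivity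
  obtain ⟨a1, a2⟩ := abs_div_le_of_abs_le_sq (F := greenA v z) (d := 1 - z) (by linarith [hz.2]) hK
    (by rw [mul_assoc]; exact abs_greenA_le v z)
  obtain ⟨b1, b2⟩ := abs_div_le_of_abs_le_sq (F := greenB v z) (d := 1 + z) (by linarith [hz.1]) hK
    (by rw [mul_assoc]; exact abs_greenB_le v z)
  refine ⟨?_, ?_, ?_⟩
  · exact (abs_add_le _ _).trans (by linarith)
  · exact (abs_sub _ _).trans (by linarith)
  · exact (abs_sub _ _).trans (by linarith)

lemma hasDerivAt_greenW (v : HalfFun) {z : ℝ} (hz : z ∈ Ioo (-1 : ℝ) 1) :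
    HasDerivAt (greenW v) (greenW' v z) z := by
  have h1 : 1 - z ≠ 0 := by linarith [hz.2]
  have h2 : 1 + z ≠ 0 := by linarith [hz.1]
  have := ((hasDerivAt_greenA v hz).div ((hasDerivAt_id z).const_sub 1) h1).add
    ((hasDerivAt_greenB v hz).div ((hasDerivAt_id z).const_add 1) h2)
  refine HasDerivAt.congr_deriv this ?_
  simp only [id, greenW']
  field_simp
  ring

lemma greenD_eq (v : HalfFun) {z : ℝ} (hz : z ∈ Ioo (-1 : ℝ) 1) :
    greenD v z = z * greenW v z - (1 - z ^ 2) * greenW' v z := by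
  have h1 : 1 - z ≠ 0 := by linarith [hz.2]
  have h2 : 1 + z ≠ 0 := by linarith [hz.1]
  simp only [greenD, greenW, greenW']
  field_simp
  ring

/-- This is the equation `(1 - z²) w'' - 4 z w' - 2 w = -γ`. -/
lemma hasDerivAt_greenD (v : HalfFun) {z : ℝ} (hz : z ∈ Ioo (-1 : ℝ) 1) :
    HasDerivAt (greenD v) (oddExt v z - greenW v z - z * greenW' v z) z := by
  have h1 : 1 - z ≠ 0 := by linarith [hz.2]
  have h2 : 1 + z ≠ 0 := by linarith [hz.1]
  have := ((hasDerivAt_greenB v hz).div ((hasDerivAt_id z).const_add 1) h2).sub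
    ((hasDerivAt_greenA v hz).div ((hasDerivAt_id z).const_sub 1) h1)
  refine HasDerivAt.congr_deriv this ?_
  simp only [id, greenW, greenW']
  field_simp
  ring

lemma continuousOn_greenW' (v : HalfFun) : ContinuousOn (greenW' v) (Ioo (-1) 1) := by
  have ca := continuous_greenA v
  have cb := continuous_greenB v
  refine ContinuousOn.sub (ContinuousOn.div (by fun_prop) (by fun_prop) fun z hz => ?_)
    (ContinuousOn.div (by fun_prop) (by fun_prop) fun z hz => ?_)
  · exact pow_ne_zero 2 (by linarith [hz.2])
  · exact pow_ne_zero 2 (by linarith [hz.1])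

lemma greenA_add (v u : HalfFun) (z : ℝ) : greenA (v + u) z = greenA v z + greenA u z := by
  rw [greenA, greenA, greenA, ← mul_add, ← intervalIntegral.integral_add
    (intervalIntegrable_mul_oddExt (by fun_prop) v _ _)
    (intervalIntegrable_mul_oddExt (by fun_prop) u _ _)]
  simp only [oddExt_add, mul_add]

lemma greenA_smul (c : ℝ) (v : HalfFun) (z : ℝ) : greenA (c • v) z = c * greenA v z := by
  rw [greenA, greenA]
  simp only [oddExt_smul, mul_left_comm (1 - _) c]
  rw [intervalIntegral.integral_const_mul]
  ring

lemma greenW_add (v u : HalfFun) (z : ℝ) : greenW (v + u) z = greenW v z + greenW u z := by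
  have hB : greenB (v + u) z = greenB v z + greenB u z := by
    have := greenA_add v u (-z)
    simp only [greenA_neg] at this
    linarith
  rw [greenW, greenA_add, hB, greenW, greenW]
  ring

lemma greenW_smul (c : ℝ) (v : HalfFun) (z : ℝ) : greenW (c • v) z = c * greenW v z := by
  have hB : greenB (c • v) z = c * greenB v z := by
    have := greenA_smul c v (-z)
    simp only [greenA_neg] at this
    linarith
  rw [greenW, greenA_smul, hB, greenW]
  ring

/-- On the upper half the odd solution is controlled by the solution `w = z / 6` for `γ = z`. -/
lemma abs_greenW_le_of_mem (v : HalfFun) {z : ℝ} (hz : z ∈ Ioo (0 : ℝ) 1) :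
    |greenW v z / z| ≤ 1 / 6 * ‖v‖ := by
  obtain ⟨hz0, hz1⟩ := hz
  have hA : |greenA v z| ≤ ‖v‖ * ((1 - z) ^ 2 * (1 + 2 * z) / 12) := by
    have h := intervalIntegral.norm_integral_le_of_norm_le (a := z) (b := 1) (μ := volume)
      (f := fun c => (1 - c) * oddExt v c) (g := fun c => ‖v‖ * (c - c ^ 2)) hz1.le
      (Eventually.of_forall fun c hc => ?_) (by apply Continuous.intervalIntegrable; fun_prop)
    · rw [intervalIntegral.integral_const_mul, intervalIntegral.integral_sub (by simp) (by simp),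
        integral_id, integral_pow] at h
      rw [greenA, abs_mul, abs_of_pos (by norm_num : (0 : ℝ) < 1 / 2)]
      rw [Real.norm_eq_abs] at h
      refine (mul_le_mul_of_nonneg_left h (by norm_num)).trans (le_of_eq ?_)
      norm_num
      ring
    · have hc0 : 0 < c := hz0.trans hc.1
      rw [norm_mul, Real.norm_eq_abs, Real.norm_eq_abs, abs_of_nonneg (by linarith [hc.2])]
      have := abs_oddExt_le v c
      rw [abs_of_pos hc0] at this
      nlinarith [mul_le_mul_of_nonneg_left this (by linarith [hc.2] : (0 : ℝ) ≤ 1 - c)]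
  have hI : |∫ c in (0 : ℝ)..z, c * oddExt v c| ≤ ‖v‖ * (z ^ 3 / 3) := by
    have h := intervalIntegral.norm_integral_le_of_norm_le (a := 0) (b := z) (μ := volume)
      (f := fun c => c * oddExt v c) (g := fun c => ‖v‖ * c ^ 2) hz0.le
      (Eventually.of_forall fun c hc => ?_) (by apply Continuous.intervalIntegrable; fun_prop)
    · rw [intervalIntegral.integral_const_mul, integral_pow, Real.norm_eq_abs] at h
      refine h.trans (le_of_eq ?_)
      norm_num
    · have hc0 : 0 < c := hc.1
      rw [norm_mul, Real.norm_eq_abs, Real.norm_eq_abs, abs_of_pos hc0]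
      have := abs_oddExt_le v c
      rw [abs_of_pos hc0] at this
      nlinarith [mul_le_mul_of_nonneg_left this hc0.le]
  have h1 : 0 < 1 - z := by linarith
  have h2 : 0 < 1 + z := by linarith
  have e : greenW v z / z = greenA v z * (2 / ((1 - z) * (1 + z))) +
      (∫ c in (0 : ℝ)..z, c * oddExt v c) * (1 / (z * (1 + z))) := by
    rw [greenW, greenB_eq]
    field_simp
    ring
  rw [e]
  refine (abs_add_le _ _).trans ?_
  rw [abs_mul, abs_mul, abs_of_pos (by positivity : 0 < 2 / ((1 - z) * (1 + z))),
    abs_of_pos (by positivity : 0 < 1 / (z * (1 + z)))]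
  calc _ ≤ ‖v‖ * ((1 - z) ^ 2 * (1 + 2 * z) / 12) * (2 / ((1 - z) * (1 + z))) +
        ‖v‖ * (z ^ 3 / 3) * (1 / (z * (1 + z))) := by gcongr
    _ = 1 / 6 * ‖v‖ := by field_simp; ring

/-- The Green operator `v ↦ u`, where `w = z u` is the solution for the right-hand side
`γ = z v`. Its norm is at most `1 / 6`. -/
noncomputable def greenOp : HalfFun →L[ℝ] HalfFun :=
  LinearMap.mkContinuous
    { toFun := fun v => BoundedContinuousFunction.ofNormedAddCommGroup
        (fun z : Ioo (0 : ℝ) 1 => greenW v z / z)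
        (((continuous_greenW v).comp continuous_subtype_val).div continuous_subtype_val
          fun z => z.2.1.ne') (1 / 6 * ‖v‖) fun z => abs_greenW_le_of_mem v z.2
      map_add' := fun v u => by
        ext z
        simp [greenW_add, add_div]
      map_smul' := fun c v => by
        ext z
        simp [greenW_smul, mul_div_assoc] }
    (1 / 6) fun v => (BoundedContinuousFunction.norm_le (by positivity)).2 fun z =>
      abs_greenW_le_of_mem v z.2

lemma greenOp_apply (v : HalfFun) (z : Ioo (0 : ℝ) 1) : greenOp v z = greenW v z / z := rfl

lemma norm_greenOp_le : ‖greenOp‖ ≤ 1 / 6 := LinearMap.mkContinuous_norm_le _ (by norm_num) _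

/-! ### The nonlinear operators and the branch of solutions -/

/-- Superposition operators on bounded continuous functions are `C¹` if the derivative of the
function is locally Lipschitz, uniformly in the parameter. -/
lemma exists_superposition {α : Type*} [TopologicalSpace α] {f f' : α → ℝ → ℝ}
    (hf : Continuous fun p : α × ℝ => f p.1 p.2) (hf' : Continuous fun p : α × ℝ => f' p.1 p.2)
    (hd : ∀ z x, HasDerivAt (f z) (f' z x) x) {C₀ : ℝ} (h0 : ∀ z, |f z 0| ≤ C₀)
    (h0' : ∀ z, |f' z 0| ≤ C₀)
    (hl : ∀ R : ℝ, 0 ≤ R → ∃ C : ℝ, 0 ≤ C ∧ ∀ z x y, |x| ≤ R → |y| ≤ R →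
      |f' z x - f' z y| ≤ C * |x - y|) :
    ∃ N D : BoundedContinuousFunction α ℝ → BoundedContinuousFunction α ℝ,
      (∀ u z, N u z = f z (u z)) ∧ (∀ u z, D u z = f' z (u z)) ∧ ContDiff ℝ 1 N ∧
      ∀ u, HasFDerivAt N (ContinuousLinearMap.mul ℝ (BoundedContinuousFunction α ℝ) (D u)) u := by
  have hb' : ∀ R : ℝ, 0 ≤ R → ∃ C, ∀ z x, |x| ≤ R → |f' z x| ≤ C := by
    intro R hR
    obtain ⟨C, hC0, hC⟩ := hl R hR
    refine ⟨C * R + C₀, fun z x hx => ?_⟩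
    have h1 := hC z x 0 hx (by simpa using hR)
    rw [sub_zero] at h1
    have h2 := abs_sub_abs_le_abs_sub (f' z x) (f' z 0)
    have h3 : C * |x| ≤ C * R := by gcongr
    linarith [h0' z]
  have hb : ∀ R : ℝ, 0 ≤ R → ∃ C, ∀ z x, |x| ≤ R → |f z x| ≤ C := by
    intro R hR
    obtain ⟨C, hC⟩ := hb' R hR
    refine ⟨C * R + C₀, fun z x hx => ?_⟩
    have h1 := (convex_Icc (-R) R).norm_image_sub_le_of_norm_hasDerivWithin_le (f := f z)
      (fun y _ => (hd z y).hasDerivWithinAt) (fun y hy => hC z y (abs_le.2 hy))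
      (show (0 : ℝ) ∈ Icc (-R) R by simpa using hR) (abs_le.1 hx)
    rw [Real.norm_eq_abs, Real.norm_eq_abs, sub_zero] at h1
    have h2 := abs_sub_abs_le_abs_sub (f z x) (f z 0)
    have hC0 : 0 ≤ C := (abs_nonneg _).trans (hC z x hx)
    have h3 : C * |x| ≤ C * R := by gcongr
    linarith [h0 z]
  choose! B hB using hb
  choose! B' hB' using hb'
  choose! L hL0 hL using hl
  have hun : ∀ (u : BoundedContinuousFunction α ℝ) z, |u z| ≤ ‖u‖ := fun u z =>
    u.norm_coe_le_norm z
  let N : BoundedContinuousFunction α ℝ → BoundedContinuousFunction α ℝ := fun u =>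
    BoundedContinuousFunction.ofNormedAddCommGroup (fun z => f z (u z))
      (hf.comp (continuous_id.prodMk u.continuous)) (B ‖u‖)
      fun z => hB _ (norm_nonneg u) z _ (hun u z)
  let D : BoundedContinuousFunction α ℝ → BoundedContinuousFunction α ℝ := fun u =>
    BoundedContinuousFunction.ofNormedAddCommGroup (fun z => f' z (u z))
      (hf'.comp (continuous_id.prodMk u.continuous)) (B' ‖u‖)
      fun z => hB' _ (norm_nonneg u) z _ (hun u z)
  have hN : ∀ u z, N u z = f z (u z) := fun _ _ => rfl
  have hD : ∀ u z, D u z = f' z (u z) := fun _ _ => rfl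
  have hder : ∀ u, HasFDerivAt N
      (ContinuousLinearMap.mul ℝ (BoundedContinuousFunction α ℝ) (D u)) u := by
    intro u
    have hR : 0 ≤ ‖u‖ + 1 := by positivity
    rw [hasFDerivAt_iff_isLittleO_nhds_zero]
    have hO : (fun h => N (u + h) - N u -
        ContinuousLinearMap.mul ℝ (BoundedContinuousFunction α ℝ) (D u) h) =O[𝓝 0]
        fun h => ‖h‖ ^ 2 := by
      refine Asymptotics.IsBigO.of_bound (L (‖u‖ + 1)) ?_
      filter_upwards [Metric.ball_mem_nhds (0 : BoundedContinuousFunction α ℝ) one_pos] with h hh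
      rw [mem_ball_zero_iff] at hh
      rw [norm_pow, norm_norm]
      refine (BoundedContinuousFunction.norm_le (mul_nonneg (hL0 _ hR) (sq_nonneg _))).2 fun z => ?_
      change ‖f z (u z + h z) - f z (u z) - f' z (u z) * h z‖ ≤ _
      have hsub : ∀ y ∈ uIcc (u z) (u z + h z), |y - u z| ≤ ‖h‖ ∧ |y| ≤ ‖u‖ + 1 := by
        intro y hy
        have h1 := abs_sub_left_of_mem_uIcc hy
        rw [add_sub_cancel_left] at h1
        have h2 := h1.trans (hun h z)
        refine ⟨h2, ?_⟩
        have h3 := abs_sub_abs_le_abs_sub y (u z)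
        linarith [hun u z]
      have hmv := (convex_uIcc (u z) (u z + h z)).norm_image_sub_le_of_norm_hasDerivWithin_le
        (f := fun y => f z y - f' z (u z) * y) (C := L (‖u‖ + 1) * ‖h‖)
        (fun y _ => ((hd z y).sub ((hasDerivAt_id y).const_mul _)).hasDerivWithinAt)
        (fun y hy => ?_) left_mem_uIcc right_mem_uIcc
      · rw [add_sub_cancel_left] at hmv
        calc ‖f z (u z + h z) - f z (u z) - f' z (u z) * h z‖
            = ‖f z (u z + h z) - f' z (u z) * (u z + h z) -
                (f z (u z) - f' z (u z) * u z)‖ := by congr 1; ring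
          _ ≤ L (‖u‖ + 1) * ‖h‖ * ‖h z‖ := hmv
          _ ≤ L (‖u‖ + 1) * ‖h‖ * ‖h‖ := by
            refine mul_le_mul_of_nonneg_left (h.norm_coe_le_norm z)
              (mul_nonneg (hL0 _ hR) (norm_nonneg _))
          _ = L (‖u‖ + 1) * ‖h‖ ^ 2 := by ring
      · obtain ⟨h1, h2⟩ := hsub y hy
        rw [mul_one, Real.norm_eq_abs]
        refine (hL _ hR z y (u z) h2 ((hun u z).trans (by linarith))).trans ?_
        exact mul_le_mul_of_nonneg_left h1 (hL0 _ hR)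
    refine hO.trans_isLittleO ?_
    simpa using Asymptotics.isLittleO_norm_pow_id (E' := BoundedContinuousFunction α ℝ) one_lt_two
  have hDc : Continuous D := by
    rw [continuous_iff_continuousAt]
    intro u
    have hR : 0 ≤ ‖u‖ + 1 := by positivity
    rw [ContinuousAt, tendsto_iff_norm_sub_tendsto_zero]
    have hlim : Tendsto (fun v => L (‖u‖ + 1) * ‖v - u‖) (𝓝 u) (𝓝 0) := by
      have hc : Continuous fun v => L (‖u‖ + 1) * ‖v - u‖ := by fun_prop
      simpa using hc.tendsto u
    refine squeeze_zero' (Eventually.of_forall fun _ => norm_nonneg _) ?_ hlim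
    filter_upwards [Metric.ball_mem_nhds u one_pos] with v hv
    rw [mem_ball_iff_norm] at hv
    refine (BoundedContinuousFunction.norm_le (mul_nonneg (hL0 _ hR) (norm_nonneg _))).2 fun z => ?_
    have hv1 : ‖v‖ ≤ ‖u‖ + 1 := by linarith [norm_sub_norm_le v u]
    refine (hL _ hR z (v z) (u z) ((hun v z).trans hv1) ((hun u z).trans (by linarith))).trans ?_
    exact mul_le_mul_of_nonneg_left ((v - u).norm_coe_le_norm z) (hL0 _ hR)
  refine ⟨N, D, hN, hD, contDiff_one_iff_fderiv.2 ⟨fun u => (hder u).differentiableAt, ?_⟩, hder⟩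
  have : fderiv ℝ N = fun u => ContinuousLinearMap.mul ℝ (BoundedContinuousFunction α ℝ) (D u) :=
    funext fun u => (hder u).fderiv
  rw [this]
  exact (ContinuousLinearMap.mul ℝ (BoundedContinuousFunction α ℝ)).continuous.comp hDc

/-- The part of the nonlinearity that comes from `sin 2h / (2 sin² θ)`, with `θ = arccos z` and
`h = 2θ + sin θ · z x`. -/
noncomputable def dirichletPart (z x : ℝ) : ℝ :=
  (2 * √(1 - z ^ 2) * z * x + Real.sin (4 * Real.arccos z) -
    Real.sin (4 * Real.arccos z + 2 * √(1 - z ^ 2) * z * x)) / (2 * √(1 - z ^ 2) ^ 3 * z) + 4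

/-- The part of the nonlinearity that comes from `sin (2h - 2θ)`, with `θ = arccos z` and
`h = 2θ + sin θ · z x`. -/
noncomputable def anisotropyPart (z x : ℝ) : ℝ :=
  Real.sin (2 * Real.arccos z + 2 * √(1 - z ^ 2) * z * x) / (√(1 - z ^ 2) * z)

lemma sqrt_one_sub_sq_pos {z : ℝ} (hz : z ∈ Ioo (-1 : ℝ) 1) : 0 < √(1 - z ^ 2) :=
  Real.sqrt_pos.2 (by nlinarith [hz.1, hz.2])

lemma sq_sqrt_one_sub_sq {z : ℝ} (hz : z ∈ Icc (-1 : ℝ) 1) : √(1 - z ^ 2) ^ 2 = 1 - z ^ 2 :=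
  Real.sq_sqrt (by nlinarith [hz.1, hz.2])

lemma sqrt_one_sub_sq_le_one (z : ℝ) : √(1 - z ^ 2) ≤ 1 := by
  rw [Real.sqrt_le_left zero_le_one]
  nlinarith [sq_nonneg z]

lemma sin_two_arccos {z : ℝ} (hz : z ∈ Icc (-1 : ℝ) 1) :
    Real.sin (2 * Real.arccos z) = 2 * √(1 - z ^ 2) * z := by
  rw [Real.sin_two_mul, Real.sin_arccos, Real.cos_arccos hz.1 hz.2]

lemma cos_two_arccos {z : ℝ} (hz : z ∈ Icc (-1 : ℝ) 1) :
    Real.cos (2 * Real.arccos z) = 2 * z ^ 2 - 1 := by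
  rw [Real.cos_two_mul, Real.cos_arccos hz.1 hz.2]

lemma sin_four_arccos {z : ℝ} (hz : z ∈ Icc (-1 : ℝ) 1) :
    Real.sin (4 * Real.arccos z) = 4 * √(1 - z ^ 2) * z * (2 * z ^ 2 - 1) := by
  rw [show 4 * Real.arccos z = 2 * (2 * Real.arccos z) by ring, Real.sin_two_mul,
    sin_two_arccos hz, cos_two_arccos hz]
  ring

lemma cos_four_arccos {z : ℝ} (hz : z ∈ Icc (-1 : ℝ) 1) :
    Real.cos (4 * Real.arccos z) = 8 * z ^ 4 - 8 * z ^ 2 + 1 := by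
  rw [show 4 * Real.arccos z = 2 * (2 * Real.arccos z) by ring, Real.cos_two_mul,
    cos_two_arccos hz]
  ring

lemma Ioo_zero_one_subset : Ioo (0 : ℝ) 1 ⊆ Ioo (-1 : ℝ) 1 := Ioo_subset_Ioo_left (by norm_num)

lemma abs_sin_add_le (x y : ℝ) : |Real.sin (x + y)| ≤ |Real.sin x| + |y| := by
  rw [Real.sin_add]
  refine (abs_add_le _ _).trans (add_le_add ?_ ?_)
  · rw [abs_mul]
    nlinarith [Real.abs_cos_le_one y, abs_nonneg (Real.sin x)]
  · rw [abs_mul]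
    nlinarith [Real.abs_cos_le_one x, abs_nonneg (Real.sin y), Real.abs_sin_le_abs (x := y),
      abs_nonneg (Real.cos x)]

lemma abs_cos_add_sub_cos_add_le (x s t : ℝ) : |Real.cos (x + 2 * s) - Real.cos (x + 2 * t)| ≤
    2 * (|Real.sin x| + |s + t|) * |s - t| ∧
    |Real.cos (x + 2 * s) - Real.cos (x + 2 * t)| ≤ 2 * |s - t| := by
  have e : Real.cos (x + 2 * s) - Real.cos (x + 2 * t) =
      -2 * Real.sin (x + (s + t)) * Real.sin (s - t) := by
    rw [Real.cos_sub_cos]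
    congr 2
    · congr 2; ring
    · ring
  have h1 := Real.abs_sin_le_abs (x := s - t)
  rw [e, abs_mul, abs_mul, abs_neg, abs_two]
  constructor
  · gcongr
    exact abs_sin_add_le _ _
  · have := Real.abs_sin_le_one (x + (s + t))
    nlinarith [abs_nonneg (Real.sin (s - t)), abs_nonneg (Real.sin (x + (s + t)))]

lemma continuous_sqrt_arccos : Continuous (fun p : Ioo (0 : ℝ) 1 × ℝ => √(1 - (p.1 : ℝ) ^ 2)) ∧
    Continuous (fun p : Ioo (0 : ℝ) 1 × ℝ => Real.arccos (p.1 : ℝ)) :=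
  ⟨by fun_prop, Real.continuous_arccos.comp (by fun_prop)⟩

lemma exists_dirichletPart_op : ∃ N D : HalfFun → HalfFun,
    (∀ u (z : Ioo (0 : ℝ) 1), N u z = dirichletPart z (u z)) ∧
    (∀ z : Ioo (0 : ℝ) 1, D 0 z = 8 * (z : ℝ) ^ 2) ∧ ContDiff ℝ 1 N ∧
    ∀ u, HasFDerivAt N (ContinuousLinearMap.mul ℝ HalfFun (D u)) u := by
  obtain ⟨hq, hθ⟩ := continuous_sqrt_arccos
  have hz0 : ∀ z : Ioo (0 : ℝ) 1, (z : ℝ) ≠ 0 := fun z => z.2.1.ne'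
  have hq0 : ∀ z : Ioo (0 : ℝ) 1, √(1 - (z : ℝ) ^ 2) ≠ 0 := fun z =>
    (sqrt_one_sub_sq_pos (Ioo_zero_one_subset z.2)).ne'
  have h0' : ∀ z : Ioo (0 : ℝ) 1, (1 - Real.cos (4 * Real.arccos z + 2 * √(1 - (z : ℝ) ^ 2) * z * 0)) /
      √(1 - (z : ℝ) ^ 2) ^ 2 = 8 * (z : ℝ) ^ 2 := by
    intro z
    have hzI := Ioo_subset_Icc_self (Ioo_zero_one_subset z.2)
    rw [mul_zero, add_zero, cos_four_arccos hzI, div_eq_iff (pow_ne_zero 2 (hq0 z)),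
      sq_sqrt_one_sub_sq hzI]
    ring
  have key := exists_superposition (α := Ioo (0 : ℝ) 1)
    (f := fun z x => dirichletPart z x)
    (f' := fun z x => (1 - Real.cos (4 * Real.arccos z + 2 * √(1 - (z : ℝ) ^ 2) * z * x)) /
      √(1 - (z : ℝ) ^ 2) ^ 2) (C₀ := 8) ?_ ?_ ?_ ?_ ?_ ?_
  · obtain ⟨N, D, hN, hD, hN1, hder⟩ := key
    exact ⟨N, D, hN, fun z => by rw [hD]; exact h0' z, hN1, hder⟩
  · unfold dirichletPart
    refine Continuous.add (Continuous.div (by fun_prop) (by fun_prop) fun p => ?_) continuous_const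
    exact mul_ne_zero (mul_ne_zero two_ne_zero (pow_ne_zero 3 (hq0 p.1))) (hz0 p.1)
  · exact Continuous.div (by fun_prop) (by fun_prop) fun p => pow_ne_zero 2 (hq0 p.1)
  · intro z x
    have h1 : HasDerivAt (fun x => 2 * √(1 - (z : ℝ) ^ 2) * z * x) (2 * √(1 - (z : ℝ) ^ 2) * z) x := by
      simpa using (hasDerivAt_id x).const_mul (2 * √(1 - (z : ℝ) ^ 2) * z)
    have h2 : HasDerivAt (fun x => dirichletPart z x) _ x :=
      (((h1.add_const (Real.sin (4 * Real.arccos z))).sub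
        (h1.const_add (4 * Real.arccos z)).sin).div_const
        (2 * √(1 - (z : ℝ) ^ 2) ^ 3 * z)).add_const 4
    refine h2.congr_deriv ?_
    have := hz0 z
    have := hq0 z
    field_simp
  · intro z
    have hzI := Ioo_subset_Icc_self (Ioo_zero_one_subset z.2)
    simp only [dirichletPart]
    norm_num
  · intro z
    rw [h0' z, abs_of_nonneg (by positivity)]
    nlinarith [z.2.1, z.2.2]
  · intro R hR
    refine ⟨2 * (4 + 2 * R), by positivity, fun z x y hx hy => ?_⟩
    have hzI := Ioo_subset_Icc_self (Ioo_zero_one_subset z.2)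
    have hqp := sqrt_one_sub_sq_pos (Ioo_zero_one_subset z.2)
    obtain ⟨hz1, hz2⟩ := z.2
    have hs4 := sin_four_arccos hzI
    set q := √(1 - (z : ℝ) ^ 2)
    rw [← sub_div, sub_sub_sub_cancel_left, abs_div, abs_of_pos (pow_pos hqp 2),
      div_le_iff₀ (pow_pos hqp 2), abs_sub_comm,
      show 2 * q * z * x = 2 * (q * z * x) by ring, show 2 * q * z * y = 2 * (q * z * y) by ring]
    refine (abs_cos_add_sub_cos_add_le _ _ _).1.trans ?_
    have b1 : |Real.sin (4 * Real.arccos z)| ≤ 4 * q := by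
      rw [hs4, abs_mul, abs_mul, abs_mul, abs_of_pos hqp, abs_of_pos hz1]
      have : |2 * (z : ℝ) ^ 2 - 1| ≤ 1 := abs_le.2 ⟨by nlinarith, by nlinarith⟩
      have h4 : |(4 : ℝ)| = 4 := by norm_num
      rw [h4]
      have : (z : ℝ) * |2 * (z : ℝ) ^ 2 - 1| ≤ 1 := by
        nlinarith [abs_nonneg (2 * (z : ℝ) ^ 2 - 1)]
      nlinarith
    have hqz : q * z ≤ q := by nlinarith
    have hqz0 : 0 ≤ q * z := by positivity
    have b2 : |q * z * x + q * z * y| ≤ q * (2 * R) := by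
      rw [← mul_add, abs_mul, abs_of_nonneg hqz0]
      exact mul_le_mul hqz ((abs_add_le _ _).trans (by linarith)) (abs_nonneg _) hqp.le
    have b3 : |q * z * x - q * z * y| ≤ q * |x - y| := by
      rw [← mul_sub, abs_mul, abs_of_nonneg hqz0]
      exact mul_le_mul_of_nonneg_right hqz (abs_nonneg _)
    calc _ ≤ 2 * (4 * q + q * (2 * R)) * (q * |x - y|) := by gcongr
      _ = _ := by ring

lemma exists_anisotropyPart_op : ∃ N D : HalfFun → HalfFun,
    (∀ u (z : Ioo (0 : ℝ) 1), N u z = anisotropyPart z (u z)) ∧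
    (∀ z : Ioo (0 : ℝ) 1, D 0 z = 2 * (2 * (z : ℝ) ^ 2 - 1)) ∧ ContDiff ℝ 1 N ∧
    ∀ u, HasFDerivAt N (ContinuousLinearMap.mul ℝ HalfFun (D u)) u := by
  obtain ⟨hq, hθ⟩ := continuous_sqrt_arccos
  have hz0 : ∀ z : Ioo (0 : ℝ) 1, (z : ℝ) ≠ 0 := fun z => z.2.1.ne'
  have hq0 : ∀ z : Ioo (0 : ℝ) 1, √(1 - (z : ℝ) ^ 2) ≠ 0 := fun z =>
    (sqrt_one_sub_sq_pos (Ioo_zero_one_subset z.2)).ne'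
  have h0' : ∀ z : Ioo (0 : ℝ) 1,
      2 * Real.cos (2 * Real.arccos z + 2 * √(1 - (z : ℝ) ^ 2) * z * 0) =
        2 * (2 * (z : ℝ) ^ 2 - 1) := by
    intro z
    rw [mul_zero, add_zero, cos_two_arccos (Ioo_subset_Icc_self (Ioo_zero_one_subset z.2))]
  have key := exists_superposition (α := Ioo (0 : ℝ) 1)
    (f := fun z x => anisotropyPart z x)
    (f' := fun z x => 2 * Real.cos (2 * Real.arccos z + 2 * √(1 - (z : ℝ) ^ 2) * z * x))
    (C₀ := 2) ?_ ?_ ?_ ?_ ?_ ?_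
  · obtain ⟨N, D, hN, hD, hN1, hder⟩ := key
    exact ⟨N, D, hN, fun z => by rw [hD]; exact h0' z, hN1, hder⟩
  · unfold anisotropyPart
    exact Continuous.div (by fun_prop) (by fun_prop) fun p => mul_ne_zero (hq0 p.1) (hz0 p.1)
  · fun_prop
  · intro z x
    have h1 : HasDerivAt (fun x => 2 * √(1 - (z : ℝ) ^ 2) * z * x) (2 * √(1 - (z : ℝ) ^ 2) * z) x := by
      simpa using (hasDerivAt_id x).const_mul (2 * √(1 - (z : ℝ) ^ 2) * z)
    have h2 : HasDerivAt (fun x => anisotropyPart z x) _ x :=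
      (h1.const_add (2 * Real.arccos z)).sin.div_const (√(1 - (z : ℝ) ^ 2) * z)
    refine h2.congr_deriv ?_
    have := hz0 z
    have := hq0 z
    field_simp
  · intro z
    simp only [anisotropyPart]
    rw [mul_zero, add_zero, sin_two_arccos (Ioo_subset_Icc_self (Ioo_zero_one_subset z.2)),
      mul_assoc, mul_div_assoc, div_self (mul_ne_zero (hq0 z) (hz0 z))]
    norm_num
  · intro z
    rw [h0' z]
    exact abs_le.2 ⟨by nlinarith [z.2.1, z.2.2], by nlinarith [z.2.1, z.2.2]⟩
  · intro R hR
    refine ⟨4, by positivity, fun z x y hx hy => ?_⟩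
    have hqp := sqrt_one_sub_sq_pos (Ioo_zero_one_subset z.2)
    have hq1 := sqrt_one_sub_sq_le_one z
    obtain ⟨hz1, hz2⟩ := z.2
    set q := √(1 - (z : ℝ) ^ 2)
    rw [← mul_sub, abs_mul, abs_two, show 2 * q * z * x = 2 * (q * z * x) by ring,
      show 2 * q * z * y = 2 * (q * z * y) by ring]
    have h1 := (abs_cos_add_sub_cos_add_le (2 * Real.arccos z) (q * z * x) (q * z * y)).2
    have b3 : |q * z * x - q * z * y| ≤ |x - y| := by
      rw [← mul_sub, abs_mul, abs_of_nonneg (by positivity)]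
      have : q * z ≤ 1 := by nlinarith
      nlinarith [abs_nonneg (x - y)]
    linarith

lemma isInvertible_one_sub_smul {X : Type*} [NormedAddCommGroup X] [NormedSpace ℝ X]
    [CompleteSpace X] {S : X →L[ℝ] X} {c : ℝ} (h : |c| * ‖S‖ < 1) :
    (1 - c • S : X →L[ℝ] X).IsInvertible := by
  have hlt : ‖c • S‖ < 1 := by rwa [norm_smul, Real.norm_eq_abs]
  obtain ⟨e, he⟩ := isUnit_one_sub_of_norm_lt_one hlt
  exact ⟨ContinuousLinearEquiv.unitsEquiv ℝ X e, by rw [← he]; rfl⟩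

/-- The branch of solutions near `κ = 4`. In terms of `w = z u`, with `u = greenOp v`, the profile
equation for `h = 2θ + sin θ w(cos θ)` is the fixed point equation for the right-hand side `v`
stated here. The linearization at `κ = 4`, `u = 0` is `1 - 4 greenOp`, which is invertible by the
Neumann series. -/
theorem exists_branch : ∃ (I : Set ℝ) (v v' : ℝ → HalfFun), IsOpen I ∧ (4 : ℝ) ∈ I ∧ v 4 = 0 ∧
    (∀ κ ∈ I, HasDerivAt v (v' κ) κ) ∧ ContinuousOn v' I ∧
    (∀ κ ∈ I, |κ - 4| ≤ 1 / 20 ∧ ‖v κ‖ ≤ 1 / 100) ∧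
    ∀ κ ∈ I, ∀ z : Ioo (0 : ℝ) 1, v κ z = dirichletPart z (greenW (v κ) z / z) -
      κ / 2 * anisotropyPart z (greenW (v κ) z / z) := by
  obtain ⟨N₁, D₁, hN₁, hD₁, hc₁, hd₁⟩ := exists_dirichletPart_op
  obtain ⟨N₂, D₂, hN₂, hD₂, hc₂, hd₂⟩ := exists_anisotropyPart_op
  let N : ℝ × HalfFun → HalfFun := fun p => N₁ p.2 - (p.1 / 2) • N₂ p.2
  let Φ : ℝ × HalfFun → HalfFun := fun p => p.2 - greenOp (N p)
  have hNc : ContDiff ℝ 1 N := (hc₁.comp contDiff_snd).sub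
    ((contDiff_fst.div_const 2).smul (hc₂.comp contDiff_snd))
  have hΦc : ContDiff ℝ 1 Φ := contDiff_snd.sub (greenOp.contDiff.comp hNc)
  have hN0 : N (4, 0) = 0 := by
    ext z
    change N₁ 0 z - (4 / 2) * N₂ 0 z = 0
    have hzI := Ioo_subset_Icc_self (Ioo_zero_one_subset z.2)
    have hz0 : (z : ℝ) ≠ 0 := z.2.1.ne'
    have hq0 := (sqrt_one_sub_sq_pos (Ioo_zero_one_subset z.2)).ne'
    rw [hN₁, hN₂, BoundedContinuousFunction.coe_zero, Pi.zero_apply, dirichletPart, anisotropyPart,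
      mul_zero, add_zero, add_zero, sin_two_arccos hzI, zero_add, sub_self, zero_div,
      mul_assoc 2, mul_div_assoc, div_self (mul_ne_zero hq0 hz0)]
    norm_num
  have hΦ0 : Φ (4, 0) = 0 := by
    change (0 : HalfFun) - greenOp (N (4, 0)) = 0
    rw [hN0, map_zero, sub_zero]
  have hpart : fderiv ℝ Φ (4, 0) ∘L ContinuousLinearMap.inr ℝ ℝ HalfFun =
      1 - (4 : ℝ) • greenOp := by
    have h1 : HasFDerivAt (fun u => Φ (4, u)) (fderiv ℝ Φ (4, 0) ∘L
        ContinuousLinearMap.inr ℝ ℝ HalfFun) (0 : HalfFun) :=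
      ((hΦc.differentiable one_ne_zero) (4, 0)).hasFDerivAt.comp (0 : HalfFun)
        (hasFDerivAt_prodMk_right (4 : ℝ) (0 : HalfFun))
    have h2 : HasFDerivAt (fun u => Φ (4, u)) _ (0 : HalfFun) :=
      (hasFDerivAt_id (0 : HalfFun)).sub (greenOp.hasFDerivAt.comp (0 : HalfFun)
        ((hd₁ 0).sub ((hd₂ 0).const_smul (4 / 2 : ℝ))))
    rw [h1.unique h2]
    ext1 u
    have hu : D₁ 0 * u - (4 / 2 : ℝ) • (D₂ 0 * u) = (4 : ℝ) • u := by
      ext z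
      change D₁ 0 z * u z - (4 / 2) * (D₂ 0 z * u z) = 4 * u z
      rw [hD₁, hD₂]
      ring
    change u - greenOp (D₁ 0 * u - (4 / 2 : ℝ) • (D₂ 0 * u)) = u - (4 : ℝ) • greenOp u
    rw [hu, map_smul]
  have hinv : (fderiv ℝ Φ (4, 0) ∘L ContinuousLinearMap.inr ℝ ℝ HalfFun).IsInvertible := by
    rw [hpart]
    refine isInvertible_one_sub_smul ?_
    rw [abs_of_pos (by norm_num)]
    linarith [norm_greenOp_le]
  have cdf : ContDiffAt ℝ 1 Φ (4, 0) := hΦc.contDiffAt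
  let φ : ℝ → HalfFun := cdf.implicitFunction one_ne_zero hinv
  have hφ0 : φ 4 = 0 := cdf.implicitFunction_apply_self one_ne_zero hinv
  have hφe : ∀ᶠ κ in 𝓝 (4 : ℝ), Φ (κ, φ κ) = 0 := by
    have := cdf.eventually_apply_implicitFunction one_ne_zero hinv
    filter_upwards [this] with κ hκ
    rw [← hΦ0]; exact hκ
  have hφc : ContDiffAt ℝ 1 φ 4 := cdf.contDiffAt_implicitFunction one_ne_zero hinv
  let v : ℝ → HalfFun := fun κ => N (κ, φ κ)
  have hvc : ContDiffAt ℝ 1 v 4 := hNc.contDiffAt.comp 4 (contDiffAt_id.prodMk hφc)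
  have hv0 : v 4 = 0 := by
    change N (4, φ 4) = 0
    rw [hφ0, hN0]
  have hvs : ∀ᶠ κ in 𝓝 (4 : ℝ), ‖v κ‖ ≤ 1 / 100 := by
    have h1 := hvc.continuousAt.norm
    have h2 : Tendsto (fun κ => ‖v κ‖) (𝓝 4) (𝓝 0) := by
      simpa [ContinuousAt, hv0] using h1
    exact (h2.eventually_lt_const (by norm_num)).mono fun κ hκ => hκ.le
  have hκs : ∀ᶠ κ in 𝓝 (4 : ℝ), |κ - 4| ≤ 1 / 20 := by
    filter_upwards [Metric.ball_mem_nhds (4 : ℝ) (by norm_num : (0 : ℝ) < 1 / 20)] with κ hκ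
    rw [Metric.mem_ball, Real.dist_eq] at hκ
    exact hκ.le
  obtain ⟨I, hI, hIo, h4⟩ := eventually_nhds_iff.1
    (hφe.and ((hvc.eventually (by simp)).and (hκs.and hvs)))
  have hvI : ContDiffOn ℝ 1 v I := fun κ hκ => (hI κ hκ).2.1.contDiffWithinAt
  refine ⟨I, v, deriv v, hIo, h4, hv0, fun κ hκ =>
    ((hI κ hκ).2.1.differentiableAt one_ne_zero).hasDerivAt,
    hvI.continuousOn_deriv_of_isOpen hIo le_rfl, fun κ hκ => (hI κ hκ).2.2, fun κ hκ z => ?_⟩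
  have hfix : φ κ = greenOp (v κ) := sub_eq_zero.1 (hI κ hκ).1
  have hz : greenW (v κ) z / z = φ κ z := by
    rw [hfix, greenOp_apply]
  rw [hz, ← hN₁, ← hN₂]
  rfl

/-! ### The profiles as functions of the polar angle -/

/-- The perturbation `η(θ) = sin θ w(cos θ)` of the profile `2θ`. -/
noncomputable def perturbation (v : HalfFun) (θ : ℝ) : ℝ := Real.sin θ * greenW v (Real.cos θ)

/-- The profile `h = 2θ + η`. -/
noncomputable def profile (v : HalfFun) (θ : ℝ) : ℝ := 2 * θ + perturbation v θ

lemma cos_mem_Ioo {θ : ℝ} (hθ : θ ∈ Ioo 0 Real.pi) : Real.cos θ ∈ Ioo (-1 : ℝ) 1 := by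
  have h1 := Real.sin_pos_of_mem_Ioo hθ
  have h2 := Real.sin_sq_add_cos_sq θ
  exact abs_lt.1 ((sq_lt_one_iff_abs_lt_one _).1 (by nlinarith))

lemma cos_mem_Icc (θ : ℝ) : Real.cos θ ∈ Icc (-1 : ℝ) 1 := ⟨Real.neg_one_le_cos θ, Real.cos_le_one θ⟩

lemma hasDerivAt_perturbation (v : HalfFun) {θ : ℝ} (hθ : θ ∈ Ioo 0 Real.pi) :
    HasDerivAt (perturbation v) (greenD v (Real.cos θ)) θ := by
  have h : HasDerivAt (perturbation v) _ θ := (Real.hasDerivAt_sin θ).mul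
    ((hasDerivAt_greenW v (cos_mem_Ioo hθ)).comp θ (Real.hasDerivAt_cos θ))
  refine h.congr_deriv ?_
  rw [greenD_eq v (cos_mem_Ioo hθ)]
  linear_combination (-greenW' v (Real.cos θ)) * Real.sin_sq_add_cos_sq θ

lemma deriv_perturbation (v : HalfFun) {θ : ℝ} (hθ : θ ∈ Ioo 0 Real.pi) :
    deriv (perturbation v) θ = greenD v (Real.cos θ) := (hasDerivAt_perturbation v hθ).deriv

lemma hasDerivAt_greenD_cos (v : HalfFun) {θ : ℝ} (hθ : θ ∈ Ioo 0 Real.pi) :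
    HasDerivAt (fun t => greenD v (Real.cos t)) ((oddExt v (Real.cos θ) - greenW v (Real.cos θ) -
      Real.cos θ * greenW' v (Real.cos θ)) * -Real.sin θ) θ :=
  (hasDerivAt_greenD v (cos_mem_Ioo hθ)).comp θ (Real.hasDerivAt_cos θ)

lemma continuousOn_greenD_cos_deriv (v : HalfFun) :
    ContinuousOn (fun θ => (oddExt v (Real.cos θ) - greenW v (Real.cos θ) -
      Real.cos θ * greenW' v (Real.cos θ)) * -Real.sin θ) (Ioo 0 Real.pi) := by
  have hc := fun θ (hθ : θ ∈ Ioo 0 Real.pi) => cos_mem_Ioo hθ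
  have h1 : ContinuousOn (fun θ => oddExt v (Real.cos θ)) (Ioo 0 Real.pi) :=
    ContinuousOn.comp (t := Ioo (-1) 1)
      (fun z hz => (continuousAt_oddExt v hz).continuousWithinAt) (by fun_prop) hc
  have h2 : ContinuousOn (fun θ => greenW' v (Real.cos θ)) (Ioo 0 Real.pi) :=
    (continuousOn_greenW' v).comp (by fun_prop) hc
  have h3 := continuous_greenW v
  fun_prop

/-- The perturbation solves `L η = - sin θ γ(cos θ)`. -/
lemma legendreOp_perturbation (v : HalfFun) {θ : ℝ} (hθ : θ ∈ Ioo 0 Real.pi) :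
    legendreOp (perturbation v) θ = -(Real.sin θ * oddExt v (Real.cos θ)) := by
  have hs := (Real.sin_pos_of_mem_Ioo hθ).ne'
  have h1 : HasDerivAt (fun t => Real.sin t * deriv (perturbation v) t) _ θ :=
    ((Real.hasDerivAt_sin θ).mul (hasDerivAt_greenD_cos v hθ)).congr_of_eventuallyEq <| by
      filter_upwards [isOpen_Ioo.mem_nhds hθ] with t ht
      rw [deriv_perturbation v ht]
      rfl
  rw [legendreOp, h1.deriv, greenD_eq v (cos_mem_Ioo hθ), perturbation]
  have h2 := Real.sin_sq_add_cos_sq θ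
  field_simp
  linear_combination (greenW v (Real.cos θ) + Real.cos θ * greenW' v (Real.cos θ)) * h2

lemma perturbation_add (v u : HalfFun) (θ : ℝ) :
    perturbation (v + u) θ = perturbation v θ + perturbation u θ := by
  rw [perturbation, greenW_add, mul_add]; rfl

lemma perturbation_smul (c : ℝ) (v : HalfFun) (θ : ℝ) :
    perturbation (c • v) θ = c * perturbation v θ := by
  rw [perturbation, greenW_smul, mul_left_comm]; rfl

lemma perturbation_sub (v u : HalfFun) (θ : ℝ) :
    perturbation (v - u) θ = perturbation v θ - perturbation u θ := by
  have := perturbation_add (v - u) u θ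
  rw [sub_add_cancel] at this
  linarith

lemma continuous_perturbation (v : HalfFun) : Continuous (perturbation v) :=
  Real.continuous_sin.mul ((continuous_greenW v).comp Real.continuous_cos)

lemma abs_perturbation_le (v : HalfFun) (θ : ℝ) : |perturbation v θ| ≤ ‖v‖ := by
  rw [perturbation, abs_mul]
  nlinarith [Real.abs_sin_le_one θ, (abs_green_le v (cos_mem_Icc θ)).1,
    abs_nonneg (greenW v (Real.cos θ)), abs_nonneg (Real.sin θ)]

instance : IsFiniteMeasure sinMeasure := by
  refine isFiniteMeasure_withDensity (ne_top_of_le_ne_top (b := ∫⁻ _ in Ioo 0 Real.pi, 1) ?_ ?_)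
  · simp
  · exact lintegral_mono fun θ => by
      rw [← ENNReal.ofReal_one]; exact ENNReal.ofReal_le_ofReal (Real.sin_le_one θ)

lemma ae_sinMeasure_mem : ∀ᵐ θ ∂sinMeasure, θ ∈ Ioo 0 Real.pi :=
  (withDensity_absolutelyContinuous _ _).ae_le (ae_restrict_mem measurableSet_Ioo)

lemma legendreOp_perturbation_ae (v : HalfFun) :
    legendreOp (perturbation v) =ᵐ[sinMeasure]
      fun θ => -(Real.sin θ * oddExt v (Real.cos θ)) := by
  filter_upwards [ae_sinMeasure_mem] with θ hθ using legendreOp_perturbation v hθ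

lemma abs_sin_mul_oddExt_le (v : HalfFun) (θ : ℝ) :
    ‖-(Real.sin θ * oddExt v (Real.cos θ))‖ ≤ ‖v‖ := by
  rw [norm_neg, norm_mul, Real.norm_eq_abs, Real.norm_eq_abs]
  nlinarith [Real.abs_sin_le_one θ, abs_oddExt_le_norm v (Real.cos θ),
    abs_nonneg (oddExt v (Real.cos θ)), abs_nonneg (Real.sin θ)]

lemma perturbation_mem_legendreDomain (v : HalfFun) : perturbation v ∈ legendreDomain := by
  have hsub : ∀ {a b : ℝ}, 0 < a → a ≤ b → b < Real.pi → uIcc a b ⊆ Ioo 0 Real.pi := by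
    intro a b ha hab hb
    rw [uIcc_of_le hab]
    exact fun t ht => ⟨ha.trans_le ht.1, ht.2.trans_lt hb⟩
  refine ⟨MemLp.of_bound (continuous_perturbation v).aestronglyMeasurable ‖v‖
    (Eventually.of_forall fun θ => abs_perturbation_le v θ), fun a b ha hab hb => ?_,
    fun a b ha hab hb => ?_, ?_⟩
  · refine ContDiffOn.absolutelyContinuousOnInterval fun θ hθ => ContDiffAt.contDiffWithinAt ?_
    exact contDiffAt_one_of_hasDerivAt isOpen_Ioo (fun t ht => hasDerivAt_perturbation v ht)
      ((continuous_greenD v).comp Real.continuous_cos).continuousOn (hsub ha hab hb hθ)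
  · refine ContDiffOn.absolutelyContinuousOnInterval ?_
    have h1 : ContDiffOn ℝ 1 (fun t => greenD v (Real.cos t) * Real.sin t) (uIcc a b) := by
      refine ContDiffOn.mul (fun θ hθ => ContDiffAt.contDiffWithinAt ?_)
        Real.contDiff_sin.contDiffOn
      exact contDiffAt_one_of_hasDerivAt isOpen_Ioo (fun t ht => hasDerivAt_greenD_cos v ht)
        (continuousOn_greenD_cos_deriv v) (hsub ha hab hb hθ)
    exact h1.congr fun t ht => by rw [deriv_perturbation v (hsub ha hab hb ht)]
  · refine MemLp.ae_eq (legendreOp_perturbation_ae v).symm (MemLp.of_bound ?_ ‖v‖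
      (Eventually.of_forall fun θ => abs_sin_mul_oddExt_le v θ))
    exact (Real.measurable_sin.mul ((measurable_oddExt v).comp
      Real.measurable_cos)).neg.aestronglyMeasurable

/-- The map `v ↦ η` is bounded from the supremum norm to the graph norm. -/
lemma exists_graphNorm_perturbation_le :
    ∃ K : ℝ, ∀ v : HalfFun, graphNorm (perturbation v) ≤ K * ‖v‖ := by
  set C : ENNReal := sinMeasure univ ^ (2 : ENNReal).toReal⁻¹ with hC
  have hCt : C ≠ ⊤ := ENNReal.rpow_ne_top_of_nonneg (by norm_num) (measure_ne_top _ _)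
  refine ⟨2 * C.toReal, fun v => ?_⟩
  have key : ∀ f : ℝ → ℝ, (∀ᵐ θ ∂sinMeasure, ‖f θ‖ ≤ ‖v‖) →
      (eLpNorm f 2 sinMeasure).toReal ≤ C.toReal * ‖v‖ := by
    intro f hf
    have h := ENNReal.toReal_mono (ENNReal.mul_ne_top hCt ENNReal.ofReal_ne_top)
      (eLpNorm_le_of_ae_bound (p := 2) hf)
    rwa [ENNReal.toReal_mul, ENNReal.toReal_ofReal (norm_nonneg _)] at h
  have h1 := key (perturbation v) (Eventually.of_forall fun θ => abs_perturbation_le v θ)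
  have h2 := key (legendreOp (perturbation v)) <| by
    filter_upwards [legendreOp_perturbation_ae v] with θ hθ
    rw [hθ]
    exact abs_sin_mul_oddExt_le v θ
  rw [graphNorm]
  linarith

lemma isC1InGraphNorm_perturbation {I : Set ℝ} (hI : IsOpen I) {v v' : ℝ → HalfFun}
    (hv : ∀ κ ∈ I, HasDerivAt v (v' κ) κ) (hv' : ContinuousOn v' I) :
    IsC1InGraphNorm I fun κ => perturbation (v κ) := by
  obtain ⟨K, hK⟩ := exists_graphNorm_perturbation_le
  have hnn : ∀ f, 0 ≤ graphNorm f := fun f => add_nonneg ENNReal.toReal_nonneg ENNReal.toReal_nonneg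
  have key : ∀ {l : Filter ℝ} {g : ℝ → HalfFun} {g₀ : HalfFun}, Tendsto g l (𝓝 g₀) →
      Tendsto (fun s => graphNorm (perturbation (g s - g₀))) l (𝓝 0) := by
    intro l g g₀ hg
    refine squeeze_zero (fun _ => hnn _) (fun s => hK _) ?_
    have := (hg.sub_const g₀).norm.const_mul K
    simpa using this
  refine ⟨fun κ _ => perturbation_mem_legendreDomain _, fun κ => perturbation (v' κ),
    fun κ _ => perturbation_mem_legendreDomain _, fun κ hκ => ?_, fun κ hκ => ?_⟩
  · have := key (hasDerivAt_iff_tendsto_slope.1 (hv κ hκ))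
    refine this.congr fun s => ?_
    congr 1
    ext θ
    rw [perturbation_sub, slope_def_module, perturbation_smul, perturbation_sub]
  · have := key (hv'.continuousAt (hI.mem_nhds hκ)).tendsto
    refine this.congr fun s => ?_
    congr 1
    ext θ
    rw [perturbation_sub]

lemma profile_mem_profileClass (v : HalfFun) : profile v ∈ profileClass 0 2 := by
  have hc : Continuous fun t => greenD v (Real.cos t) :=
    (continuous_greenD v).comp Real.continuous_cos
  refine ⟨⟨?_, 1, fun i => i * Real.pi, by simp, by simp, fun i hi => ?_, fun i hi => ?_⟩, ?_, ?_⟩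
  · exact ((continuous_const.mul continuous_id).add (continuous_perturbation v)).continuousOn
  · have := Real.pi_pos
    push_cast
    linarith
  · obtain rfl : i = 0 := by omega
    simp only [Nat.cast_zero, zero_mul, zero_add, Nat.cast_one, one_mul]
    -- The derivative extends continuously to the end points, so the profile is a primitive of it.
    have hG : ∀ θ, HasDerivAt (fun θ => ∫ t in (0 : ℝ)..θ, greenD v (Real.cos t))
        (greenD v (Real.cos θ)) θ := fun θ => intervalIntegral.integral_hasDerivAt_right
      (hc.intervalIntegrable _ _) (hc.stronglyMeasurableAtFilter _ _) hc.continuousAt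
    have hG1 : ContDiff ℝ 1 fun θ => ∫ t in (0 : ℝ)..θ, greenD v (Real.cos t) :=
      contDiff_one_iff_deriv.2 ⟨fun θ => (hG θ).differentiableAt, by
        rw [show deriv (fun θ => ∫ t in (0 : ℝ)..θ, greenD v (Real.cos t)) =
          fun θ => greenD v (Real.cos θ) from funext fun θ => (hG θ).deriv]
        exact hc⟩
    have h2 : ContDiff ℝ 1 fun θ => 2 * θ + ∫ t in (0 : ℝ)..θ, greenD v (Real.cos t) :=
      (contDiff_const.mul contDiff_id).add hG1
    refine h2.contDiffOn.congr fun θ hθ => ?_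
    rw [profile, intervalIntegral.integral_eq_sub_of_hasDerivAt_of_le (f := perturbation v) hθ.1
      (continuous_perturbation v).continuousOn
      (fun t ht => hasDerivAt_perturbation v ⟨ht.1, ht.2.trans_le hθ.2⟩)
      (hc.intervalIntegrable _ _)]
    simp [perturbation]
  · simp [profile, perturbation]
  · simp [profile, perturbation]

lemma hasDerivAt_profile (v : HalfFun) {θ : ℝ} (hθ : θ ∈ Ioo 0 Real.pi) :
    HasDerivAt (profile v) (2 + greenD v (Real.cos θ)) θ := by
  have h : HasDerivAt (profile v) _ θ :=
    ((hasDerivAt_id θ).const_mul 2).add (hasDerivAt_perturbation v hθ)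
  simpa using h

/-- The fixed point equation for the right-hand side of the linearized equation. -/
def IsFixedRhs (κ : ℝ) (v : HalfFun) : Prop :=
  ∀ z : Ioo (0 : ℝ) 1, v z = dirichletPart z (greenW v z / z) -
    κ / 2 * anisotropyPart z (greenW v z / z)

/-- The fixed point equation in terms of `γ` and `w`. It extends from the upper to the lower half
of the sphere because all functions involved are odd. -/
lemma IsFixedRhs.identity {κ : ℝ} {v : HalfFun} (hv : IsFixedRhs κ v) {z : ℝ}
    (hz : z ∈ Ioo (-1 : ℝ) 1) :
    2 * √(1 - z ^ 2) ^ 3 * oddExt v z = 2 * √(1 - z ^ 2) * (greenW v z + 2 * z) -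
      Real.sin (4 * Real.arccos z + 2 * √(1 - z ^ 2) * greenW v z) -
      κ * √(1 - z ^ 2) ^ 2 * Real.sin (2 * Real.arccos z + 2 * √(1 - z ^ 2) * greenW v z) := by
  have hpos : ∀ {z : ℝ}, z ∈ Ioo (0 : ℝ) 1 → 2 * √(1 - z ^ 2) ^ 3 * oddExt v z =
      2 * √(1 - z ^ 2) * (greenW v z + 2 * z) -
      Real.sin (4 * Real.arccos z + 2 * √(1 - z ^ 2) * greenW v z) -
      κ * √(1 - z ^ 2) ^ 2 * Real.sin (2 * Real.arccos z + 2 * √(1 - z ^ 2) * greenW v z) := by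
    intro z hz
    have hz' := Ioo_zero_one_subset hz
    have hzI := Ioo_subset_Icc_self hz'
    have hz0 : z ≠ 0 := hz.1.ne'
    have hq0 := (sqrt_one_sub_sq_pos hz').ne'
    have hq2 := sq_sqrt_one_sub_sq hzI
    have h := hv ⟨z, hz⟩
    have hs4 := sin_four_arccos hzI
    have e : 2 * √(1 - z ^ 2) * z * (greenW v z / z) = 2 * √(1 - z ^ 2) * greenW v z := by
      field_simp
    simp only [dirichletPart, anisotropyPart] at h
    rw [e] at h
    rw [oddExt_of_mem v hz, h, hs4]
    generalize Real.sin (4 * Real.arccos z + 2 * √(1 - z ^ 2) * greenW v z) = S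
    generalize Real.sin (2 * Real.arccos z + 2 * √(1 - z ^ 2) * greenW v z) = T
    set q := √(1 - z ^ 2)
    have hz2 : z ^ 2 = 1 - q ^ 2 := by linarith
    field_simp
    rw [hz2]
    ring
  rcases lt_trichotomy z 0 with h | h | h
  · have hp := hpos (z := -z) ⟨by linarith, by linarith [hz.1]⟩
    rw [neg_sq, oddExt_neg, greenW_neg, Real.arccos_neg] at hp
    have e1 : Real.sin (4 * (Real.pi - Real.arccos z) + 2 * √(1 - z ^ 2) * -greenW v z) =
        -Real.sin (4 * Real.arccos z + 2 * √(1 - z ^ 2) * greenW v z) := by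
      rw [← Real.sin_neg, ← Real.sin_add_nat_mul_two_pi (-(_ + _)) 2]
      congr 1
      push_cast
      ring
    have e2 : Real.sin (2 * (Real.pi - Real.arccos z) + 2 * √(1 - z ^ 2) * -greenW v z) =
        -Real.sin (2 * Real.arccos z + 2 * √(1 - z ^ 2) * greenW v z) := by
      rw [← Real.sin_neg, ← Real.sin_add_nat_mul_two_pi (-(_ + _)) 1]
      congr 1
      push_cast
      ring
    rw [e1, e2] at hp
    linarith
  · subst h
    have hw : greenW v 0 = 0 := by
      have := greenW_neg v 0
      rw [neg_zero] at this
      linarith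
    have hγ : oddExt v 0 = 0 := by simp [oddExt]
    rw [hw, hγ, Real.arccos_zero]
    have e1 : Real.sin (4 * (Real.pi / 2)) = 0 := by
      rw [show 4 * (Real.pi / 2) = 2 * Real.pi by ring, Real.sin_two_pi]
    have e2 : Real.sin (2 * (Real.pi / 2)) = 0 := by
      rw [mul_div_cancel₀ _ two_ne_zero, Real.sin_pi]
    simp [e1, e2]
  · exact hpos ⟨h, hz.2⟩

lemma IsFixedRhs.solvesProfileEq {κ : ℝ} {v : HalfFun} (hv : IsFixedRhs κ v) :
    SolvesProfileEq κ (profile v) := by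
  have hd2 : ∀ θ ∈ Ioo 0 Real.pi, HasDerivAt (deriv (profile v))
      ((oddExt v (Real.cos θ) - greenW v (Real.cos θ) -
        Real.cos θ * greenW' v (Real.cos θ)) * -Real.sin θ) θ := fun θ hθ =>
    ((hasDerivAt_greenD_cos v hθ).const_add 2).congr_of_eventuallyEq <| by
      filter_upwards [isOpen_Ioo.mem_nhds hθ] with t ht using (hasDerivAt_profile v ht).deriv
  constructor
  · rw [show (2 : WithTop ℕ∞) = 1 + 1 by norm_num, contDiffOn_succ_iff_deriv_of_isOpen isOpen_Ioo]
    refine ⟨fun θ hθ => (hasDerivAt_profile v hθ).differentiableAt.differentiableWithinAt,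
      by simp, fun θ hθ => ContDiffAt.contDiffWithinAt ?_⟩
    exact contDiffAt_one_of_hasDerivAt isOpen_Ioo hd2 (continuousOn_greenD_cos_deriv v) hθ
  · intro θ hθ
    rw [(hd2 θ hθ).deriv, (hasDerivAt_profile v hθ).deriv, greenD_eq v (cos_mem_Ioo hθ)]
    have hid := hv.identity (cos_mem_Ioo hθ)
    have hsp := Real.sin_pos_of_mem_Ioo hθ
    have h2 := Real.sin_sq_add_cos_sq θ
    rw [← Real.abs_sin_eq_sqrt_one_sub_cos_sq, abs_of_pos hsp, Real.arccos_cos hθ.1.le hθ.2.le] at hid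
    have e1 : 2 * profile v θ = 4 * θ + 2 * Real.sin θ * greenW v (Real.cos θ) := by
      rw [profile, perturbation]; ring
    have e2 : 2 * profile v θ - 2 * θ = 2 * θ + 2 * Real.sin θ * greenW v (Real.cos θ) := by
      rw [e1]; ring
    rw [e2, e1]
    generalize Real.sin (4 * θ + 2 * Real.sin θ * greenW v (Real.cos θ)) = S at *
    generalize Real.sin (2 * θ + 2 * Real.sin θ * greenW v (Real.cos θ)) = T at *
    have hs := hsp.ne'
    field_simp
    linear_combination hid - (2 * Real.sin θ * (greenW v (Real.cos θ) +
      Real.cos θ * greenW' v (Real.cos θ))) * h2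

/-! ### The axisymmetric maps as zonal maps -/

/-- The function `sin h / sin θ` of `z = cos θ`. -/
noncomputable def profileA (v : HalfFun) (z : ℝ) : ℝ :=
  Real.sin (profile v (Real.arccos z)) / √(1 - z ^ 2)

/-- The function `cos h` of `z = cos θ`. -/
noncomputable def profileB (v : HalfFun) (z : ℝ) : ℝ := Real.cos (profile v (Real.arccos z))

lemma profile_arccos (v : HalfFun) {z : ℝ} (hz : z ∈ Icc (-1 : ℝ) 1) :
    profile v (Real.arccos z) = 2 * Real.arccos z + √(1 - z ^ 2) * greenW v z := by
  rw [profile, perturbation, Real.sin_arccos, Real.cos_arccos hz.1 hz.2]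

lemma axisymmetricMap_profile (v : HalfFun) :
    axisymmetricMap (profile v) = zonalMap (profileA v) (profileB v) := by
  ext1 x
  have hx := x.sq_sum
  have hxI := x.apply_mem_Icc 2
  have hnorm : ‖(⟨(x : E3) 0, (x : E3) 1⟩ : ℂ)‖ = √(1 - (x : E3) 2 ^ 2) := by
    rw [Complex.norm_def, Complex.normSq_mk]
    congr 1
    linarith
  by_cases hq : √(1 - (x : E3) 2 ^ 2) = 0
  · -- At the poles both sides are `(0, 0, cos h)` since `sin h = 0` there.
    have h0 : (⟨(x : E3) 0, (x : E3) 1⟩ : ℂ) = 0 := norm_eq_zero.1 (hnorm.trans hq)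
    have hx0 : (x : E3) 0 = 0 := congrArg Complex.re h0
    have hx1 : (x : E3) 1 = 0 := congrArg Complex.im h0
    have hsin : Real.sin (profile v (Real.arccos ((x : E3) 2))) = 0 := by
      rw [profile_arccos v hxI, hq, zero_mul, add_zero, sin_two_arccos hxI, hq]
      ring
    ext k
    fin_cases k <;>
      simp [axisymmetricMap, sphericalCoord, polarAngle, zonalMap, zonalPt, profileB, hsin, hx0, hx1]
  · have hne : (⟨(x : E3) 0, (x : E3) 1⟩ : ℂ) ≠ 0 := fun h => hq (by rw [← hnorm, h, norm_zero])
    have hc : Real.cos (azimuth x) = (x : E3) 0 / √(1 - (x : E3) 2 ^ 2) := by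
      rw [azimuth, Complex.cos_arg hne, hnorm]
    have hs : Real.sin (azimuth x) = (x : E3) 1 / √(1 - (x : E3) 2 ^ 2) := by
      rw [azimuth, Complex.sin_arg, hnorm]
    ext k
    fin_cases k <;>
      simp [axisymmetricMap, sphericalCoord, polarAngle, zonalMap, zonalPt, profileA, profileB, hc,
        hs] <;> ring

lemma hasDerivAt_profile_arccos (v : HalfFun) {z : ℝ} (hz : z ∈ Ioo (-1 : ℝ) 1) :
    HasDerivAt (fun z => profile v (Real.arccos z)) ((2 + greenD v z) * -(1 / √(1 - z ^ 2))) z := by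
  have hθ : Real.arccos z ∈ Ioo 0 Real.pi := by
    refine ⟨Real.arccos_pos.2 hz.2, lt_of_le_of_ne (Real.arccos_le_pi z) fun h => ?_⟩
    rw [Real.arccos_eq_pi] at h
    linarith [hz.1]
  have h1 := hasDerivAt_profile v hθ
  rw [Real.cos_arccos hz.1.le hz.2.le] at h1
  exact h1.comp z (Real.hasDerivAt_arccos hz.1.ne' hz.2.ne)

lemma hasDerivAt_sqrt_one_sub_sq {z : ℝ} (hz : z ∈ Ioo (-1 : ℝ) 1) :
    HasDerivAt (fun z => √(1 - z ^ 2)) (-z / √(1 - z ^ 2)) z := by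
  have h1 : HasDerivAt (fun z : ℝ => 1 - z ^ 2) (-(2 * z)) z := by
    simpa using ((hasDerivAt_id z).pow 2).const_sub 1
  refine (h1.sqrt (one_sub_sq_pos hz).ne').congr_deriv ?_
  have := (sqrt_one_sub_sq_pos hz).ne'
  field_simp

lemma abs_sin_sub_mul_cos_le (x : ℝ) : |Real.sin x - x * Real.cos x| ≤ |x| ^ 3 := by
  have hd : ∀ t : ℝ, HasDerivAt (fun t => Real.sin t - t * Real.cos t) (t * Real.sin t) t := by
    intro t
    have h : HasDerivAt (fun t => Real.sin t - t * Real.cos t) _ t :=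
      (Real.hasDerivAt_sin t).sub ((hasDerivAt_id t).mul (Real.hasDerivAt_cos t))
    refine h.congr_deriv ?_
    simp only [id]
    ring
  have h := (convex_Icc (-|x|) |x|).norm_image_sub_le_of_norm_hasDerivWithin_le
    (f := fun t => Real.sin t - t * Real.cos t) (C := |x| ^ 2) (x := 0) (y := x)
    (fun t _ => (hd t).hasDerivWithinAt) (fun t ht => ?_) (by simp) ⟨neg_abs_le x, le_abs_self x⟩
  · simp only [Real.sin_zero, zero_mul, sub_zero, Real.norm_eq_abs] at h
    calc _ ≤ |x| ^ 2 * |x| := h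
      _ = |x| ^ 3 := by ring
  · have ht' := abs_le.2 ht
    have hs := (Real.abs_sin_le_abs (x := t)).trans ht'
    rw [norm_mul, Real.norm_eq_abs, Real.norm_eq_abs, sq]
    exact mul_le_mul ht' hs (abs_nonneg _) (abs_nonneg _)

/-- Near the poles `z a - b y` is of order `1 - z²`, because `sin h / sin θ` and `h' cos h / cos θ`
agree to first order. -/
lemma abs_mul_profileA_sub_le (v : HalfFun) (hv : ‖v‖ ≤ 1 / 100) {z : ℝ} (hz : z ∈ Ioo (-1 : ℝ) 1) :
    |z * profileA v z - profileB v z * (2 + greenD v z)| ≤ 3 * (1 - z ^ 2) := by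
  have hzI := Ioo_subset_Icc_self hz
  have hqp := sqrt_one_sub_sq_pos hz
  have hq2 := sq_sqrt_one_sub_sq hzI
  have hz1 := abs_le.2 hzI
  obtain ⟨hw, -, hw'⟩ := abs_green_le v hzI
  have hb : |profileB v z| ≤ 1 := Real.abs_cos_le_one _
  have hB : profileB v z = (2 * z ^ 2 - 1) * Real.cos (√(1 - z ^ 2) * greenW v z) -
      2 * √(1 - z ^ 2) * z * Real.sin (√(1 - z ^ 2) * greenW v z) := by
    rw [profileB, profile_arccos v hzI, Real.cos_add, sin_two_arccos hzI, cos_two_arccos hzI]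
  have hA : profileA v z = 2 * z * Real.cos (√(1 - z ^ 2) * greenW v z) +
      (2 * z ^ 2 - 1) * (Real.sin (√(1 - z ^ 2) * greenW v z) / √(1 - z ^ 2)) := by
    rw [profileA, profile_arccos v hzI, Real.sin_add, sin_two_arccos hzI, cos_two_arccos hzI]
    have := hqp.ne'
    field_simp
  have hcub := abs_sin_sub_mul_cos_le (√(1 - z ^ 2) * greenW v z)
  have hsin := Real.abs_sin_le_abs (x := √(1 - z ^ 2) * greenW v z)
  have hcos := Real.abs_cos_le_one (√(1 - z ^ 2) * greenW v z)
  rw [greenD_eq v hz]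
  set q := √(1 - z ^ 2)
  set w := greenW v z
  set w' := greenW' v z
  set c := Real.cos (q * w)
  obtain ⟨S, hS⟩ : ∃ S, Real.sin (q * w) = q * S := ⟨Real.sin (q * w) / q, by field_simp⟩
  rw [hS, mul_div_cancel_left₀ _ hqp.ne'] at hA
  rw [hS] at hB hcub hsin
  have hSw : |S| ≤ 1 / 100 := by
    rw [abs_mul, abs_mul, abs_of_pos hqp] at hsin
    linarith [le_of_mul_le_mul_left hsin hqp]
  have hSc : |S - w * c| ≤ q ^ 2 * (1 / 100) := by
    rw [show q * S - q * w * c = q * (S - w * c) by ring, abs_mul, abs_mul, abs_of_pos hqp,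
      mul_pow, show q ^ 3 * |w| ^ 3 = q * (q ^ 2 * |w| ^ 3) by ring] at hcub
    refine (le_of_mul_le_mul_left hcub hqp).trans ?_
    have : |w| ^ 3 ≤ 1 / 100 := by
      have h1 : |w| ≤ 1 / 100 := hw.trans hv
      calc |w| ^ 3 ≤ (1 / 100) ^ 3 := pow_le_pow_left₀ (abs_nonneg _) h1 3
        _ ≤ 1 / 100 := by norm_num
    gcongr
  have e : z * profileA v z - profileB v z * (2 + (z * w - (1 - z ^ 2) * w')) =
      z * (S - w * c) + q ^ 2 * (2 * c + 2 * (z * S) + 2 * (z * w * c) + 2 * (z * S * (z * w)) +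
        w' * profileB v z) := by
    rw [← hq2]
    have hz2 : z ^ 2 = 1 - q ^ 2 := by linarith
    rw [hA]
    have hB' : profileB v z = (1 - 2 * q ^ 2) * c - 2 * q ^ 2 * (z * S) := by
      rw [hB, hz2]; ring
    have : profileB v z * (2 + (z * w - q ^ 2 * w')) = profileB v z * (2 + z * w) -
        q ^ 2 * (w' * profileB v z) := by ring
    rw [this]
    nth_rewrite 1 [hB']
    linear_combination (2 * c + 2 * z * S) * hz2
  have hmul : ∀ {s t K : ℝ}, |s| ≤ 1 → |t| ≤ K → |s * t| ≤ K := fun {s t K} hs ht => by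
    rw [abs_mul]; nlinarith [abs_nonneg s, abs_nonneg t]
  have hw1 : |w| ≤ 1 / 100 := hw.trans hv
  have b1 := hmul hz1 hSc
  have b2 : |z * S| ≤ 1 / 100 := hmul hz1 hSw
  have b3 : |z * w * c| ≤ 1 / 100 := by
    rw [mul_comm]; exact hmul hcos (hmul hz1 hw1)
  have b4 : |z * S * (z * w)| ≤ 1 / 100 := hmul (b2.trans (by norm_num)) (hmul hz1 hw1)
  have b5 : |w' * profileB v z| ≤ 1 / 100 := by
    rw [mul_comm]; exact hmul hb (hw'.trans hv)
  have b6 : |2 * c + 2 * (z * S) + 2 * (z * w * c) + 2 * (z * S * (z * w)) +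
      w' * profileB v z| ≤ 5 / 2 := by
    rw [abs_le] at *
    constructor <;> linarith
  rw [e]
  refine (abs_add_le _ _).trans ?_
  rw [abs_mul (q ^ 2), abs_of_nonneg (sq_nonneg q), ← hq2]
  nlinarith [sq_nonneg q, mul_le_mul_of_nonneg_left b6 (sq_nonneg q)]

lemma IsFixedRhs.zonalSolution {κ : ℝ} {v : HalfFun} (hv : IsFixedRhs κ v) (hvn : ‖v‖ ≤ 1 / 100) :
    ZonalSolution κ (profileA v) (profileB v) (fun z => 2 + greenD v z)
      (fun z => (z * profileA v z - profileB v z * (2 + greenD v z)) / (1 - z ^ 2))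
      (fun z => oddExt v z - greenW v z - z * greenW' v z) 3 where
  hasDerivAt_a z hz := by
    have hq0 := (sqrt_one_sub_sq_pos hz).ne'
    have h : HasDerivAt (profileA v) _ z :=
      (hasDerivAt_profile_arccos v hz).sin.div (hasDerivAt_sqrt_one_sub_sq hz) hq0
    refine h.congr_deriv ?_
    have hq2 := sq_sqrt_one_sub_sq (Ioo_subset_Icc_self hz)
    rw [profileA, profileB]
    set q := √(1 - z ^ 2)
    rw [← hq2]
    field_simp
    ring
  hasDerivAt_b z hz := by
    have h : HasDerivAt (profileB v) _ z := (hasDerivAt_profile_arccos v hz).cos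
    refine h.congr_deriv ?_
    rw [profileA]
    ring
  hasDerivAt_y z hz := (hasDerivAt_greenD v hz).const_add 2
  a'_eq z hz := mul_div_cancel₀ _ (one_sub_sq_pos hz).ne'
  y'_eq z hz := by
    have hzI := Ioo_subset_Icc_self hz
    have hid := hv.identity hz
    have hq0 := (sqrt_one_sub_sq_pos hz).ne'
    have hq2 := sq_sqrt_one_sub_sq hzI
    have e1 : 4 * Real.arccos z + 2 * √(1 - z ^ 2) * greenW v z =
        2 * profile v (Real.arccos z) := by
      rw [profile_arccos v hzI]; ring
    have e2 : 2 * Real.arccos z + 2 * √(1 - z ^ 2) * greenW v z =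
        2 * (profile v (Real.arccos z) - Real.arccos z) := by
      rw [profile_arccos v hzI]; ring
    rw [e1, e2, Real.sin_two_mul, Real.sin_two_mul, Real.sin_sub, Real.cos_sub, Real.sin_arccos,
      Real.cos_arccos hz.1.le hz.2.le] at hid
    rw [greenD_eq v hz, profileA, profileB]
    generalize Real.sin (profile v (Real.arccos z)) = s at *
    generalize Real.cos (profile v (Real.arccos z)) = c at *
    set q := √(1 - z ^ 2)
    rw [← hq2]
    have hz2 : z ^ 2 = 1 - q ^ 2 := by linarith
    field_simp
    linear_combination (1 / 2) * hid - (q * greenW v z) * hz2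
  sq_add_sq z hz := by
    rw [profileA, profileB, div_pow, sq_sqrt_one_sub_sq hz]
    by_cases h0 : 1 - z ^ 2 = 0
    · have hs : Real.sin (profile v (Real.arccos z)) = 0 := by
        rw [profile_arccos v hz, h0, Real.sqrt_zero, zero_mul, add_zero, sin_two_arccos hz, h0,
          Real.sqrt_zero]
        ring
      have := Real.sin_sq_add_cos_sq (profile v (Real.arccos z))
      rw [hs] at this
      rw [h0]
      linarith
    · rw [mul_div_cancel₀ _ h0, Real.sin_sq_add_cos_sq]
  one_le := by norm_num
  abs_a_le z hz := by
    rw [profileA, abs_div, abs_of_nonneg (Real.sqrt_nonneg _)]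
    refine div_le_of_le_mul₀ (Real.sqrt_nonneg _) (by norm_num) ?_
    rw [profile_arccos v hz]
    refine (abs_sin_add_le _ _).trans ?_
    have hq := Real.sqrt_nonneg (1 - z ^ 2)
    have hw := (abs_green_le v hz).1.trans hvn
    have hz1 := abs_le.2 hz
    rw [sin_two_arccos hz, abs_mul, abs_mul, abs_mul, abs_two, abs_of_nonneg hq]
    nlinarith
  abs_y_le z hz := by
    have := (abs_green_le v hz).2.1.trans hvn
    rw [abs_le] at *
    constructor <;> linarith
  abs_a'_le z hz := by
    by_cases h0 : z ∈ Ioo (-1 : ℝ) 1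
    · rw [abs_div, abs_of_nonneg (one_sub_sq_mem hz).1, div_le_iff₀ (one_sub_sq_pos h0)]
      exact abs_mul_profileA_sub_le v hvn h0
    · -- At the poles the quotient is `0` by the convention for division by zero.
      have hz2 : 1 - z ^ 2 = 0 := by
        by_contra hne
        have := lt_of_le_of_ne (one_sub_sq_mem hz).1 (Ne.symm hne)
        exact h0 (abs_lt.1 ((sq_lt_one_iff_abs_lt_one z).1 (by linarith)))
      rw [hz2, div_zero, abs_zero]
      norm_num
  abs_y'_le z hz := by
    obtain ⟨h1, h2, h3⟩ := abs_green_le v hz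
    have h4 := abs_oddExt_le_norm v z
    have h5 : |z * greenW' v z| ≤ ‖v‖ := by
      rw [abs_mul]
      nlinarith [abs_le.2 hz, abs_nonneg z, abs_nonneg (greenW' v z)]
    rw [abs_le] at *
    constructor <;> linarith

lemma IsFixedRhs.isSaddlePoint {κ : ℝ} {v : HalfFun} (hv : IsFixedRhs κ v) (hvn : ‖v‖ ≤ 1 / 100)
    (hκ : |κ - 4| ≤ 1 / 20) : IsSaddlePoint κ (axisymmetricMap (profile v)) := by
  rw [axisymmetricMap_profile]
  have hqw : ∀ z ∈ Ioo (-1 : ℝ) 1, |√(1 - z ^ 2) * greenW v z| ≤ 1 / 100 := fun z hz => by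
    rw [abs_mul, abs_of_nonneg (Real.sqrt_nonneg _)]
    have hw := (abs_green_le v (Ioo_subset_Icc_self hz)).1.trans hvn
    nlinarith [sqrt_one_sub_sq_le_one z, Real.sqrt_nonneg (1 - z ^ 2), abs_nonneg (greenW v z)]
  have hqa : ∀ z ∈ Ioo (-1 : ℝ) 1,
      √(1 - z ^ 2) * profileA v z = Real.sin (profile v (Real.arccos z)) := fun z hz => by
    rw [profileA, mul_div_cancel₀ _ (sqrt_one_sub_sq_pos hz).ne']
  refine (hv.zonalSolution hvn).isSaddlePoint hκ (δ := 1 / 50) (by norm_num) le_rfl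
    (fun z hz => ?_) fun z hz => ?_
  · have hzI := Ioo_subset_Icc_self hz
    have hq2 := sq_sqrt_one_sub_sq hzI
    have e : profileB v z ^ 2 - (1 - z ^ 2) * profileA v z ^ 2 =
        Real.cos (4 * Real.arccos z + 2 * (√(1 - z ^ 2) * greenW v z)) := by
      rw [show (1 - z ^ 2) * profileA v z ^ 2 = (√(1 - z ^ 2) * profileA v z) ^ 2 by
        rw [mul_pow, hq2], hqa z hz, profileB, ← Real.cos_two_mul',
        profile_arccos v hzI]
      congr 1
      ring
    have := (abs_cos_add_sub_cos_add_le (4 * Real.arccos z) (√(1 - z ^ 2) * greenW v z) 0).2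
    rw [mul_zero, add_zero, sub_zero, cos_four_arccos hzI] at this
    rw [e]
    linarith [hqw z hz]
  · have hzI := Ioo_subset_Icc_self hz
    have hq2 := sq_sqrt_one_sub_sq hzI
    have hc := Real.cos_arccos hz.1.le hz.2.le
    have hs := Real.sin_arccos z
    have e1 : (1 - z ^ 2) * profileA v z + z * profileB v z =
        Real.cos (profile v (Real.arccos z) - Real.arccos z) := by
      rw [Real.cos_sub, hc, hs, ← hqa z hz, profileB]
      linear_combination (-profileA v z) * hq2
    have e2 : (1 - z ^ 2) * (profileB v z - z * profileA v z) ^ 2 =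
        Real.sin (profile v (Real.arccos z) - Real.arccos z) ^ 2 := by
      rw [Real.sin_sub, hc, hs, ← hqa z hz, ← profileB]
      linear_combination (-(profileB v z - z * profileA v z) ^ 2) * hq2
    rw [e1, e2, ← Real.cos_two_mul', profile_arccos v hzI]
    have := (abs_cos_add_sub_cos_add_le (2 * Real.arccos z) (√(1 - z ^ 2) * greenW v z) 0).2
    rw [mul_zero, add_zero, sub_zero, cos_two_arccos hzI] at this
    rw [show 2 * (2 * Real.arccos z + √(1 - z ^ 2) * greenW v z - Real.arccos z) =
      2 * Real.arccos z + 2 * (√(1 - z ^ 2) * greenW v z) by ring]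
    linarith [hqw z hz]

end SphereSaddle

theorem mainTheorem9 :
    ∃ (I : Set ℝ) (h : ℝ → ℝ → ℝ),
      IsOpen I ∧ (4 : ℝ) ∈ I ∧ I ⊆ Set.Ioi 0 ∧
      (∀ θ ∈ Set.Icc 0 Real.pi, h 4 θ = 2 * θ) ∧
      (∀ κ ∈ I, h κ ∈ profileClass 0 2 ∧ SolvesProfileEq κ (h κ)) ∧
      IsC1InGraphNorm I (fun κ θ => h κ θ - 2 * θ) ∧
      ∃ κ₁ κ₂ : ℝ, 0 < κ₁ ∧ κ₁ < 4 ∧ 4 < κ₂ ∧ Set.Ioo κ₁ κ₂ ⊆ I ∧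
        ∀ κ ∈ Set.Ioo κ₁ κ₂, IsSaddlePoint κ (axisymmetricMap (h κ)) := by
  obtain ⟨I, v, v', hI, h4, hv4, hv, hv', hsmall, hfix⟩ := exists_branch
  have hIpos : I ⊆ Set.Ioi 0 := fun κ hκ => by
    have := (abs_le.1 (hsmall κ hκ).1).1
    rw [Set.mem_Ioi]
    linarith
  obtain ⟨κ₁, κ₂, h4', hsub⟩ := mem_nhds_iff_exists_Ioo_subset.1 (hI.mem_nhds h4)
  refine ⟨I, fun κ => profile (v κ), hI, h4, hIpos, fun θ _ => ?_, fun κ hκ =>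
    ⟨profile_mem_profileClass _, IsFixedRhs.solvesProfileEq (hfix κ hκ)⟩, ?_,
    max κ₁ 1, κ₂, by positivity, max_lt h4'.1 (by norm_num), h4'.2, fun κ hκ =>
      hsub ⟨(le_max_left _ _).trans_lt hκ.1, hκ.2⟩, fun κ hκ => ?_⟩
  · have := perturbation_smul 0 (v 4) θ
    rw [zero_smul, zero_mul] at this
    simp only [profile]
    rw [hv4, this, add_zero]
  · have he : (fun κ θ => profile (v κ) θ - 2 * θ) = fun κ => perturbation (v κ) := by
      ext κ θ
      rw [profile, add_sub_cancel_left]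
    rw [he]
    exact isC1InGraphNorm_perturbation hI hv hv'
  · have hκI := hsub ⟨(le_max_left _ _).trans_lt hκ.1, hκ.2⟩
    exact IsFixedRhs.isSaddlePoint (hfix κ hκI) (hsmall κ hκI).2 (hsmall κ hκI).1
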